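/- **Model.** Let $\Omega_x,\Omega_y\subseteq\mathbb R$ be Borel sets, $\rho$ and $\phi$ probability densities on $\Omega_x$ and $\Omega_y$, $\mu_y(dy)=\phi(y)\,dy$, and $\mathcal K:\Omega_x\times\Omega_y\to[0,\infty)$ a measurable kernel such that $\int_{\Omega_y}\mathcal K(x,y)\phi(y)\,dy<\infty$ for every $x\in\Omega_x$. For each $x\in\Omega_x$ let $\varrho_x$ be a probability density on $(0,\infty)$, jointly measurable in $(x,r)$, and write $\langle r^n\rangle_x=\int_0^\infty r^n\varrho_x(r)\,dr$. A trip mobility network with these data consists of locations $i=0,1,2,\dots$ such that: * (A1) the attractivenesses $x_i$ of the locations are random variables with density $\rho$, and the pairs (attractiveness, record of the trips to the location) are independent and identically distributed over the locations; * (A2) conditionally on attractiveness $x$, the trips to a location arrive with intensity $d\mathcal V_x=\mathcal K(x,y)\mu_y(dy)$ per unit time, i.e. the pairs (arrival time, productiveness of the origin) form a Poisson random measure on $[0,\infty)\times\mathbb R$ with intensity $dt\otimes\mathcal K(x,y)\mu_y(dy)$, where $\mu_y$ is regarded as a measure on $\mathbb R$ carried by $\Omega_y$; * (A3) conditionally on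 attractiveness $x$, the weights of the trips are i.i.d. with density $\varrho_x$ and independent of the arrival times and origins. The strength $\kappa$ of a location at time $t$ is the sum of the weights of all trips that have arrived there up to time $t$; its number of visits is the number of these trips. Let $p_x(d\kappa,t)$ be the law of the strength at time $t$ of a location of attractiveness $x$ (the conditional visit distribution), and let $P(d\kappa,t)=\mathbb E\big[\tfrac1n\sum_{i<n}\delta_{\kappa_i(t)}\big]$ be the overall visit distribution of the first $n\ge1$ locations. Let $\nu_x=\int_{\Omega_y}d\mathcal V_x$ be the attraction rate. **Proposition.** 1. For $x\in\Omega_x$, $\nu_x=\int_{\Omega_y}\mathcal K(x,y)\phi(y)\,dy$, and $\nu_x$ is the transition rate of the number of visits: for all $t\ge0$ and $k\in\mathbb N$, $\ \lim_{h\downarrow0}h^{-1}\,\mathbb P_x(k\text{ visits at }t,\ k+1\text{ visits at }t+h)=\nu_x\,\mathbb P_x(k\text{ visits at }t)$, where $\mathbb P_x$ is the law of the trips to a location of attractiveness $x$. 2. For $x\in\Omega_x$, the probability measures $p_x(\cdot,t)$ satisfy $p_x(\cdot,0)=\delta_0$ and the Kolmogorov–Feller master equation $$\frac{\partial}{\partial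 t}p_x(\kappa,t)=\int_0^\infty\nu_x\varrho_x(r)\,[p_x(\kappa-r,t)-p_x(\kappa,t)]\,dr,\qquad t\ge0,$$ in the sense of measures: for every Borel set $B\subseteq\mathbb R$ and $t\ge0$ (one-sided derivative at $t=0$), $\frac{d}{dt}p_x(B,t)=\int_0^\infty\nu_x\varrho_x(r)[p_x(B-r,t)-p_x(B,t)]\,dr$. They are the only family of finite measures on $\mathbb R$ that does so. Moreover $p_x(d\kappa,t)=e^{-\nu_xt}\delta_0(d\kappa)+q_x(\kappa,t)\mathbf 1_{\kappa>0}\,d\kappa$ with a measurable $q_x\ge0$ such that for almost every $\kappa>0$ and all $t\ge0$ $$\frac{\partial}{\partial t}q_x(\kappa,t)=\nu_x\Big(\int_0^\kappa\varrho_x(r)q_x(\kappa-r,t)\,dr+e^{-\nu_xt}\varrho_x(\kappa)\Big)-\nu_xq_x(\kappa,t),$$ where the integral converges. 3. If $x\in\Omega_x$, $\nu_x>0$ and $\langle r^2\rangle_x<\infty$, then as $t\to\infty$ the total variation distance between $p_x(\cdot,t)$ and the truncated normal law on $[0,\infty)$ with density $$\epsilon_t\,\frac{1}{\sqrt{2\pi\nu_x\langle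 r^2\rangle_xt}}\exp\Big(-\frac{(\kappa-\nu_x\langle r\rangle_xt)^2}{2\nu_x\langle r^2\rangle_xt}\Big),\qquad \epsilon_t=\frac{2}{1+\operatorname{erf}\Big(\frac{\nu_x\langle r\rangle_xt}{\sqrt{2\nu_x\langle r^2\rangle_xt}}\Big)},$$ tends to $0$, and $\epsilon_t\to1$. 4. For all $n\ge1$ and $t\ge0$, the overall visit distribution is the mixture $P(\cdot,t)=\int_{\Omega_x}p_x(\cdot,t)\rho(x)\,dx$. 5. Suppose that $\langle r^2\rangle_x<\infty$ for all $x\in\Omega_x$, that $\Omega_x$ is a set of unique differentiability (for instance open, or a nondegenerate interval), and that for all $\kappa\in\mathbb R$ and $t>0$ the function $z(x)=\kappa-\nu_x\langle r\rangle_xt$ is continuously differentiable on $\Omega_x$ with $z'$ nowhere zero. Then, as $t\to\infty$, $$P(\kappa,t)\sim\sum_{i}|z'(x_{0,i})|^{-1}\rho(x_{0,i}),$$ where $x_{0,i}=x_{0,i}(\kappa,t)$ are the zeros of $z$ in $\Omega_x$, in the sense that the total variation distance between $P(\cdot,t)$ and the measure whose density in $\kappa$ is the right-hand side tends to $0$.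 -/

import Mathlib

open MeasureTheory ProbabilityTheory Set Filter Topology
open scoped NNReal ENNReal

noncomputable section

namespace TripMobility

/-- The data of the visitation model: type spaces, latent-variable densities, attraction kernel
and the densities of the (positive) trip weights. -/
structure Model where
  /-- attractiveness space -/
  Ωx : Set ℝ
  /-- productiveness space -/
  Ωy : Set ℝ
  /-- attractiveness density -/
  ρ : ℝ → ℝ≥0
  /-- productiveness density -/
  φ : ℝ → ℝ≥0
  /-- attraction kernel `K x y` -/
  K : ℝ → ℝ → ℝ≥0
  /-- `weightPDF x r` is the density at `r > 0` of the weight of a trip to a destination of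
  attractiveness `x` -/
  weightPDF : ℝ → ℝ → ℝ≥0
  measurableSet_Ωx : MeasurableSet Ωx
  measurableSet_Ωy : MeasurableSet Ωy
  measurable_ρ : Measurable ρ
  measurable_φ : Measurable φ
  measurable_K : Measurable (Function.uncurry K)
  measurable_weightPDF : Measurable (Function.uncurry weightPDF)
  lintegral_ρ : ∫⁻ x in Ωx, ρ x = 1
  lintegral_φ : ∫⁻ y in Ωy, φ y = 1
  lintegral_weightPDF : ∀ x ∈ Ωx, ∫⁻ r in Ioi (0 : ℝ), weightPDF x r = 1
  lintegral_K_lt_top : ∀ x ∈ Ωx, ∫⁻ y in Ωy, (K x y : ℝ≥0∞) * φ y < ⊤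

namespace Model

variable (M : Model)

/-- Law of the attractiveness of a location. -/
def μx : Measure ℝ := (volume.restrict M.Ωx).withDensity fun x => (M.ρ x : ℝ≥0∞)

/-- Law of the productiveness of a location. -/
def μy : Measure ℝ := (volume.restrict M.Ωy).withDensity fun y => (M.φ y : ℝ≥0∞)

/-- The arrival intensity `dV_x = K(x,y) μ_y(dy)`, a measure on origin types. -/
def arrivalIntensity (x : ℝ) : Measure ℝ := M.μy.withDensity fun y => (M.K x y : ℝ≥0∞)

/-- The attraction rate `ν_x = ∫ dV_x`. -/
def rate (x : ℝ) : ℝ := (M.arrivalIntensity x).real univ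

/-- Law of the weight of a trip to a destination of attractiveness `x`. -/
def weightLaw (x : ℝ) : Measure ℝ :=
  (volume.restrict (Ioi 0)).withDensity fun r => (M.weightPDF x r : ℝ≥0∞)

/-- The moment `⟨r ^ n⟩_x` of the trip weights. -/
def weightMoment (n : ℕ) (x : ℝ) : ℝ := ∫ r in Ioi (0 : ℝ), r ^ n * M.weightPDF x r

/-- Finiteness of the second moment of the trip weights. -/
def FiniteSecondMoment (x : ℝ) : Prop :=
  IntegrableOn (fun r : ℝ => r ^ 2 * M.weightPDF x r) (Ioi 0)

/-- `z(x) = κ - ν_x ⟨r⟩_x t`. -/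
def z (κ t x : ℝ) : ℝ := κ - M.rate x * M.weightMoment 1 x * t

/-- `∑ |z'(x₀)|⁻¹ ρ(x₀)` over the zeros `x₀ ∈ Ω_x` of `z`. -/
def rootSum (κ t : ℝ) : ℝ≥0∞ :=
  ∑' x : {x : ℝ // x ∈ M.Ωx ∧ M.z κ t x = 0},
    ENNReal.ofReal (|derivWithin (M.z κ t) M.Ωx x|⁻¹ * M.ρ x)

end Model

/-- A trip: its arrival time (`⊤` if it never arrives), the productiveness of its origin, and its
weight. -/
abbrev Trip : Type := ℝ≥0∞ × ℝ × ℝ≥0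

/-- The record of all trips to one destination. The labels carry no meaning; in particular they
need not follow the order of arrival. -/
abbrev TripRecord : Type := ℕ → Trip

/-- Number of arriving trips whose pair (arrival time, origin) lies in `B`. -/
def tripCount (B : Set (ℝ × ℝ)) (τ : TripRecord) : ℕ∞ :=
  Set.encard {k | (τ k).1 ≠ ⊤ ∧ ((τ k).1.toReal, (τ k).2.1) ∈ B}

/-- Number of visits (in-degree) up to time `t`. -/
def visits (t : ℝ) (τ : TripRecord) : ℕ∞ := Set.encard {k | (τ k).1 ≤ ENNReal.ofReal t}

open Classical in
/-- Visit strength (weighted in-degree) at time `t`: the sum of the weights of all trips arrived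
up to time `t`. -/
def strength (t : ℝ) (τ : TripRecord) : ℝ :=
  (∑' k, if (τ k).1 ≤ ENNReal.ofReal t then ((τ k).2.2 : ℝ≥0∞) else 0).toReal

/-- Under `Q`, the pairs (arrival time, origin) form a Poisson random measure on
`[0, ∞) × ℝ` with intensity `dt ⊗ V(dy)`. -/
structure IsPoissonArrival (Q : Measure TripRecord) (V : Measure ℝ) : Prop where
  poisson : ∀ (B : Set (ℝ × ℝ)) (l : ℝ≥0), MeasurableSet B →
    ((volume.restrict (Ici (0 : ℝ))).prod V) B = l →
    ∀ n : ℕ, Q {τ | tripCount B τ = n} = poissonMeasure l {n}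
  indep : ∀ (m : ℕ) (B : Fin m → Set (ℝ × ℝ)), (∀ i, MeasurableSet (B i)) →
    Pairwise (Function.onFun Disjoint B) → iIndepFun (fun i => tripCount (B i)) Q

/-- Under `Q`, the weights are i.i.d. with law `W`, and independent of arrival times and
origins. -/
structure HasIIDWeights (Q : Measure TripRecord) (W : Measure ℝ) : Prop where
  law : ∀ k, Q.map (fun τ => ((τ k).2.2 : ℝ)) = W
  iIndep : iIndepFun (fun k (τ : TripRecord) => (τ k).2.2) Q
  indep_arrivals : IndepFun (fun (τ : TripRecord) k => (τ k).2.2)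
    (fun (τ : TripRecord) k => ((τ k).1, (τ k).2.1)) Q

/-- A trip mobility network on the probability space `(Ω, P)` with locations labelled by `ℕ`. -/
structure Network (M : Model) {Ω : Type*} [MeasurableSpace Ω] (P : Measure Ω) where
  /-- `classLaw x` is the law of the trip record of a destination of attractiveness `x`. -/
  classLaw : Kernel ℝ TripRecord
  isMarkov : IsMarkovKernel classLaw
  /-- trips to destinations of attractiveness `x` arrive with intensity `dt ⊗ K(x,y) μ_y(dy)` -/
  arrivals : ∀ x ∈ M.Ωx, IsPoissonArrival (classLaw x) (M.arrivalIntensity x)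
  /-- trip weights are i.i.d. with density `weightPDF x`, independent of the arrivals -/
  weights : ∀ x ∈ M.Ωx, HasIIDWeights (classLaw x) (M.weightLaw x)
  /-- attractiveness of location `i` -/
  X : ℕ → Ω → ℝ
  /-- record of the trips to location `i` -/
  trips : ℕ → Ω → TripRecord
  measurable_X : ∀ i, Measurable (X i)
  measurable_trips : ∀ i, Measurable (trips i)
  /-- locations are independent of each other -/
  iIndep : iIndepFun (fun i ω => (X i ω, trips i ω)) P
  /-- `X i` has density `ρ`, and given `X i = x` the trips have law `classLaw x` -/
  law : ∀ i, P.map (fun ω => (X i ω, trips i ω)) = M.μx.compProd classLaw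

namespace Network

variable {M : Model} {Ω : Type*} [MeasurableSpace Ω] {P : Measure Ω} (N : Network M P)

/-- Conditional visit distribution `p_x(dκ, t)`. -/
def condVisit (x t : ℝ) : Measure ℝ := (N.classLaw x).map (strength t)

/-- Overall visit distribution `P(dκ, t)` of the first `n` locations: the expectation of the
empirical measure `n⁻¹ ∑_{i < n} δ_{κ_i(t)}`. -/
def visitDistribution (n : ℕ) (t : ℝ) : Measure ℝ :=
  (n : ℝ≥0∞)⁻¹ • ∑ i ∈ Finset.range n, P.map (fun ω => strength t (N.trips i ω))

end Network

/-- The Kolmogorov–Feller master equation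
`∂ₜ p(κ,t) = ∫₀^∞ ν w(r) [p(κ - r, t) - p(κ, t)] dr`, `t ≥ 0`, for measures `p t` on `ℝ`, tested on
every Borel set: the shifted density `p(κ - r, t)` gives `B` the mass
`p t {κ | κ + r ∈ B}`. -/
def MasterEquation (ν : ℝ) (w : ℝ → ℝ≥0) (p : ℝ → Measure ℝ) : Prop :=
  ∀ B : Set ℝ, MeasurableSet B → ∀ t : ℝ, 0 ≤ t →
    HasDerivWithinAt (fun s => (p s).real B)
      (∫ r in Ioi (0 : ℝ), ν * w r * ((p t).real {κ | κ + r ∈ B} - (p t).real B)) (Ici 0) t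

/-- The error function. -/
def erf (u : ℝ) : ℝ := 2 / √Real.pi * ∫ s in (0 : ℝ)..u, Real.exp (-s ^ 2)

/-- The factor `2 / (1 + erf (m / √(2 v)))`. -/
def truncFactor (m v : ℝ) : ℝ := 2 / (1 + erf (m / √(2 * v)))

/-- The normal law with parameters `m`, `v`, truncated to `[0, ∞)`. -/
def truncNormal (m v : ℝ) : Measure ℝ :=
  (volume.restrict (Ici 0)).withDensity fun κ => ENNReal.ofReal
    (truncFactor m v * (1 / √(2 * Real.pi * v) * Real.exp (-(κ - m) ^ 2 / (2 * v))))

/-- The total variation distance of `p t` and `q t` tends to `0` as `t → ∞`. -/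
def AsympEqTV (p q : ℝ → Measure ℝ) : Prop :=
  ∀ ε : ℝ, 0 < ε → ∀ᶠ t in atTop, ∀ B : Set ℝ, MeasurableSet B →
    |(p t).real B - (q t).real B| ≤ ε

end TripMobility

end

noncomputable section

namespace TripMobility

/-! ### Total variation distance -/

/-! The set of labels of the trips arrived by time `t` is almost surely finite, its size is Poisson
with mean `ν t`, and it is independent of the weights. Given that this set is `S`, the strength is a
sum of `S.card` i.i.d. weights, so the conditional visit distribution is the compound Poisson law
`e^{-νt} ∑ (νt)^n / n! W^{*n}` (`map_strength_eq_compoundPoisson`). The claims about a fixed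
attractiveness, apart from the transition rate, are claims about this series.

Differentiating `e^{-νt} ∑ (νt)^n / n! a n` in `t` replaces `a` by `ν` times (shifted `a` minus
`a`), and the shift is convolution with `W`. With `a n = W^{*n}(B)` this is the master equation for
measures. With the densities of `W^{*n}` at a point it is the pointwise equation, valid wherever the
density series converges for all times (`ae_densityFinite`). Uniqueness is Picard iteration: two
solutions differ on every Borel set by at most `(2νt)^n / n!` for every `n`.

Asymptotic normality holds weakly by characteristic functions, the compound Poisson one being `exp
(s (φ_W - 1))`. The upgrade to total variation is by smoothing. Gaussian noise of variance `s δ`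
turns weak convergence of the standardised laws into convergence of densities, hence in total
variation (Scheffé). Removing the noise is cheap because a compound Poisson law with absolutely
continuous `W` moves by only `C (|y| + 1) / √s` under translation by `y`
(`exists_tvDist_compoundPoisson_map_le_mul`). For small `z`, `W` overlaps its translate by `z`, so
half of `W` has the form `A ∗ twoPoint z`. The compound Poisson law then contains, as a convolution
factor, a Poisson number of fair coin flips of size `z`, and binomial laws with `n` flips change by
`O(1/√n)` under a unit shift. Truncation to `[0, ∞)` is negligible because the mean is of order `t`
and the standard deviation of order `√t`.

For the overall distribution, put `G x = ν_x ⟨r⟩_x`. The mixture consists of laws close to normal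
ones with mean `t G x` and spread of order `√t`, while the law of `t G` lives on scale `t`. The law
of `G` is absolutely continuous, so by continuity of translation in `L¹` the spread is invisible in
the limit (`tendsto_tvDist_bind_map`). The area formula `lintegral_tsum_fiber` identifies the
density of `t G` with the sum over the zeros of `z`. -/

/-- Total variation distance, `sup_B |μ B - ν B|`. -/
def tvDist (μ ν : Measure ℝ) : ℝ≥0∞ :=
  ⨆ B : {B : Set ℝ // MeasurableSet B}, ENNReal.ofReal |μ.real B - ν.real B|

lemma ofReal_abs_sub_le_tvDist (μ ν : Measure ℝ) {B : Set ℝ} (hB : MeasurableSet B) :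
    ENNReal.ofReal |μ.real B - ν.real B| ≤ tvDist μ ν :=
  le_iSup (fun B : {B : Set ℝ // MeasurableSet B} => ENNReal.ofReal |μ.real B - ν.real B|) ⟨B, hB⟩

lemma tvDist_le {μ ν : Measure ℝ} {ε : ℝ≥0∞}
    (h : ∀ B, MeasurableSet B → ENNReal.ofReal |μ.real B - ν.real B| ≤ ε) : tvDist μ ν ≤ ε :=
  iSup_le fun B => h B B.2

lemma tvDist_comm (μ ν : Measure ℝ) : tvDist μ ν = tvDist ν μ := by
  simp only [tvDist, abs_sub_comm]

@[simp] lemma tvDist_self (μ : Measure ℝ) : tvDist μ μ = 0 := by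
  simp [tvDist]

lemma tvDist_triangle (μ ν ξ : Measure ℝ) : tvDist μ ξ ≤ tvDist μ ν + tvDist ν ξ := by
  refine tvDist_le fun B hB => ?_
  calc ENNReal.ofReal |μ.real B - ξ.real B|
      ≤ ENNReal.ofReal (|μ.real B - ν.real B| + |ν.real B - ξ.real B|) :=
        ENNReal.ofReal_le_ofReal (abs_sub_le _ _ _)
    _ ≤ _ := ENNReal.ofReal_add_le
    _ ≤ _ := add_le_add (ofReal_abs_sub_le_tvDist _ _ hB) (ofReal_abs_sub_le_tvDist _ _ hB)

lemma tvDist_le_one (μ ν : Measure ℝ) [IsZeroOrProbabilityMeasure μ]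
    [IsZeroOrProbabilityMeasure ν] : tvDist μ ν ≤ 1 := by
  refine tvDist_le fun B _ => ENNReal.ofReal_le_one.2 ?_
  have h1 : μ.real B ≤ 1 := measureReal_le_one
  have h2 : ν.real B ≤ 1 := measureReal_le_one
  have h3 : 0 ≤ μ.real B := measureReal_nonneg
  have h4 : 0 ≤ ν.real B := measureReal_nonneg
  rw [abs_le]; constructor <;> linarith

lemma tvDist_map_le (μ ν : Measure ℝ) {f : ℝ → ℝ} (hf : Measurable f) :
    tvDist (μ.map f) (ν.map f) ≤ tvDist μ ν := by
  refine tvDist_le fun B hB => ?_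
  rw [map_measureReal_apply hf hB, map_measureReal_apply hf hB]
  exact ofReal_abs_sub_le_tvDist _ _ (hf hB)

lemma asympEqTV_iff {p q : ℝ → Measure ℝ} :
    AsympEqTV p q ↔ Tendsto (fun t => tvDist (p t) (q t)) atTop (𝓝 0) := by
  rw [ENNReal.tendsto_nhds_zero]
  constructor
  · intro h ε hε
    rcases eq_or_ne ε ⊤ with rfl | hε'
    · simp
    filter_upwards [h ε.toReal (ENNReal.toReal_pos hε.ne' hε')] with t ht
    exact tvDist_le fun B hB => ENNReal.ofReal_le_of_le_toReal (ht B hB)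
  · intro h ε hε
    filter_upwards [h (ENNReal.ofReal ε) (by simpa using hε)] with t ht B hB
    exact (ENNReal.ofReal_le_ofReal_iff hε.le).1 ((ofReal_abs_sub_le_tvDist _ _ hB).trans ht)

/-- Total variation distance of two mixtures with the same mixing measure. -/
lemma tvDist_le_lintegral {X : Type*} [MeasurableSpace X] {m : Measure X}
    {κ η : X → Measure ℝ} {μ ν : Measure ℝ}
    (hκ : ∀ B, MeasurableSet B → Integrable (fun x => (κ x).real B) m)
    (hη : ∀ B, MeasurableSet B → Integrable (fun x => (η x).real B) m)
    (hμ : ∀ B, MeasurableSet B → μ.real B = ∫ x, (κ x).real B ∂m)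
    (hν : ∀ B, MeasurableSet B → ν.real B = ∫ x, (η x).real B ∂m) :
    tvDist μ ν ≤ ∫⁻ x, tvDist (κ x) (η x) ∂m := by
  refine tvDist_le fun B hB => ?_
  rw [hμ B hB, hν B hB, ← integral_sub (hκ B hB) (hη B hB), ← Real.enorm_eq_ofReal_abs]
  refine (enorm_integral_le_lintegral_enorm _).trans (lintegral_mono fun x => ?_)
  rw [Real.enorm_eq_ofReal_abs]
  exact ofReal_abs_sub_le_tvDist _ _ hB

lemma measurable_map_add_apply (ν : Measure ℝ) [SFinite ν] {B : Set ℝ} (hB : MeasurableSet B) :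
    Measurable fun x : ℝ => (ν.map (x + ·)) B := by
  have : (fun x : ℝ => (ν.map (x + ·)) B) =
      fun x => ν (Prod.mk x ⁻¹' ((fun p : ℝ × ℝ => p.1 + p.2) ⁻¹' B)) := by
    ext x
    rw [Measure.map_apply (measurable_const_add x) hB]
    rfl
  rw [this]
  exact measurable_measure_prodMk_left (measurable_add hB)

lemma integrable_map_add_real (μ ν : Measure ℝ) [IsFiniteMeasure μ] [IsFiniteMeasure ν]
    {B : Set ℝ} (hB : MeasurableSet B) :
    Integrable (fun x : ℝ => (ν.map (x + ·)).real B) μ := by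
  refine Integrable.of_bound (C := ν.real univ)
    (measurable_map_add_apply ν hB).ennreal_toReal.aestronglyMeasurable (.of_forall fun x => ?_)
  rw [map_measureReal_apply (measurable_const_add x) hB, Real.norm_of_nonneg measureReal_nonneg]
  exact measureReal_mono (subset_univ _)

lemma conv_apply' (μ ν : Measure ℝ) [SFinite ν] {B : Set ℝ} (hB : MeasurableSet B) :
    (μ ∗ ν) B = ∫⁻ x, (ν.map (x + ·)) B ∂μ := by
  rw [← lintegral_indicator_one hB, Measure.lintegral_conv (measurable_one.indicator hB)]
  refine lintegral_congr fun x => ?_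
  rw [← lintegral_indicator_one hB, lintegral_map (measurable_one.indicator hB) (by fun_prop)]

lemma conv_real (μ ν : Measure ℝ) [IsFiniteMeasure μ] [IsFiniteMeasure ν]
    {B : Set ℝ} (hB : MeasurableSet B) :
    (μ ∗ ν).real B = ∫ x, (ν.map (x + ·)).real B ∂μ := by
  rw [measureReal_def, conv_apply' μ ν hB]
  symm
  exact integral_toReal (measurable_map_add_apply ν hB).aemeasurable
    (.of_forall fun x => measure_lt_top _ _)

lemma tvDist_conv_left_le (κ μ ν : Measure ℝ) [IsProbabilityMeasure κ] [IsFiniteMeasure μ]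
    [IsFiniteMeasure ν] : tvDist (κ ∗ μ) (κ ∗ ν) ≤ tvDist μ ν := by
  refine (tvDist_le_lintegral (fun B hB => integrable_map_add_real κ μ hB)
    (fun B hB => integrable_map_add_real κ ν hB) (fun B hB => conv_real κ μ hB)
    (fun B hB => conv_real κ ν hB)).trans ?_
  refine (lintegral_mono fun x => tvDist_map_le μ ν (measurable_const_add x)).trans ?_
  simp

/-- Distance between a measure and its convolution with a probability measure, in terms of
translates. -/
lemma tvDist_conv_self_le (κ μ : Measure ℝ) [IsProbabilityMeasure κ] [IsFiniteMeasure μ] :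
    tvDist μ (κ ∗ μ) ≤ ∫⁻ y, tvDist μ (μ.map (y + ·)) ∂κ := by
  refine tvDist_le_lintegral (κ := fun _ => μ) (fun B hB => integrable_const _)
    (fun B hB => integrable_map_add_real κ μ hB) (fun B hB => ?_) (fun B hB => conv_real κ μ hB)
  simp

/-- Dominated convergence to `0` without measurability: `lintegral` is a lower integral. -/
lemma tendsto_lintegral_zero_of_le {X ι : Type*} [MeasurableSpace X] {m : Measure X}
    [IsFiniteMeasure m] {l : Filter ι} [l.IsCountablyGenerated] {E : ι → X → ℝ≥0∞}
    {C : ℝ≥0∞} (hC : C ≠ ⊤) (hE : ∀ i x, E i x ≤ C)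
    (hlim : ∀ᵐ x ∂m, Tendsto (fun i => E i x) l (𝓝 0)) :
    Tendsto (fun i => ∫⁻ x, E i x ∂m) l (𝓝 0) := by
  choose F hFm hFE hF using fun i => exists_measurable_le_lintegral_eq (μ := m) (E i)
  simp_rw [hF]
  rw [← lintegral_zero (μ := m) (α := X)]
  refine tendsto_lintegral_filter_of_dominated_convergence (fun _ => C)
    (.of_forall hFm) (.of_forall fun i => .of_forall fun x => (hFE i x).trans (hE i x)) ?_ ?_
  · simpa using ENNReal.mul_ne_top hC (measure_ne_top _ _)
  · filter_upwards [hlim] with x hx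
    exact tendsto_of_tendsto_of_tendsto_of_le_of_le tendsto_const_nhds hx (fun _ => zero_le)
      (fun i => hFE i x)

/-- For probability measures a one-sided bound suffices: applied to the complement it becomes the
opposite one. -/
lemma tvDist_le_of_le_add {μ ν : Measure ℝ} [IsProbabilityMeasure μ] [IsProbabilityMeasure ν]
    {ε : ℝ≥0∞} (h : ∀ B, MeasurableSet B → μ B ≤ ν B + ε) : tvDist μ ν ≤ ε := by
  rcases eq_or_ne ε ⊤ with rfl | hε
  · exact le_top
  have key : ∀ B, MeasurableSet B → μ.real B ≤ ν.real B + ε.toReal := fun B hB => by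
    rw [measureReal_def, measureReal_def, ← ENNReal.toReal_add (measure_ne_top _ _) hε]
    exact ENNReal.toReal_mono (by finiteness) (h B hB)
  refine tvDist_le fun B hB => ENNReal.ofReal_le_of_le_toReal ?_
  have h1 := key B hB
  have h2 := key Bᶜ hB.compl
  rw [probReal_compl_eq_one_sub hB, probReal_compl_eq_one_sub hB] at h2
  rw [abs_le]; constructor <;> linarith

/-- Scheffé's lemma. -/
lemma tendsto_tvDist_withDensity {ι : Type*} {l : Filter ι} [l.IsCountablyGenerated]
    {m : Measure ℝ} {f : ι → ℝ → ℝ≥0∞} {g : ℝ → ℝ≥0∞} (hf : ∀ i, Measurable (f i))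
    (hg : Measurable g) (hfp : ∀ i, IsProbabilityMeasure (m.withDensity (f i)))
    [hgp : IsProbabilityMeasure (m.withDensity g)]
    (hlim : ∀ᵐ x ∂m, Tendsto (fun i => f i x) l (𝓝 (g x))) :
    Tendsto (fun i => tvDist (m.withDensity g) (m.withDensity (f i))) l (𝓝 0) := by
  have hgi : ∫⁻ x, g x ∂m = 1 := by
    rw [← setLIntegral_univ, ← withDensity_apply _ MeasurableSet.univ]; exact hgp.measure_univ
  -- Only the positive part of `g - f i` is needed. It is dominated by `g`, so no bound on `f i` is
  -- required.
  have h0 : Tendsto (fun i => ∫⁻ x, (g x - f i x) ∂m) l (𝓝 0) := by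
    have : Tendsto (fun i => ∫⁻ x, (g x - f i x) ∂m) l (𝓝 (∫⁻ x, (fun _ => 0) x ∂m)) := by
      refine tendsto_lintegral_filter_of_dominated_convergence g
        (.of_forall fun i => hg.sub (hf i)) (.of_forall fun i => .of_forall fun x => tsub_le_self)
        (by simp [hgi]) ?_
      have hfin : ∀ᵐ x ∂m, g x < ⊤ := ae_lt_top hg (by simp [hgi])
      filter_upwards [hlim, hfin] with x hx hx'
      have := ENNReal.Tendsto.sub (tendsto_const_nhds (x := g x)) hx (Or.inl hx'.ne)
      simpa using this
    simpa using this
  refine tendsto_of_tendsto_of_tendsto_of_le_of_le tendsto_const_nhds h0 (fun _ => zero_le)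
    (fun i => ?_)
  refine tvDist_le_of_le_add fun B hB => ?_
  rw [withDensity_apply _ hB, withDensity_apply _ hB]
  calc ∫⁻ x in B, g x ∂m ≤ ∫⁻ x in B, (f i x + (g x - f i x)) ∂m :=
        lintegral_mono fun x => le_add_tsub
    _ = ∫⁻ x in B, f i x ∂m + ∫⁻ x in B, (g x - f i x) ∂m := lintegral_add_left (hf i) _
    _ ≤ _ := by gcongr; exact Measure.restrict_le_self

/-- Translation is continuous in total variation on absolutely continuous finite measures. -/
lemma tendsto_tvDist_map_add {μ : Measure ℝ} [IsFiniteMeasure μ] (hμ : μ ≪ volume) :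
    Tendsto (fun h : ℝ => tvDist μ (μ.map (h + ·))) (𝓝 0) (𝓝 0) := by
  set f : ℝ → ℝ := fun x => (μ.rnDeriv volume x).toReal with hf
  have hfi : Integrable f volume := Measure.integrable_toReal_rnDeriv
  have hreal : ∀ B, MeasurableSet B → μ.real B = ∫ x in B, f x := fun B hB => by
    rw [Measure.setIntegral_toReal_rnDeriv hμ]
  -- The density is viewed in `L¹`, where composition with a measure-preserving translation depends
  -- continuously on the translation; the `L¹` distance bounds the total variation distance.
  let F : Lp ℝ 1 (volume : Measure ℝ) := hfi.toL1 f
  let g : ℝ → C(ℝ, ℝ) := fun h => ⟨fun x => x - h, by fun_prop⟩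
  have hgm : ∀ h, MeasurePreserving (g h) volume volume := fun h =>
    measurePreserving_sub_right volume h
  have hg : Continuous g := by
    refine ContinuousMap.continuous_of_continuous_uncurry _ ?_
    simp only [g, Function.uncurry_def, ContinuousMap.coe_mk]; fun_prop
  have hc : Continuous fun h => Lp.compMeasurePreserving (g h) (hgm h) F :=
    Continuous.compMeasurePreservingLp continuous_const hg hgm (by simp)
  have h0 : Lp.compMeasurePreserving (g 0) (hgm 0) F = F := by
    apply Lp.ext
    refine (Lp.coeFn_compMeasurePreserving _ _).trans ?_
    simp [g, Function.comp_def]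
  have hlim : Tendsto (fun h => ‖Lp.compMeasurePreserving (g h) (hgm h) F - F‖ₑ) (𝓝 0) (𝓝 0) := by
    have : Continuous fun h => ‖Lp.compMeasurePreserving (g h) (hgm h) F - F‖ₑ := by fun_prop
    have h1 := this.tendsto 0
    simpa only [h0, sub_self, enorm_zero] using h1
  refine tendsto_of_tendsto_of_tendsto_of_le_of_le tendsto_const_nhds hlim (fun _ => zero_le)
    (fun h => tvDist_le fun B hB => ?_)
  have hcomp : (fun x => Lp.compMeasurePreserving (g h) (hgm h) F x) =ᵐ[volume]
      fun x => f (x - h) := by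
    refine (Lp.coeFn_compMeasurePreserving _ _).trans ?_
    exact (hgm h).quasiMeasurePreserving.ae_eq_comp hfi.coeFn_toL1
  have hmap : (μ.map (h + ·)).real B = ∫ x in B, f (x - h) := by
    rw [map_measureReal_apply (measurable_const_add h) hB,
      hreal _ ((measurable_const_add h) hB)]
    have := (measurePreserving_add_left volume h).setIntegral_preimage_emb
      (measurableEmbedding_addLeft h) (fun x => f (x - h)) B
    simpa using this
  rw [hreal B hB, hmap, abs_sub_comm, ← integral_sub (hfi.comp_sub_right h).integrableOn
    hfi.integrableOn, ← Real.enorm_eq_ofReal_abs]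
  refine (enorm_integral_le_lintegral_enorm _).trans ?_
  rw [Lp.enorm_def, eLpNorm_one_eq_lintegral_enorm]
  refine (setLIntegral_le_lintegral _ _).trans (le_of_eq (lintegral_congr_ae ?_))
  filter_upwards [hcomp, hfi.coeFn_toL1, Lp.coeFn_sub
    (Lp.compMeasurePreserving (g h) (hgm h) F) F] with x h1 h2 h3
  rw [h3, Pi.sub_apply, h1, h2]

/-! ### Convolution powers, Poisson mixtures and compound Poisson laws -/

/-- Convolution powers of a measure. -/
def convPow (W : Measure ℝ) : ℕ → Measure ℝ
  | 0 => Measure.dirac 0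
  | n + 1 => W ∗ convPow W n

instance isProbabilityMeasure_convPow (W : Measure ℝ) [IsProbabilityMeasure W] (n : ℕ) :
    IsProbabilityMeasure (convPow W n) := by
  induction n with
  | zero => rw [convPow]; infer_instance
  | succ n ih => rw [convPow]; infer_instance

lemma charFun_convPow (W : Measure ℝ) [IsProbabilityMeasure W] (n : ℕ) (ξ : ℝ) :
    charFun (convPow W n) ξ = charFun W ξ ^ n := by
  induction n with
  | zero => simp [convPow, charFun_dirac]
  | succ n ih => rw [convPow, charFun_conv, ih, pow_succ']

lemma convPow_conv (A b : Measure ℝ) [IsProbabilityMeasure A] [IsProbabilityMeasure b] (n : ℕ) :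
    convPow (A ∗ b) n = convPow A n ∗ convPow b n := by
  refine Measure.ext_of_charFun ?_
  ext ξ
  simp only [charFun_convPow, charFun_conv, mul_pow]

/-- The mixture of `κ 0, κ 1, …` with Poisson weights. -/
def poissonMix (s : ℝ≥0) (κ : ℕ → Measure ℝ) : Measure ℝ :=
  Measure.sum fun n => poissonMeasure s {n} • κ n

/-- The law of a sum of a Poisson number of independent variables with law `W`. -/
def compoundPoisson (s : ℝ≥0) (W : Measure ℝ) : Measure ℝ := poissonMix s (convPow W)

lemma poissonMix_apply (s : ℝ≥0) (κ : ℕ → Measure ℝ) {B : Set ℝ} (hB : MeasurableSet B) :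
    poissonMix s κ B = ∑' n, poissonMeasure s {n} * κ n B := by
  simp [poissonMix, Measure.sum_apply _ hB]

instance isProbabilityMeasure_poissonMix (s : ℝ≥0) (κ : ℕ → Measure ℝ)
    [∀ n, IsProbabilityMeasure (κ n)] : IsProbabilityMeasure (poissonMix s κ) := by
  refine ⟨?_⟩
  rw [poissonMix_apply _ _ MeasurableSet.univ]
  simp only [measure_univ, mul_one]
  simpa using (lintegral_countable' (μ := poissonMeasure s) fun _ => 1).symm

instance isProbabilityMeasure_compoundPoisson (s : ℝ≥0) (W : Measure ℝ) [IsProbabilityMeasure W] :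
    IsProbabilityMeasure (compoundPoisson s W) := by
  rw [compoundPoisson]; infer_instance

lemma hasSum_poissonMix_real (s : ℝ≥0) (κ : ℕ → Measure ℝ) [∀ n, IsProbabilityMeasure (κ n)]
    {B : Set ℝ} (hB : MeasurableSet B) :
    HasSum (fun n : ℕ => Real.exp (-s) * s ^ n / n.factorial * (κ n).real B)
      ((poissonMix s κ).real B) := by
  have h : (poissonMix s κ).real B =
      ∑' n : ℕ, Real.exp (-s) * s ^ n / n.factorial * (κ n).real B := by
    rw [measureReal_def, poissonMix_apply _ _ hB, ENNReal.tsum_toReal_eq (fun n => by finiteness)]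
    congr with n
    rw [ENNReal.toReal_mul, ← measureReal_def, ← measureReal_def, poissonMeasure_real_singleton]
  rw [h]
  refine Summable.hasSum (Summable.of_nonneg_of_le (fun n => by positivity) (fun n => ?_)
    (hasSum_one_poissonMeasure s).summable)
  exact mul_le_of_le_one_right (by positivity) measureReal_le_one

lemma poissonMix_real_eq_integral (s : ℝ≥0) (κ : ℕ → Measure ℝ) [∀ n, IsProbabilityMeasure (κ n)]
    {B : Set ℝ} (hB : MeasurableSet B) :
    (poissonMix s κ).real B = ∫ n, (κ n).real B ∂(poissonMeasure s) := by
  rw [integral_poissonMeasure, ← (hasSum_poissonMix_real s κ hB).tsum_eq]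
  simp

/-- Both mixtures use the same Poisson weights, and the total variation distance is convex. -/
lemma tvDist_poissonMix_le (s : ℝ≥0) (κ η : ℕ → Measure ℝ) [∀ n, IsProbabilityMeasure (κ n)]
    [∀ n, IsProbabilityMeasure (η n)] :
    tvDist (poissonMix s κ) (poissonMix s η) ≤
      ∑' n : ℕ, poissonMeasure s {n} * tvDist (κ n) (η n) := by
  have hint : ∀ (κ : ℕ → Measure ℝ) [∀ n, IsProbabilityMeasure (κ n)] (B : Set ℝ),
      Integrable (fun n => (κ n).real B) (poissonMeasure s) := fun κ _ B =>
    Integrable.of_bound (C := 1) (Measurable.of_discrete).aestronglyMeasurable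
      (.of_forall fun n => by
        rw [Real.norm_of_nonneg measureReal_nonneg]; exact measureReal_le_one)
  refine (tvDist_le_lintegral (fun B _ => hint κ B) (fun B _ => hint η B)
    (fun B hB => poissonMix_real_eq_integral s κ hB)
    (fun B hB => poissonMix_real_eq_integral s η hB)).trans_eq ?_
  rw [lintegral_countable']
  simp only [mul_comm]

/-- The `n`-th convolution power contributes the `n`-th power of `charFun W ξ`, so the Poisson
weights sum to an exponential series. -/
lemma charFun_compoundPoisson (s : ℝ≥0) (W : Measure ℝ) [IsProbabilityMeasure W] (ξ : ℝ) :
    charFun (compoundPoisson s W) ξ = Complex.exp (s * (charFun W ξ - 1)) := by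
  have hint : Integrable (fun x : ℝ => Complex.exp (ξ * x * Complex.I))
      (compoundPoisson s W) := by
    refine Integrable.of_bound (C := 1) (by fun_prop) (.of_forall fun x => ?_)
    have : (ξ : ℂ) * x * Complex.I = ((ξ * x : ℝ) : ℂ) * Complex.I := by push_cast; ring
    rw [this, Complex.norm_exp_ofReal_mul_I]
  have h1 := hasSum_integral_measure hint
  rw [charFun_apply_real]
  refine h1.unique ?_
  have h2 : ∀ n, ∫ x, Complex.exp (ξ * x * Complex.I) ∂(poissonMeasure s {n} • convPow W n) =
      Complex.exp (-s) * ((s * charFun W ξ) ^ n / n.factorial) := fun n => by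
    rw [integral_smul_measure, ← charFun_apply_real, charFun_convPow, ← measureReal_def,
      poissonMeasure_real_singleton, Complex.real_smul]
    push_cast
    ring
  simp_rw [h2]
  have h3 : Complex.exp (s * (charFun W ξ - 1)) =
      Complex.exp (-s) * Complex.exp (s * charFun W ξ) := by
    rw [← Complex.exp_add]; ring_nf
  rw [h3]
  refine HasSum.mul_left _ ?_
  have := NormedSpace.expSeries_div_hasSum_exp (𝔸 := ℂ) ((s : ℂ) * charFun W ξ)
  rwa [← Complex.exp_eq_exp_ℂ] at this

/-- Splitting the jump law splits the compound Poisson law into independent parts. -/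
lemma compoundPoisson_mix (s a b : ℝ≥0) (hab : a + b = 1) (W W₁ W₂ : Measure ℝ)
    [IsProbabilityMeasure W] [IsProbabilityMeasure W₁] [IsProbabilityMeasure W₂]
    (hW : W = a • W₁ + b • W₂) :
    compoundPoisson s W = compoundPoisson (s * b) W₂ ∗ compoundPoisson (s * a) W₁ := by
  refine Measure.ext_of_charFun ?_
  ext ξ
  have hint : ∀ (μ : Measure ℝ) [IsFiniteMeasure μ],
      Integrable (fun x : ℝ => Complex.exp (ξ * x * Complex.I)) μ := fun μ _ => by
    refine Integrable.of_bound (C := 1) (by fun_prop) (.of_forall fun x => ?_)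
    have : (ξ : ℂ) * x * Complex.I = ((ξ * x : ℝ) : ℂ) * Complex.I := by push_cast; ring
    rw [this, Complex.norm_exp_ofReal_mul_I]
  have hχ : charFun W ξ = a * charFun W₁ ξ + b * charFun W₂ ξ := by
    rw [hW, charFun_apply_real, charFun_apply_real, charFun_apply_real,
      integral_add_measure (hint _) (hint _), integral_smul_nnreal_measure,
      integral_smul_nnreal_measure]
    rfl
  have hab' : (a : ℂ) + b = 1 := by exact_mod_cast congrArg (fun x : ℝ≥0 => (x : ℂ)) hab
  rw [charFun_conv, charFun_compoundPoisson, charFun_compoundPoisson, charFun_compoundPoisson,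
    ← Complex.exp_add, hχ]
  congr 1
  push_cast
  -- The exponent is affine in the jump law; `a + b = 1` distributes its constant term over the two
  -- factors.
  linear_combination (s : ℂ) * hab'

/-! ### Visits and strength under Poisson arrivals -/

/-- Arrival times are nonnegative, so `Iic t` can stand for `[0, t]`. Trips that never arrive have
to be excluded explicitly, since `toReal ⊤ = 0` would put them into the half-line. -/
lemma visits_eq_tripCount {t : ℝ} (ht : 0 ≤ t) (τ : TripRecord) :
    visits t τ = tripCount (Iic t ×ˢ univ) τ := by
  unfold visits tripCount
  congr 1
  ext k
  simp only [mem_ofPred_eq, mem_prod, mem_Iic, mem_univ, and_true]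
  constructor
  · intro h
    have hne : (τ k).1 ≠ ⊤ := ne_top_of_le_ne_top ENNReal.ofReal_ne_top h
    exact ⟨hne, (ENNReal.le_ofReal_iff_toReal_le hne ht).1 h⟩
  · rintro ⟨h1, h2⟩
    exact (ENNReal.le_ofReal_iff_toReal_le h1 ht).2 h2

lemma tripCount_Iic_add_Ioc {t h : ℝ} (hh : 0 ≤ h) (τ : TripRecord) :
    tripCount (Iic (t + h) ×ˢ univ) τ =
      tripCount (Iic t ×ˢ univ) τ + tripCount (Ioc t (t + h) ×ˢ univ) τ := by
  unfold tripCount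
  rw [← encard_union_eq]
  · congr 1
    ext k
    simp only [mem_ofPred_eq, mem_prod, mem_Iic, mem_univ, and_true, mem_union, mem_Ioc]
    constructor
    · rintro ⟨h1, h2⟩
      rcases le_or_gt (τ k).1.toReal t with h3 | h3
      · exact Or.inl ⟨h1, h3⟩
      · exact Or.inr ⟨h1, h3, h2⟩
    · rintro (⟨h1, h2⟩ | ⟨h1, h2, h3⟩)
      · exact ⟨h1, by linarith⟩
      · exact ⟨h1, h3⟩
  · rw [Set.disjoint_left]
    rintro k ⟨_, h1⟩ ⟨_, h2⟩
    simp only [mem_prod, mem_Iic, mem_univ, and_true, mem_Ioc] at h1 h2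
    exact absurd h1 (not_le.2 h2.1)

section Arrival

variable {Q : Measure TripRecord} {V : Measure ℝ}

lemma IsPoissonArrival.measure_visits_eq [IsFiniteMeasure V] (hQ : IsPoissonArrival Q V) {t : ℝ}
    (ht : 0 ≤ t) (n : ℕ) :
    Q {τ | visits t τ = n} = poissonMeasure (V.real univ * t).toNNReal {n} := by
  simp_rw [visits_eq_tripCount ht]
  refine hQ.poisson _ _ (measurableSet_Iic.prod MeasurableSet.univ) ?_ n
  rw [Measure.prod_prod, Measure.restrict_apply measurableSet_Iic, inter_comm, Ici_inter_Iic,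
    Real.volume_Icc, sub_zero, ← ofReal_measureReal (μ := V), ← ENNReal.ofReal_mul ht, mul_comm]
  rfl

lemma IsPoissonArrival.measure_tripCount_Ioc [IsFiniteMeasure V] (hQ : IsPoissonArrival Q V)
    {t h : ℝ} (ht : 0 ≤ t) (hh : 0 ≤ h) (n : ℕ) :
    Q {τ | tripCount (Ioc t (t + h) ×ˢ univ) τ = n} =
      poissonMeasure (V.real univ * h).toNNReal {n} := by
  refine hQ.poisson _ _ (measurableSet_Ioc.prod MeasurableSet.univ) ?_ n
  have : Ioc t (t + h) ∩ Ici 0 = Ioc t (t + h) :=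
    inter_eq_left.2 fun x hx => ht.trans hx.1.le
  rw [Measure.prod_prod, Measure.restrict_apply measurableSet_Ioc, this,
    Real.volume_Ioc, add_sub_cancel_left, ← ofReal_measureReal (μ := V), ← ENNReal.ofReal_mul hh,
    mul_comm]
  rfl

/-- The numbers of arrivals in the disjoint time strips up to `t` and in `(t, t + h]` are
independent, and the second is Poisson with mean `h` times the total intensity. -/
lemma IsPoissonArrival.measureReal_visits_jump [IsFiniteMeasure V] (hQ : IsPoissonArrival Q V)
    {t h : ℝ} (ht : 0 ≤ t) (hh : 0 ≤ h) (k : ℕ) :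
    Q.real {τ | visits t τ = k ∧ visits (t + h) τ = k + 1} =
      Q.real {τ | visits t τ = k} *
        (Real.exp (-(V.real univ * h)) * (V.real univ * h)) := by
  have hset : {τ | visits t τ = k ∧ visits (t + h) τ = k + 1} =
      (tripCount (Iic t ×ˢ univ)) ⁻¹' {(k : ℕ∞)} ∩
        (tripCount (Ioc t (t + h) ×ˢ univ)) ⁻¹' {1} := by
    ext τ
    simp only [mem_ofPred_eq, mem_inter_iff, mem_preimage, mem_singleton_iff]
    rw [visits_eq_tripCount ht, visits_eq_tripCount (add_nonneg ht hh),
      tripCount_Iic_add_Ioc hh]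
    refine and_congr_right fun h1 => ?_
    rw [h1]
    -- Cancellation in `ℕ∞` is legitimate because the count `k` is finite.
    exact (ENat.addLECancellable_of_ne_top (ENat.natCast_ne_top k)).inj
  have hind : IndepFun (tripCount (Iic t ×ˢ univ)) (tripCount (Ioc t (t + h) ×ˢ univ)) Q := by
    have := hQ.indep 2 ![Iic t ×ˢ univ, Ioc t (t + h) ×ˢ univ] (fun i => by
      fin_cases i
      · exact measurableSet_Iic.prod MeasurableSet.univ
      · exact measurableSet_Ioc.prod MeasurableSet.univ) (fun i j hij => by
      have hd : Disjoint (Iic t ×ˢ (univ : Set ℝ)) (Ioc t (t + h) ×ˢ univ) := by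
        rw [Set.disjoint_left]
        rintro p h1 h2
        simp only [mem_prod, mem_Iic, mem_univ, and_true, mem_Ioc] at h1 h2
        exact absurd h1 (not_le.2 h2.1)
      fin_cases i <;> fin_cases j
      · exact absurd rfl hij
      · exact hd
      · exact hd.symm
      · exact absurd rfl hij)
    exact this.indepFun (i := 0) (j := 1) (by decide)
  rw [hset, measureReal_def, hind.measure_inter_preimage_eq_mul _ _ (MeasurableSet.of_discrete)
    (MeasurableSet.of_discrete), ENNReal.toReal_mul]
  congr 1
  · rw [measureReal_def]
    simp_rw [visits_eq_tripCount ht]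
    rfl
  · have h1 := hQ.measure_tripCount_Ioc ht hh 1
    have h2 : (tripCount (Ioc t (t + h) ×ˢ univ)) ⁻¹' {1} =
        {τ | tripCount (Ioc t (t + h) ×ˢ univ) τ = (1 : ℕ)} := by
      ext τ; simp
    rw [h2, h1, ← measureReal_def, poissonMeasure_real_singleton,
      Real.coe_toNNReal _ (mul_nonneg measureReal_nonneg hh)]
    simp

lemma IsPoissonArrival.tendsto_visits_jump [IsFiniteMeasure V] (hQ : IsPoissonArrival Q V)
    {t : ℝ} (ht : 0 ≤ t) (k : ℕ) :
    Tendsto (fun h : ℝ => Q.real {τ | visits t τ = k ∧ visits (t + h) τ = k + 1} / h) (𝓝[>] 0)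
      (𝓝 (V.real univ * Q.real {τ | visits t τ = k})) := by
  have hc : Continuous fun h : ℝ => Q.real {τ | visits t τ = k} *
      (Real.exp (-(V.real univ * h)) * V.real univ) := by fun_prop
  have hlim := (hc.tendsto 0).mono_left (nhdsWithin_le_nhds (s := Ioi 0))
  simp only [mul_zero, neg_zero, Real.exp_zero, one_mul] at hlim
  rw [mul_comm]
  refine hlim.congr' ?_
  filter_upwards [self_mem_nhdsWithin] with h hh
  have hh' : (0 : ℝ) < h := hh
  rw [hQ.measureReal_visits_jump ht hh'.le]
  field_simp

end Arrival

/-- The event that exactly the trips with labels in `S` have arrived up to time `t`. -/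
def arrivedEq (t : ℝ) (S : Finset ℕ) : Set TripRecord :=
  {τ | {k | (τ k).1 ≤ ENNReal.ofReal t} = (S : Set ℕ)}

lemma measurable_strength (t : ℝ) : Measurable (strength t) := by
  unfold strength
  refine (Measurable.tsum fun k => ?_).ennreal_toReal
  refine Measurable.ite (measurableSet_le (by fun_prop) measurable_const) ?_ measurable_const
  exact measurable_coe_nnreal_ennreal.comp (by fun_prop)

/-- The event depends on arrival times and origins only, which makes it independent of the weights.
-/
lemma arrivedEq_eq_preimage (t : ℝ) (S : Finset ℕ) :
    arrivedEq t S = (fun (τ : TripRecord) k => ((τ k).1, (τ k).2.1)) ⁻¹'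
      {α : ℕ → ℝ≥0∞ × ℝ | ∀ k, (α k).1 ≤ ENNReal.ofReal t ↔ k ∈ S} := by
  ext τ
  simp [arrivedEq, Set.ext_iff]

lemma measurableSet_arrived (t : ℝ) (S : Finset ℕ) :
    MeasurableSet {α : ℕ → ℝ≥0∞ × ℝ | ∀ k, (α k).1 ≤ ENNReal.ofReal t ↔ k ∈ S} := by
  rw [ofPred_forall]
  refine MeasurableSet.iInter fun k => ?_
  exact (measurableSet_le (by fun_prop) measurable_const).iff (.const _)

lemma measurableSet_arrivedEq (t : ℝ) (S : Finset ℕ) : MeasurableSet (arrivedEq t S) := by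
  rw [arrivedEq_eq_preimage]
  exact (by fun_prop : Measurable fun (τ : TripRecord) k => ((τ k).1, (τ k).2.1))
    (measurableSet_arrived t S)

lemma disjoint_arrivedEq (t : ℝ) : Pairwise (Function.onFun Disjoint (arrivedEq t)) := by
  intro S T hST
  rw [Function.onFun, Set.disjoint_left]
  intro τ h1 h2
  exact hST (Finset.coe_injective (h1.symm.trans h2))

lemma setOf_visits_eq (t : ℝ) (n : ℕ) :
    {τ | visits t τ = n} = ⋃ S : {S : Finset ℕ // S.card = n}, arrivedEq t S := by
  ext τ
  simp only [mem_ofPred_eq, mem_iUnion, Subtype.exists, exists_prop, visits, arrivedEq]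
  constructor
  · intro h
    have hfin : {k | (τ k).1 ≤ ENNReal.ofReal t}.Finite := finite_of_encard_eq_coe h
    refine ⟨hfin.toFinset, ?_, by simp⟩
    rw [hfin.encard_eq_coe_toFinset_card] at h
    exact_mod_cast h
  · rintro ⟨S, hS, h⟩
    rw [h, encard_coe_eq_coe_finsetCard, hS]

lemma strength_of_arrivedEq {t : ℝ} {S : Finset ℕ} {τ : TripRecord} (h : τ ∈ arrivedEq t S) :
    strength t τ = ∑ k ∈ S, ((τ k).2.2 : ℝ) := by
  have hk : ∀ k, (τ k).1 ≤ ENNReal.ofReal t ↔ k ∈ S := fun k => by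
    have := Set.ext_iff.1 h k
    simpa using this
  unfold strength
  rw [tsum_eq_sum (s := S) (fun k hkS => by rw [if_neg (by rwa [hk k])]),
    ENNReal.toReal_sum (fun k _ => by split_ifs <;> simp)]
  refine Finset.sum_congr rfl fun k hkS => ?_
  rw [if_pos ((hk k).2 hkS)]
  simp

section Weights

variable {Q : Measure TripRecord} [IsProbabilityMeasure Q] {W : Measure ℝ} [IsProbabilityMeasure W]

lemma HasIIDWeights.map_sum (hQ : HasIIDWeights Q W) (S : Finset ℕ) :
    Q.map (fun τ => ∑ k ∈ S, ((τ k).2.2 : ℝ)) = convPow W S.card := by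
  have hm : ∀ k, Measurable fun τ : TripRecord => ((τ k).2.2 : ℝ) := fun k => by fun_prop
  have hind : iIndepFun (fun k (τ : TripRecord) => ((τ k).2.2 : ℝ)) Q :=
    hQ.iIndep.comp (fun _ => NNReal.toReal) (fun _ => by fun_prop)
  have hsum : Measurable fun τ : TripRecord => ∑ k ∈ S, ((τ k).2.2 : ℝ) := by fun_prop
  have := Measure.isProbabilityMeasure_map (μ := Q) hsum.aemeasurable
  refine Measure.ext_of_charFun ?_
  ext ξ
  have h := iIndepFun.charFun_map_fun_finsetSum_eq_prod (s := S) (fun k _ => (hm k).aemeasurable)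
    (hind.restrict _)
  rw [h, charFun_convPow]
  simp [hQ.law]

/-- On this event the strength is the sum over the fixed set `S`, a function of the weights alone.
Conditioning on the whole set of arrived labels avoids having to order the trips by arrival. -/
lemma HasIIDWeights.measure_strength_inter_arrivedEq (hQ : HasIIDWeights Q W) (t : ℝ)
    (S : Finset ℕ) {B : Set ℝ} (hB : MeasurableSet B) :
    Q (strength t ⁻¹' B ∩ arrivedEq t S) = Q (arrivedEq t S) * convPow W S.card B := by
  have hset : strength t ⁻¹' B ∩ arrivedEq t S =
      (fun (τ : TripRecord) k => (τ k).2.2) ⁻¹' ((fun w : ℕ → ℝ≥0 => ∑ k ∈ S, (w k : ℝ)) ⁻¹' B) ∩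
        (fun (τ : TripRecord) k => ((τ k).1, (τ k).2.1)) ⁻¹'
          {α : ℕ → ℝ≥0∞ × ℝ | ∀ k, (α k).1 ≤ ENNReal.ofReal t ↔ k ∈ S} := by
    rw [← arrivedEq_eq_preimage]
    ext τ
    simp only [mem_inter_iff, mem_preimage]
    refine and_congr_left fun h => ?_
    rw [strength_of_arrivedEq h]
  have hms : Measurable fun w : ℕ → ℝ≥0 => ∑ k ∈ S, (w k : ℝ) := by fun_prop
  rw [hset, hQ.indep_arrivals.measure_inter_preimage_eq_mul _ _ (hms hB)
    (measurableSet_arrived t S), ← arrivedEq_eq_preimage, mul_comm, ← hQ.map_sum S,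
    Measure.map_apply (by fun_prop) hB]
  rfl

/-- The strength has a compound Poisson law. -/
theorem map_strength_eq_compoundPoisson {V : Measure ℝ} [IsFiniteMeasure V]
    (hP : IsPoissonArrival Q V) (hQ : HasIIDWeights Q W) {t : ℝ} (ht : 0 ≤ t) :
    Q.map (strength t) = compoundPoisson (V.real univ * t).toNNReal W := by
  set s := (V.real univ * t).toNNReal
  have hfib : ∀ n : ℕ, ∑' S : {S : Finset ℕ // S.card = n}, Q (arrivedEq t S) =
      poissonMeasure s {n} := fun n => by
    rw [← hP.measure_visits_eq ht n, setOf_visits_eq, measure_iUnion]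
    · exact fun S T hST => disjoint_arrivedEq t (fun h => hST (Subtype.ext h))
    · exact fun S => measurableSet_arrivedEq t S
  -- Finite label sets are grouped by cardinality; each group carries a Poisson mass.
  have hsplit : ∀ c : ℕ → ℝ≥0∞, ∑' S : Finset ℕ, Q (arrivedEq t S) * c S.card =
      ∑' n : ℕ, poissonMeasure s {n} * c n := fun c => by
    rw [← (Equiv.sigmaFiberEquiv (Finset.card (α := ℕ))).tsum_eq, ENNReal.tsum_sigma']
    refine tsum_congr fun n => ?_
    rw [← hfib n, ← ENNReal.tsum_mul_right]
    refine tsum_congr fun S => ?_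
    rw [Equiv.sigmaFiberEquiv_apply, S.2]
  -- The Poisson masses add up to one, so almost surely only finitely many trips have arrived.
  have hall : Q (⋃ S, arrivedEq t S)ᶜ = 0 := by
    rw [prob_compl_eq_zero_iff (MeasurableSet.iUnion fun S => measurableSet_arrivedEq t S),
      measure_iUnion (disjoint_arrivedEq t) (fun S => measurableSet_arrivedEq t S)]
    have h1 := hsplit fun _ => 1
    simp only [mul_one] at h1
    rw [h1]
    simpa using (lintegral_countable' (μ := poissonMeasure s) fun _ => 1).symm
  ext B hB
  rw [Measure.map_apply (measurable_strength t) hB, compoundPoisson, poissonMix_apply _ _ hB,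
    ← hsplit fun n => convPow W n B, ← measure_inter_conull hall, inter_iUnion, measure_iUnion]
  · exact tsum_congr fun S => hQ.measure_strength_inter_arrivedEq t S hB
  · exact fun S T hST => (disjoint_arrivedEq t hST).mono inter_subset_right inter_subset_right
  · exact fun S => (measurable_strength t hB).inter (measurableSet_arrivedEq t S)

end Weights

/-! ### Smoothness of compound Poisson laws under translation -/

/-- This is the variance `N / 4` of the fair binomial law, read off from the variance identity of
the Bernstein polynomials at `1 / 2`. -/
lemma sum_choose_mul_sq (N : ℕ) :
    ∑ j ∈ Finset.range (N + 1), (N.choose j : ℝ) * ((N : ℝ) - 2 * j) ^ 2 = (N : ℝ) * 2 ^ N := by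
  have h := congrArg (Polynomial.eval (1 / 2 : ℝ)) (bernsteinPolynomial.variance ℝ N)
  simp only [bernsteinPolynomial, Polynomial.eval_finsetSum, Polynomial.eval_mul,
    Polynomial.eval_pow, Polynomial.eval_sub, nsmul_eq_mul, Polynomial.eval_natCast,
    Polynomial.eval_X, Polynomial.eval_one] at h
  have h2 : ∀ j ∈ Finset.range (N + 1), (N.choose j : ℝ) * ((N : ℝ) - 2 * j) ^ 2 =
      4 * 2 ^ N * (((N : ℝ) * (1 / 2) - j) ^ 2 *
        (N.choose j * (1 / 2) ^ j * (1 - 1 / 2) ^ (N - j))) := fun j hj => by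
    have hj' : j ≤ N := Nat.lt_succ_iff.1 (Finset.mem_range.1 hj)
    have h3 : (1 / 2 : ℝ) ^ j * (1 - 1 / 2) ^ (N - j) = (2 ^ N)⁻¹ := by
      norm_num only
      rw [← pow_add, Nat.add_sub_cancel' hj', one_div, inv_pow]
    rw [mul_assoc (N.choose j : ℝ), h3]
    field_simp
    ring
  rw [Finset.sum_congr rfl h2, ← Finset.mul_sum, h]
  ring

/-- Summation by parts turns differences of `f` into differences of binomial coefficients, which
with `N = n + 1` equal `N.choose j * (N - 2 j) / N`. What remains is the mean absolute deviation of
a fair binomial law, at most its standard deviation. -/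
lemma abs_sum_choose_sub_le (n : ℕ) (f : ℕ → ℝ) (hf : ∀ k, |f k| ≤ 1) :
    |∑ k ∈ Finset.range (n + 1), (n.choose k / 2 ^ n : ℝ) * (f k - f (k + 1))| ≤
      2 / √((n : ℝ) + 1) := by
  set N : ℝ := (n : ℝ) + 1 with hN
  have hNpos : 0 < N := by positivity
  have hsq : √N * √N = N := Real.mul_self_sqrt hNpos.le
  have hsqpos : 0 < √N := Real.sqrt_pos.2 hNpos
  have h1 : ∑ k ∈ Finset.range (n + 1), (n.choose k / 2 ^ n : ℝ) * (f k - f (k + 1)) =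
      ∑ j ∈ Finset.range (n + 2), (((n + 1).choose j : ℝ) * (N - 2 * j)) / (N * 2 ^ n) * f j := by
    -- The sum may be extended to `k = n + 1`, because `n.choose (n + 1) = 0`.
    have ha : ∑ k ∈ Finset.range (n + 1), (n.choose k / 2 ^ n : ℝ) * f k =
        ∑ k ∈ Finset.range (n + 1), (n.choose (k + 1) / 2 ^ n : ℝ) * f (k + 1) +
          1 / 2 ^ n * f 0 := by
      have := Finset.sum_range_succ' (fun k => (n.choose k / 2 ^ n : ℝ) * f k) (n + 1)
      rw [Finset.sum_range_succ] at this
      simpa using this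
    have hb : ∑ k ∈ Finset.range (n + 1), (n.choose k / 2 ^ n : ℝ) * (f k - f (k + 1)) =
        ∑ k ∈ Finset.range (n + 1), (n.choose k / 2 ^ n : ℝ) * f k -
          ∑ k ∈ Finset.range (n + 1), (n.choose k / 2 ^ n : ℝ) * f (k + 1) := by
      rw [← Finset.sum_sub_distrib]
      exact Finset.sum_congr rfl fun k _ => mul_sub _ _ _
    rw [hb, ha, Finset.sum_range_succ' _ (n + 1), add_sub_right_comm, ← Finset.sum_sub_distrib]
    congr 1
    · refine Finset.sum_congr rfl fun k _ => ?_
      have e1 : (((n + 1) * n.choose k : ℕ) : ℝ) = ((n + 1).choose (k + 1) * (k + 1) : ℕ) :=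
        congrArg _ (Nat.add_one_mul_choose_eq n k)
      have e2 : ((n + 1).choose (k + 1) : ℝ) = n.choose k + n.choose (k + 1) := by
        rw [Nat.choose_succ_succ]; push_cast; ring
      push_cast at e1
      rw [e2] at e1 ⊢
      field_simp
      push_cast
      linear_combination (-2 * f (k + 1)) * e1 + ((n.choose k : ℝ) * f (k + 1) - n.choose (k + 1) * f (k + 1)) * hN
    · simp only [Nat.choose_zero_right, Nat.cast_one, Nat.cast_zero, mul_zero, sub_zero, one_mul]
      congr 1
      field_simp
  rw [h1]
  -- The inequality of arithmetic and geometric means, scaled by `√N`, plays the role of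
  -- Cauchy–Schwarz.
  have h2 : ∀ j : ℕ, |N - 2 * j| ≤ (√N + (N - 2 * j) ^ 2 / √N) / 2 := fun j => by
    rw [le_div_iff₀ two_pos, ← sub_nonneg]
    have : √N + (N - 2 * j) ^ 2 / √N - |N - 2 * j| * 2 = (√N - |N - 2 * j|) ^ 2 / √N := by
      field_simp
      rw [← sq_abs (N - 2 * j)]
      ring
    rw [this]; positivity
  have hs0 : ∑ j ∈ Finset.range (n + 2), ((n + 1).choose j : ℝ) = 2 ^ (n + 1) := by
    exact_mod_cast Nat.sum_range_choose (n + 1)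
  have hs2 : ∑ j ∈ Finset.range (n + 2), ((n + 1).choose j : ℝ) * (N - 2 * j) ^ 2 =
      N * 2 ^ (n + 1) := by
    have := sum_choose_mul_sq (n + 1)
    push_cast at this
    simpa [hN] using this
  calc _ ≤ ∑ j ∈ Finset.range (n + 2),
          |(((n + 1).choose j : ℝ) * (N - 2 * j)) / (N * 2 ^ n) * f j| :=
        Finset.abs_sum_le_sum_abs _ _
    _ ≤ ∑ j ∈ Finset.range (n + 2), ((n + 1).choose j : ℝ) *
          ((√N + (N - 2 * j) ^ 2 / √N) / 2) / (N * 2 ^ n) := by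
        refine Finset.sum_le_sum fun j _ => ?_
        rw [abs_mul, abs_div, abs_mul, abs_of_nonneg (by positivity : (0 : ℝ) ≤ (n + 1).choose j),
          abs_of_pos (by positivity : 0 < N * 2 ^ n)]
        refine (mul_le_of_le_one_right (by positivity) (hf j)).trans ?_
        gcongr
        exact h2 j
    _ = (√N * ∑ j ∈ Finset.range (n + 2), ((n + 1).choose j : ℝ) +
          (∑ j ∈ Finset.range (n + 2), ((n + 1).choose j : ℝ) * (N - 2 * j) ^ 2) / √N) / 2 /
            (N * 2 ^ n) := by
        rw [Finset.mul_sum, Finset.sum_div, ← Finset.sum_add_distrib, Finset.sum_div,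
          Finset.sum_div]
        refine Finset.sum_congr rfl fun j _ => ?_
        ring
    _ = 2 / √N := by
        rw [hs0, hs2, pow_succ]
        field_simp
        rw [sq, hsq]
        ring

/-- The fair two-point law on `{0, z}`. -/
def twoPoint (z : ℝ) : Measure ℝ :=
  (1 / 2 : ℝ≥0) • Measure.dirac 0 + (1 / 2 : ℝ≥0) • Measure.dirac z

instance (z : ℝ) : IsProbabilityMeasure (twoPoint z) := by
  refine ⟨?_⟩
  simp only [twoPoint, Measure.coe_add, Measure.coe_nnreal_smul_apply, Pi.add_apply, measure_univ, mul_one]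
  rw [← ENNReal.coe_add, ← ENNReal.coe_one]
  congr 1
  exact add_halves 1

/-- On characteristic functions this is the binomial theorem for `((1 + exp (i ξ z)) / 2) ^ n`. -/
lemma convPow_twoPoint (z : ℝ) (n : ℕ) :
    convPow (twoPoint z) n =
      ∑ k ∈ Finset.range (n + 1), (n.choose k / 2 ^ n : ℝ≥0) • Measure.dirac (k * z) := by
  refine Measure.ext_of_charFun ?_
  ext ξ
  have hint : ∀ (μ : Measure ℝ) [IsFiniteMeasure μ],
      Integrable (fun x : ℝ => Complex.exp (ξ * x * Complex.I)) μ := fun μ _ => by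
    refine Integrable.of_bound (C := 1) (by fun_prop) (.of_forall fun x => ?_)
    have : (ξ : ℂ) * x * Complex.I = ((ξ * x : ℝ) : ℂ) * Complex.I := by push_cast; ring
    rw [this, Complex.norm_exp_ofReal_mul_I]
  rw [charFun_convPow, charFun_apply_real, charFun_apply_real, twoPoint,
    integral_add_measure (hint _) (hint _), integral_finsetSum_measure (fun k _ => hint _)]
  simp only [integral_smul_nnreal_measure, integral_dirac]
  simp only [NNReal.smul_def, Complex.real_smul]
  push_cast
  have h0 : Complex.exp (ξ * 0 * Complex.I) = 1 := by simp
  rw [h0, ← mul_add, mul_pow, add_comm, add_pow, Finset.mul_sum]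
  refine Finset.sum_congr rfl fun k _ => ?_
  rw [← Complex.exp_nat_mul, one_pow]
  simp only [one_div, inv_pow, mul_one]
  have : (k : ℂ) * (ξ * z * Complex.I) = ξ * (k * z) * Complex.I := by ring
  rw [this]
  ring

lemma convPow_twoPoint_real (z : ℝ) (n : ℕ) {B : Set ℝ} (hB : MeasurableSet B) :
    (convPow (twoPoint z) n).real B =
      ∑ k ∈ Finset.range (n + 1), (n.choose k / 2 ^ n : ℝ) * B.indicator 1 (k * z) := by
  rw [convPow_twoPoint, measureReal_def, Measure.finsetSum_apply,
    ENNReal.toReal_sum (fun k _ => by finiteness)]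
  refine Finset.sum_congr rfl fun k _ => ?_
  rw [Measure.coe_nnreal_smul_apply, Measure.dirac_apply' _ hB, ENNReal.toReal_mul]
  congr 1
  by_cases h : (k * z : ℝ) ∈ B <;> simp [h]

lemma tvDist_convPow_twoPoint_le (z : ℝ) (n : ℕ) :
    tvDist (convPow (twoPoint z) n) ((convPow (twoPoint z) n).map (z + ·)) ≤
      ENNReal.ofReal (2 / √((n : ℝ) + 1)) := by
  refine tvDist_le fun B hB => ENNReal.ofReal_le_ofReal ?_
  rw [map_measureReal_apply (measurable_const_add z) hB, convPow_twoPoint_real z n hB,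
    convPow_twoPoint_real z n (measurable_const_add z hB), ← Finset.sum_sub_distrib]
  refine le_trans (le_of_eq ?_) (abs_sum_choose_sub_le n (fun k => B.indicator 1 (k * z)) ?_)
  · congr 1
    refine Finset.sum_congr rfl fun k _ => ?_
    rw [mul_sub]
    congr 2
    have : ((k + 1 : ℕ) : ℝ) * z = z + k * z := by push_cast; ring
    simp only [this]
    rfl
  · intro k
    by_cases h : (k * z : ℝ) ∈ B <;> simp [h]

lemma map_add_poissonMix (s : ℝ≥0) (κ : ℕ → Measure ℝ) (z : ℝ) :
    (poissonMix s κ).map (z + ·) = poissonMix s fun n => (κ n).map (z + ·) := by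
  ext B hB
  rw [Measure.map_apply (measurable_const_add z) hB, poissonMix_apply _ _ hB,
    poissonMix_apply _ _ (measurable_const_add z hB)]
  simp only [Measure.map_apply (measurable_const_add z) hB]

lemma map_add_conv (μ ν : Measure ℝ) [SFinite μ] [SFinite ν] (z : ℝ) :
    (μ ∗ ν).map (z + ·) = μ ∗ ν.map (z + ·) := by
  rw [← Measure.dirac_conv, ← Measure.dirac_conv, ← Measure.conv_assoc, Measure.conv_comm _ μ,
    Measure.conv_assoc]

instance isProbabilityMeasure_map_add (μ : Measure ℝ) [IsProbabilityMeasure μ] (z : ℝ) :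
    IsProbabilityMeasure (μ.map (z + ·)) :=
  Measure.isProbabilityMeasure_map (by fun_prop)

/-- For a Poisson variable `N` with mean `s`, `2 / √(N + 1) ≤ (s / (N + 1) + 1) / √s`, and the mean
of `s / (N + 1)` is the probability of `N ≥ 1`, which is at most one. -/
lemma tsum_poisson_mul_inv_sqrt_le (s : ℝ≥0) (hs : 0 < s) :
    ∑' n : ℕ, poissonMeasure s {n} * ENNReal.ofReal (2 / √((n : ℝ) + 1)) ≤
      ENNReal.ofReal (2 / √(s : ℝ)) := by
  have hs' : (0 : ℝ) < s := hs
  have hsq : √(s : ℝ) * √(s : ℝ) = s := Real.mul_self_sqrt hs'.le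
  have hsp : 0 < √(s : ℝ) := Real.sqrt_pos.2 hs'
  have h1 := hasSum_one_poissonMeasure s
  have h2 : HasSum (fun n : ℕ => Real.exp (-s) * s ^ (n + 1) / (n + 1).factorial)
      (1 - Real.exp (-s)) := by
    rw [← hasSum_nat_add_iff' 1] at h1
    simpa using h1
  have h3 : HasSum (fun n : ℕ => (Real.exp (-s) * s ^ (n + 1) / (n + 1).factorial +
      Real.exp (-s) * s ^ n / n.factorial) / √(s : ℝ)) ((1 - Real.exp (-s) + 1) / √(s : ℝ)) :=
    (h2.add h1).div_const _
  have hle : ∀ n : ℕ, poissonMeasure s {n} * ENNReal.ofReal (2 / √((n : ℝ) + 1)) ≤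
      ENNReal.ofReal ((Real.exp (-s) * s ^ (n + 1) / (n + 1).factorial +
        Real.exp (-s) * s ^ n / n.factorial) / √(s : ℝ)) := fun n => by
    rw [poissonMeasure_singleton, ← ENNReal.ofReal_mul (by positivity)]
    refine ENNReal.ofReal_le_ofReal ?_
    have hn : (0 : ℝ) < n + 1 := by positivity
    have hnsq : √((n : ℝ) + 1) * √((n : ℝ) + 1) = n + 1 := Real.mul_self_sqrt hn.le
    have hnp : 0 < √((n : ℝ) + 1) := Real.sqrt_pos.2 hn
    have e : (Real.exp (-s) * s ^ (n + 1) / (n + 1).factorial +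
        Real.exp (-s) * s ^ n / n.factorial) / √(s : ℝ) =
        Real.exp (-s) * s ^ n / n.factorial * ((s / (n + 1) + 1) / √(s : ℝ)) := by
      rw [Nat.factorial_succ]
      push_cast
      field_simp
      ring
    rw [e]
    refine mul_le_mul_of_nonneg_left ?_ (by positivity)
    rw [div_le_div_iff₀ hnp hsp]
    have e2 : ((s : ℝ) / (n + 1) + 1) * √((n : ℝ) + 1) - 2 * √(s : ℝ) =
        (√(s : ℝ) - √((n : ℝ) + 1)) ^ 2 / √((n : ℝ) + 1) := by
      rw [← hnsq, ← hsq]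
      simp only [Real.sqrt_mul_self hnp.le, Real.sqrt_mul_self hsp.le]
      field_simp
      ring
    have : 0 ≤ (√(s : ℝ) - √((n : ℝ) + 1)) ^ 2 / √((n : ℝ) + 1) := by positivity
    linarith
  refine (ENNReal.tsum_le_tsum hle).trans ?_
  rw [← ENNReal.ofReal_tsum_of_nonneg (fun n => by positivity) h3.summable, h3.tsum_eq]
  refine ENNReal.ofReal_le_ofReal ?_
  gcongr
  linarith [Real.exp_pos (-(s : ℝ))]

/-- Every jump contains an independent fair coin flip of size `z`. Given `n` jumps, convolution with
the `A`-parts does not increase the distance, so the binomial bound applies. -/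
lemma tvDist_compoundPoisson_conv_twoPoint_le (s : ℝ≥0) (hs : 0 < s) (A : Measure ℝ)
    [IsProbabilityMeasure A] (z : ℝ) :
    tvDist (compoundPoisson s (A ∗ twoPoint z))
      ((compoundPoisson s (A ∗ twoPoint z)).map (z + ·)) ≤ ENNReal.ofReal (2 / √(s : ℝ)) := by
  rw [compoundPoisson, map_add_poissonMix]
  refine (tvDist_poissonMix_le s _ _).trans ((ENNReal.tsum_le_tsum fun n => ?_).trans
    (tsum_poisson_mul_inv_sqrt_le s hs))
  gcongr
  rw [convPow_conv, map_add_conv]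
  exact (tvDist_conv_left_le _ _ _).trans (tvDist_convPow_twoPoint_le z n)

/-- The mass of the common part is the infimum of `μ t + ν tᶜ`, and `ν t` exceeds `μ t` by at most
the distance. -/
lemma one_sub_tvDist_le_inf (μ ν : Measure ℝ) [IsProbabilityMeasure μ] [IsProbabilityMeasure ν] :
    1 - tvDist μ ν ≤ (μ ⊓ ν) univ := by
  rw [Measure.inf_apply MeasurableSet.univ]
  refine le_sInf ?_
  rintro m ⟨t, rfl⟩
  simp only [inter_univ]
  -- Passing to a measurable hull keeps the `μ`-measure and only shrinks the complement.
  rw [← measure_toMeasurable (μ := μ) t]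
  set T := toMeasurable μ t
  have hT : MeasurableSet T := measurableSet_toMeasurable _ _
  have hsub : Tᶜ ⊆ tᶜ := compl_subset_compl.2 (subset_toMeasurable _ _)
  refine le_trans ?_ (add_le_add_right (measure_mono hsub) _)
  rw [tsub_le_iff_right]
  have h := ofReal_abs_sub_le_tvDist μ ν hT
  have h1 : ν T ≤ μ T + tvDist μ ν := by
    rw [← ofReal_measureReal (μ := ν), ← ofReal_measureReal (μ := μ)]
    refine le_trans ?_ (add_le_add_right h _)
    rw [← ENNReal.ofReal_add measureReal_nonneg (abs_nonneg _)]
    refine ENNReal.ofReal_le_ofReal ?_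
    linarith [neg_abs_le (μ.real T - ν.real T)]
  calc (1 : ℝ≥0∞) = ν T + ν Tᶜ := by rw [measure_add_measure_compl hT, measure_univ]
    _ ≤ μ T + tvDist μ ν + ν Tᶜ := by gcongr
    _ = _ := by ring

/-- A law that is close to its translate by `-z` has a component that is a convolution with the
two-point law on `{0, z}`. -/
lemma exists_twoPoint_component (W : Measure ℝ) [IsProbabilityMeasure W] (z : ℝ)
    (hz : tvDist W (W.map (-z + ·)) ≤ 1 / 2) :
    ∃ A R : Measure ℝ, IsProbabilityMeasure A ∧ IsProbabilityMeasure R ∧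
      W = (1 / 2 : ℝ≥0) • (A ∗ twoPoint z) + (1 / 2 : ℝ≥0) • R := by
  set W' := W.map (-z + ·) with hW'
  -- Both `D` and its translate by `z` lie below `W`, and `D` has mass at least `1 / 2`. Hence the
  -- normalised `A` and its translate lie below `2 W`, and half of their average lies below `W`.
  set D := W ⊓ W' with hD
  have hD1 : D ≤ W := inf_le_left
  have hD2 : D ≤ W' := inf_le_right
  have : IsFiniteMeasure D := isFiniteMeasure_of_le W hD1
  have hmass : 1 / 2 ≤ D univ := by
    refine le_trans ?_ (one_sub_tvDist_le_inf W W')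
    calc (1 / 2 : ℝ≥0∞) = 1 - 1 / 2 := by simp
      _ ≤ _ := tsub_le_tsub_left hz _
  have hD0 : D univ ≠ 0 := fun h => by simp [h] at hmass
  have : NeZero D := ⟨fun h => hD0 (by simp [h])⟩
  set A := (D univ)⁻¹ • D with hA
  have : IsProbabilityMeasure A := isProbabilityMeasureSMul
  have hDz : D.map (z + ·) ≤ W := by
    refine (Measure.map_mono hD2 (measurable_const_add z)).trans (le_of_eq ?_)
    rw [hW', Measure.map_map (by fun_prop) (by fun_prop)]
    simp [Function.comp_def]
  have hAb : A ∗ twoPoint z = (1 / 2 : ℝ≥0) • A + (1 / 2 : ℝ≥0) • A.map (z + ·) := by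
    ext B hB
    rw [Measure.conv_comm, conv_apply' _ _ hB, twoPoint, lintegral_add_measure,
      lintegral_smul_measure, lintegral_smul_measure,
      lintegral_dirac' _ (measurable_map_add_apply A hB), lintegral_dirac' _ (measurable_map_add_apply A hB)]
    simp [ENNReal.smul_def]
  have hinv : (D univ)⁻¹ ≤ 2 := by
    rw [ENNReal.inv_le_iff_inv_le]
    simpa using hmass
  have hle : (1 / 2 : ℝ≥0) • (A ∗ twoPoint z) ≤ W := by
    refine Measure.le_intro fun B hB _ => ?_
    have h1 : A B ≤ 2 * W B := by
      rw [hA, Measure.smul_apply, smul_eq_mul]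
      exact mul_le_mul' hinv (hD1 B)
    have h2 : A.map (z + ·) B ≤ 2 * W B := by
      rw [hA, Measure.map_smul, Measure.smul_apply, smul_eq_mul]
      exact mul_le_mul' hinv (hDz B)
    have hhalf : ((1 / 2 : ℝ≥0) : ℝ≥0∞) = 2⁻¹ := by simp
    rw [hAb]
    simp only [Measure.coe_nnreal_smul_apply, Measure.coe_add, Pi.add_apply, hhalf]
    calc (2 : ℝ≥0∞)⁻¹ * (2⁻¹ * A B + 2⁻¹ * A.map (z + ·) B)
        ≤ 2⁻¹ * (2⁻¹ * (2 * W B) + 2⁻¹ * (2 * W B)) := by gcongr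
      _ = W B := by
        rw [← mul_assoc, ENNReal.inv_mul_cancel (by simp) (by simp), one_mul, ← two_mul,
          ← mul_assoc, ENNReal.inv_mul_cancel (by simp) (by simp), one_mul]
  set V := (1 / 2 : ℝ≥0) • (A ∗ twoPoint z) with hV
  have hVm : V univ = 2⁻¹ := by
    rw [hV, Measure.coe_nnreal_smul_apply, measure_univ]; simp
  refine ⟨A, (2 : ℝ≥0) • (W - V), inferInstance, ⟨?_⟩, ?_⟩
  · rw [Measure.coe_nnreal_smul_apply, Measure.sub_apply MeasurableSet.univ hle, measure_univ, hVm]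
    simp only [ENNReal.coe_ofNat, ENNReal.one_sub_inv_two]
    exact ENNReal.mul_inv_cancel (by simp) (by simp)
  · rw [smul_smul]
    simp only [one_div, ne_eq, OfNat.ofNat_ne_zero, not_false_eq_true, inv_mul_cancel₀, one_smul]
    rw [add_comm]
    simpa [hV] using (Measure.sub_add_cancel_of_le hle).symm

/-- By continuity of translation, for all small `z` half of the jump law has the form `A ∗ twoPoint
z`. The other half is an independent summand and can be dropped; halving the intensity costs a
factor below `2`. -/
lemma exists_tvDist_compoundPoisson_map_le (W : Measure ℝ) [IsProbabilityMeasure W]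
    (hW : W ≪ volume) :
    ∃ z₀ > 0, ∀ z : ℝ, |z| ≤ z₀ → ∀ s : ℝ≥0, 0 < s →
      tvDist (compoundPoisson s W) ((compoundPoisson s W).map (z + ·)) ≤
        ENNReal.ofReal (4 / √(s : ℝ)) := by
  have h := (tendsto_tvDist_map_add hW).eventually_le_const (u := 1 / 2) (by simp)
  obtain ⟨δ, hδ, hball⟩ := Metric.eventually_nhds_iff.1 h
  refine ⟨δ / 2, by positivity, fun z hz s hs => ?_⟩
  obtain ⟨A, R, hA, hR, hWe⟩ := exists_twoPoint_component W z
    (hball (by simp only [dist_zero_right, norm_neg, Real.norm_eq_abs]; linarith))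
  rw [compoundPoisson_mix s (1 / 2) (1 / 2) (add_halves 1) W _ R hWe, map_add_conv]
  refine (tvDist_conv_left_le _ _ _).trans ((tvDist_compoundPoisson_conv_twoPoint_le _
    (by positivity) A z).trans (ENNReal.ofReal_le_ofReal ?_))
  have hs' : (0 : ℝ) < s := hs
  push_cast
  rw [div_le_div_iff₀ (Real.sqrt_pos.2 (by positivity)) (Real.sqrt_pos.2 hs')]
  have : √(s : ℝ) ≤ 2 * √((s : ℝ) * (1 / 2)) := by
    refine Real.sqrt_le_left (by positivity) |>.2 ?_ 
    rw [mul_pow, Real.sq_sqrt (by positivity)]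
    linarith
  linarith

lemma tvDist_map_nsmul_add_le (μ : Measure ℝ) (z : ℝ) (n : ℕ) :
    tvDist μ (μ.map ((n * z) + ·)) ≤ n * tvDist μ (μ.map (z + ·)) := by
  induction n with
  | zero => simp
  | succ n ih =>
    refine (tvDist_triangle μ (μ.map (z + ·)) _).trans ?_
    have : μ.map (((n + 1 : ℕ) * z) + ·) = (μ.map ((n * z) + ·)).map (z + ·) := by
      rw [Measure.map_map (by fun_prop) (by fun_prop)]
      congr 1
      ext x
      simp only [Function.comp_apply]
      push_cast; ring
    rw [this]
    push_cast
    rw [add_mul, one_mul, add_comm]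
    exact add_le_add_left ((tvDist_map_le _ _ (measurable_const_add z)).trans ih) _

/-- Compound Poisson laws with an absolutely continuous jump law vary slowly under translation. -/
lemma exists_tvDist_compoundPoisson_map_le_mul (W : Measure ℝ) [IsProbabilityMeasure W]
    (hW : W ≪ volume) :
    ∃ C : ℝ, 0 < C ∧ ∀ (y : ℝ) (s : ℝ≥0), 0 < s →
      tvDist (compoundPoisson s W) ((compoundPoisson s W).map (y + ·)) ≤
        ENNReal.ofReal (C * (|y| + 1) / √(s : ℝ)) := by
  obtain ⟨z₀, hz₀, h⟩ := exists_tvDist_compoundPoisson_map_le W hW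
  refine ⟨4 * (1 / z₀ + 1), by positivity, fun y s hs => ?_⟩
  -- The translation by `y` is cut into `n` equal steps of length at most `z₀`; the added one keeps
  -- `n` positive and accounts for the `1` in `|y| + 1`.
  set n := ⌊|y| / z₀⌋₊ + 1 with hn
  have hn1 : |y| / z₀ ≤ n := by rw [hn]; push_cast; exact (Nat.lt_floor_add_one _).le
  have hn2 : (n : ℝ) ≤ |y| / z₀ + 1 := by
    rw [hn]; push_cast
    gcongr
    exact Nat.floor_le (by positivity)
  have hnpos : (0 : ℝ) < n := by positivity
  have hz : |y / n| ≤ z₀ := by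
    rw [abs_div, abs_of_pos hnpos, div_le_iff₀ hnpos]
    rw [div_le_iff₀ hz₀] at hn1
    linarith
  have h1 := tvDist_map_nsmul_add_le (compoundPoisson s W) (y / n) n
  rw [mul_div_cancel₀ _ hnpos.ne'] at h1
  have hs' : (0 : ℝ) < s := hs
  refine h1.trans ((mul_le_mul_right (h _ hz s hs) _).trans ?_)
  rw [← ENNReal.ofReal_natCast, ← ENNReal.ofReal_mul hnpos.le]
  refine ENNReal.ofReal_le_ofReal ?_
  rw [← mul_div_assoc]
  refine div_le_div_of_nonneg_right ?_ (Real.sqrt_nonneg _)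
  have : |y| / z₀ + 1 ≤ (1 / z₀ + 1) * (|y| + 1) := by
    have h3 : 0 ≤ |y| := abs_nonneg y
    have h4 : 0 < 1 / z₀ := by positivity
    rw [div_eq_mul_one_div]
    nlinarith
  nlinarith

/-! ### The central limit theorem in total variation for compound Poisson laws -/

lemma tvDist_map_affine (μ ν : Measure ℝ) (a : ℝ) {c : ℝ} (hc : c ≠ 0) :
    tvDist (μ.map fun x => c * (a + x)) (ν.map fun x => c * (a + x)) = tvDist μ ν := by
  refine le_antisymm (tvDist_map_le _ _ (by fun_prop)) ?_
  have h := tvDist_map_le (μ.map fun x => c * (a + x)) (ν.map fun x => c * (a + x))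
    (f := fun y => -a + c⁻¹ * y) (by fun_prop)
  rw [Measure.map_map (by fun_prop) (by fun_prop), Measure.map_map (by fun_prop) (by fun_prop)] at h
  have hid : (fun y => -a + c⁻¹ * y) ∘ (fun x => c * (a + x)) = id := by
    ext x; simp [hc]
  simpa [hid] using h

lemma map_affine_eq (μ : Measure ℝ) (a c : ℝ) :
    μ.map (fun x => c * (a + x)) = (μ.map (a + ·)).map (c * ·) := by
  rw [Measure.map_map (by fun_prop) (by fun_prop)]; rfl

lemma gaussianReal_map_affine (m a c : ℝ) (v w : ℝ≥0) (h : (w : ℝ) = c ^ 2 * v) :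
    (gaussianReal m v).map (fun x => c * (a + x)) = gaussianReal (c * (m + a)) w := by
  rw [map_affine_eq, gaussianReal_map_const_add, gaussianReal_map_const_mul]
  congr 1
  exact NNReal.coe_injective (by simp [h])

lemma conv_map_affine (μ ν : Measure ℝ) [SFinite μ] [SFinite ν] (a c : ℝ) :
    (μ ∗ ν).map (fun x => c * (a + x)) = μ.map (c * ·) ∗ ν.map fun x => c * (a + x) := by
  rw [map_affine_eq, map_affine_eq, map_add_conv]
  exact Measure.map_conv_addMonoidHom (AddMonoidHom.mulLeft c) (measurable_const_mul c)

lemma isLittleO_charFun_sub_taylor (W : Measure ℝ) [IsProbabilityMeasure W]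
    (hW : MemLp id 2 W) :
    (fun u : ℝ => charFun W u - (1 + (∫ x, x ∂W : ℝ) * u * Complex.I -
      (∫ x, x ^ 2 ∂W : ℝ) * u ^ 2 / 2)) =o[𝓝 0] fun u : ℝ => u ^ 2 := by
  have h := taylor_isLittleO_univ (x₀ := 0) (contDiff_charFun (n := 2) (by exact_mod_cast hW))
  simp only [sub_zero] at h
  refine h.congr_left fun u => ?_
  have h2 := taylorWithinEval_charFun_two_zero (X := id) (P := W) aemeasurable_id
    (by simpa using hW) u
  rw [Measure.map_id] at h2
  rw [h2]
  simp

/-- With `u = ξ / √s` the exponent is `s (φ_W(u) - 1)` minus its linear term, so a second-order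
expansion suffices. The limiting variance is the raw second moment of `W`, since the number of jumps
fluctuates too. -/
lemma tendsto_charFun_standardized (W : Measure ℝ) [IsProbabilityMeasure W]
    (hW : MemLp id 2 W) {v : ℝ≥0} (hv : (v : ℝ) = ∫ x, x ^ 2 ∂W) {s : ℕ → ℝ≥0}
    (hs : Tendsto s atTop atTop) (ξ : ℝ) :
    Tendsto (fun n => charFun ((compoundPoisson (s n) W).map
        fun x => (√(s n : ℝ))⁻¹ * (-(s n * ∫ x, x ∂W) + x)) ξ) atTop
      (𝓝 (charFun (gaussianReal 0 v) ξ)) := by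
  set m := ∫ x, x ∂W with hm
  have hsr : Tendsto (fun n => (s n : ℝ)) atTop atTop := NNReal.tendsto_coe_atTop.2 hs
  have hu : Tendsto (fun n => (√(s n : ℝ))⁻¹ * ξ) atTop (𝓝 0) := by
    have : Tendsto (fun n => (√(s n : ℝ))⁻¹) atTop (𝓝 0) :=
      tendsto_inv_atTop_zero.comp (Real.tendsto_sqrt_atTop.comp hsr)
    simpa using this.mul_const ξ
  have hR := (isLittleO_charFun_sub_taylor W hW).comp_tendsto hu
  set R : ℝ → ℂ := fun u => charFun W u - (1 + (m : ℝ) * u * Complex.I -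
      (∫ x, x ^ 2 ∂W : ℝ) * u ^ 2 / 2) with hRdef
  have hpos : ∀ᶠ n in atTop, (0 : ℝ) < s n := hsr.eventually_gt_atTop 0
  -- Here `s u² = ξ²`, so `s` times a remainder `o(u²)` vanishes.
  have hlim : Tendsto (fun n => (s n : ℂ) * R ((√(s n : ℝ))⁻¹ * ξ)) atTop (𝓝 0) := by
    have h1 : (fun n => (s n : ℂ) * R ((√(s n : ℝ))⁻¹ * ξ)) =o[atTop]
        fun n => (s n : ℂ) * ((((√(s n : ℝ))⁻¹ * ξ) ^ 2 : ℝ) : ℂ) := by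
      refine (Asymptotics.isBigO_refl _ _).mul_isLittleO ?_
      refine hR.trans_isBigO ?_
      refine Asymptotics.IsBigO.of_bound 1 (.of_forall fun n => ?_)
      simp [Function.comp_apply]
    have h2 : (fun n => (s n : ℂ) * ((((√(s n : ℝ))⁻¹ * ξ) ^ 2 : ℝ) : ℂ)) =ᶠ[atTop]
        fun _ => ((ξ ^ 2 : ℝ) : ℂ) := by
      filter_upwards [hpos] with n hn
      have : (s n : ℝ) * ((√(s n : ℝ))⁻¹ * ξ) ^ 2 = ξ ^ 2 := by
        rw [mul_pow, inv_pow, Real.sq_sqrt hn.le]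
        field_simp
      exact_mod_cast this
    have h3 := h1.trans_eventuallyEq h2
    have h4 : (fun n => (s n : ℂ) * R ((√(s n : ℝ))⁻¹ * ξ)) =o[atTop] fun _ => (1 : ℝ) :=
      h3.trans_isBigO (Asymptotics.isBigO_const_const _ one_ne_zero _)
    exact (Asymptotics.isLittleO_one_iff ℝ).1 h4
  have hexp : Tendsto (fun n => Complex.exp ((s n : ℂ) * R ((√(s n : ℝ))⁻¹ * ξ) -
      (v : ℂ) * ξ ^ 2 / 2)) atTop (𝓝 (Complex.exp (0 - (v : ℂ) * ξ ^ 2 / 2))) :=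
    (Complex.continuous_exp.tendsto _).comp (hlim.sub_const _)
  rw [charFun_gaussianReal]
  have e0 : (ξ : ℂ) * (0 : ℝ) * Complex.I - v * ξ ^ 2 / 2 = 0 - (v : ℂ) * ξ ^ 2 / 2 := by simp
  rw [e0]
  refine hexp.congr' ?_
  filter_upwards [hpos] with n hn
  rw [map_affine_eq, charFun_map_mul, charFun_map_const_add, charFun_compoundPoisson,
    ← Complex.exp_add]
  congr 1
  have hsq : ((√(s n : ℝ) : ℝ) : ℂ) ^ 2 = s n := by
    exact_mod_cast congrArg (fun x : ℝ => (x : ℂ)) (Real.sq_sqrt hn.le)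
  have hsn : ((√(s n : ℝ) : ℝ) : ℂ) ≠ 0 := by
    exact_mod_cast (Real.sqrt_pos.2 hn).ne'
  simp only [hRdef, ← hv, RCLike.inner_apply, conj_trivial]
  push_cast
  have hsq' : (s n : ℂ) * ((((√(s n : ℝ) : ℝ) : ℂ))⁻¹ * ξ) ^ 2 = ξ ^ 2 := by
    rw [← hsq]; field_simp
  linear_combination ((v : ℂ) / 2) * hsq'

/-- The convolution of a density with a measure has a density. -/
lemma withDensity_conv {g : ℝ → ℝ≥0∞} (hg : Measurable g) (Q : Measure ℝ) [SFinite Q] :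
    volume.withDensity g ∗ Q = volume.withDensity fun x => ∫⁻ y, g (x - y) ∂Q := by
  refine Measure.ext_of_lintegral _ fun f hf => ?_
  have hm : Measurable fun x => ∫⁻ y, g (x - y) ∂Q :=
    Measurable.lintegral_prod_right (f := fun x y => g (x - y)) (by fun_prop)
  rw [Measure.lintegral_conv hf, lintegral_withDensity_eq_lintegral_mul _ hg (by fun_prop),
    lintegral_withDensity_eq_lintegral_mul _ hm hf]
  simp only [Pi.mul_apply]
  calc ∫⁻ x, g x * ∫⁻ y, f (x + y) ∂Q
      = ∫⁻ x, ∫⁻ y, g x * f (x + y) ∂Q := by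
        refine lintegral_congr fun x => ?_
        rw [lintegral_const_mul _ (by fun_prop)]
    _ = ∫⁻ y, (∫⁻ x, g x * f (x + y)) ∂Q := lintegral_lintegral_swap (by fun_prop)
    _ = ∫⁻ y, (∫⁻ x, g (x - y) * f x) ∂Q := by
        refine lintegral_congr fun y => ?_
        rw [← lintegral_add_right_eq_self (fun x => g (x - y) * f x) y]
        simp
    _ = ∫⁻ x, ∫⁻ y, g (x - y) * f x ∂Q := lintegral_lintegral_swap (by fun_prop)
    _ = _ := by
        refine lintegral_congr fun x => ?_
        rw [lintegral_mul_const _ (by fun_prop)]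

/-- Weak convergence becomes convergence in total variation after Gaussian smoothing. -/
lemma tendsto_tvDist_gaussian_conv {Q : ℕ → ProbabilityMeasure ℝ} {Q₀ : ProbabilityMeasure ℝ}
    (h : Tendsto Q atTop (𝓝 Q₀)) {δ : ℝ≥0} (hδ : δ ≠ 0) :
    Tendsto (fun n => tvDist (gaussianReal 0 δ ∗ (Q₀ : Measure ℝ))
      (gaussianReal 0 δ ∗ (Q n : Measure ℝ))) atTop (𝓝 0) := by
  rw [ProbabilityMeasure.tendsto_iff_forall_lintegral_tendsto] at h
  have hmeas : ∀ Q : Measure ℝ, SFinite Q →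
      Measurable fun x => ∫⁻ y, gaussianPDF 0 δ (x - y) ∂Q := fun Q _ =>
    Measurable.lintegral_prod_right (f := fun x y => gaussianPDF 0 δ (x - y)) (by fun_prop)
  have hconv : ∀ Q : Measure ℝ, SFinite Q → gaussianReal 0 δ ∗ Q =
      volume.withDensity fun x => ∫⁻ y, gaussianPDF 0 δ (x - y) ∂Q := fun Q _ => by
    rw [gaussianReal_of_var_ne_zero _ hδ, withDensity_conv (measurable_gaussianPDF 0 δ)]
  have hp : ∀ Q : Measure ℝ, IsProbabilityMeasure Q → IsProbabilityMeasure
      (volume.withDensity fun x => ∫⁻ y, gaussianPDF 0 δ (x - y) ∂Q) := fun Q _ => by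
    rw [← hconv Q inferInstance]; infer_instance
  have := hp Q₀ inferInstance
  rw [hconv Q₀ inferInstance]
  simp_rw [fun n => hconv (Q n) inferInstance]
  refine tendsto_tvDist_withDensity (fun n => hmeas _ inferInstance) (hmeas _ inferInstance)
    (fun n => hp _ inferInstance) (.of_forall fun x => ?_)
  -- The smoothed density at `x` is the integral of this test function of `y`, so weak convergence
  -- yields pointwise convergence of densities.
  let f : BoundedContinuousFunction ℝ ℝ :=
    BoundedContinuousFunction.ofNormedAddCommGroup
      (fun y => gaussianPDFReal 0 δ (x - y)) (by unfold gaussianPDFReal; fun_prop)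
      ((√(2 * Real.pi * δ))⁻¹) (fun y => by
        rw [Real.norm_of_nonneg (gaussianPDFReal_nonneg _ _ _), gaussianPDFReal]
        refine mul_le_of_le_one_right (by positivity) (Real.exp_le_one_iff.2 ?_)
        rw [neg_div]
        exact neg_nonpos.2 (by positivity))
  exact h f.nnrealPart

lemma tendsto_tvDist_gaussianReal_var {ι : Type*} {l : Filter ι} [l.IsCountablyGenerated]
    {v : ι → ℝ≥0} {v₀ : ℝ≥0} (hv₀ : v₀ ≠ 0) (hv : Tendsto v l (𝓝 v₀)) (m : ℝ) :
    Tendsto (fun i => tvDist (gaussianReal m v₀) (gaussianReal m (v i))) l (𝓝 0) := by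
  -- A zero variance gives a law without density; such values are replaced by `v₀`, which changes
  -- nothing eventually.
  set v' : ι → ℝ≥0 := fun i => if v i = 0 then v₀ else v i with hv'
  have hne : ∀ i, v' i ≠ 0 := fun i => by simp only [hv']; split_ifs <;> assumption
  have hev : ∀ᶠ i in l, v' i = v i := by
    filter_upwards [hv.eventually_ne hv₀] with i hi
    simp [hv', hi]
  have hvl : Tendsto v' l (𝓝 v₀) := hv.congr' (hev.mono fun i hi => hi.symm)
  have key : Tendsto (fun i => tvDist (gaussianReal m v₀) (gaussianReal m (v' i))) l (𝓝 0) := by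
    simp_rw [fun i => gaussianReal_of_var_ne_zero m (hne i)]
    rw [gaussianReal_of_var_ne_zero m hv₀]
    have hp : ∀ v : ℝ≥0, v ≠ 0 → IsProbabilityMeasure (volume.withDensity (gaussianPDF m v)) :=
      fun v hv => by rw [← gaussianReal_of_var_ne_zero m hv]; infer_instance
    have := hp v₀ hv₀
    refine tendsto_tvDist_withDensity (fun i => measurable_gaussianPDF _ _)
      (measurable_gaussianPDF _ _) (fun i => hp _ (hne i)) (.of_forall fun x => ?_)
    unfold gaussianPDF
    refine ENNReal.tendsto_ofReal ?_
    have hc : ContinuousAt (fun u : ℝ => (√(2 * Real.pi * u))⁻¹ *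
        Real.exp (-(x - m) ^ 2 / (2 * u))) v₀ := by
      have h0 : (0 : ℝ) < v₀ := by positivity
      have : √(2 * Real.pi * v₀) ≠ 0 := (Real.sqrt_pos.2 (by positivity)).ne'
      fun_prop (disch := first | assumption | positivity)
    exact hc.tendsto.comp (NNReal.tendsto_coe.2 hvl)
  exact key.congr' (hev.mono fun i hi => by rw [hi])

/-- Centring and dividing by `√s` preserves the distance and turns the noise variance `s δ` into the
fixed value `δ`; then the weak limit can be smoothed. -/
lemma tendsto_tvDist_gaussian_conv_compoundPoisson (W : Measure ℝ) [IsProbabilityMeasure W]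
    (hW : MemLp id 2 W) {v : ℝ≥0} (hv : (v : ℝ) = ∫ x, x ^ 2 ∂W) {δ : ℝ≥0} (hδ : δ ≠ 0) :
    Tendsto (fun s : ℝ≥0 => tvDist (gaussianReal (s * ∫ x, x ∂W) (s * (δ + v)))
      (gaussianReal 0 (s * δ) ∗ compoundPoisson s W)) atTop (𝓝 0) := by
  refine tendsto_of_seq_tendsto fun s hs => ?_
  set m := ∫ x, x ∂W with hm
  let Q : ℕ → ProbabilityMeasure ℝ := fun n => ⟨(compoundPoisson (s n) W).map
    fun x => (√(s n : ℝ))⁻¹ * (-(s n * m) + x),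
    Measure.isProbabilityMeasure_map (by fun_prop)⟩
  let Q₀ : ProbabilityMeasure ℝ := ⟨gaussianReal 0 v, inferInstance⟩
  have hQ : Tendsto Q atTop (𝓝 Q₀) :=
    ProbabilityMeasure.tendsto_of_tendsto_charFun (tendsto_charFun_standardized W hW hv hs)
  refine (tendsto_tvDist_gaussian_conv hQ hδ).congr' ?_
  filter_upwards [hs.eventually_gt_atTop 0] with n hn
  have hn' : (0 : ℝ) < s n := hn
  have hc : (√(s n : ℝ))⁻¹ ≠ 0 := (inv_pos.2 (Real.sqrt_pos.2 hn')).ne'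
  simp only [Function.comp_apply]
  rw [← tvDist_map_affine (gaussianReal _ _) _ (-(s n * m)) hc, conv_map_affine,
    gaussianReal_map_const_mul]
  have e1 : (gaussianReal (s n * m) (s n * (δ + v))).map
      (fun x => (√(s n : ℝ))⁻¹ * (-(s n * m) + x)) = gaussianReal 0 δ ∗ gaussianReal 0 v := by
    rw [gaussianReal_map_affine _ _ _ _ (δ + v), gaussianReal_conv_gaussianReal]
    · simp
    · push_cast
      rw [inv_pow, Real.sq_sqrt hn'.le]; field_simp
  have e2 : gaussianReal ((√(s n : ℝ))⁻¹ * 0) (.mk ((√(s n : ℝ))⁻¹ ^ 2) (sq_nonneg _) *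
      (s n * δ)) = gaussianReal 0 δ := by
    rw [mul_zero]
    congr 1
    refine NNReal.coe_injective ?_
    push_cast
    rw [inv_pow, Real.sq_sqrt hn'.le]; field_simp
  rw [e1, e2]
  rfl

/-- The translation bound is averaged over a centred normal `y` of variance `s δ`, whose mean
absolute value is proportional to `√(s δ)`. -/
lemma exists_tvDist_compoundPoisson_gaussian_conv_le (W : Measure ℝ) [IsProbabilityMeasure W]
    (hW : W ≪ volume) :
    ∃ C : ℝ, 0 < C ∧ ∀ s δ : ℝ≥0, 0 < s →
      tvDist (compoundPoisson s W) (gaussianReal 0 (s * δ) ∗ compoundPoisson s W) ≤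
        ENNReal.ofReal (C * (√(δ : ℝ) + (√(s : ℝ))⁻¹)) := by
  obtain ⟨C, hC, h⟩ := exists_tvDist_compoundPoisson_map_le_mul W hW
  set c := ∫ x, |x| ∂(gaussianReal 0 1) with hcdef
  have hc : 0 ≤ c := integral_nonneg fun x => abs_nonneg x
  have hint : Integrable (fun x : ℝ => |x|) (gaussianReal 0 1) :=
    ((memLp_id_gaussianReal 1).integrable le_rfl).abs
  refine ⟨C * (c + 1), by positivity, fun s δ hs => ?_⟩
  have hs' : (0 : ℝ) < s := hs
  have hsp : 0 < √(s : ℝ) := Real.sqrt_pos.2 hs'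
  have hg : gaussianReal 0 (s * δ) =
      (gaussianReal 0 1).map fun x => √((s : ℝ) * δ) * (0 + x) := by
    rw [gaussianReal_map_affine 0 0 _ 1 (s * δ)]
    · simp
    · push_cast
      rw [Real.sq_sqrt (by positivity), mul_one]
  refine (tvDist_conv_self_le _ _).trans ((lintegral_mono fun y => h y s hs).trans ?_)
  rw [hg, lintegral_map (by fun_prop) (by fun_prop)]
  simp only [zero_add, abs_mul, abs_of_nonneg (Real.sqrt_nonneg _)]
  have hi2 : Integrable (fun x : ℝ => C * (√((s : ℝ) * δ) * |x| + 1) / √(s : ℝ))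
      (gaussianReal 0 1) := by fun_prop
  rw [← ofReal_integral_eq_lintegral_ofReal hi2 (.of_forall fun x => by positivity)]
  refine ENNReal.ofReal_le_ofReal ?_
  rw [integral_div, integral_const_mul, integral_add (by fun_prop) (by fun_prop),
    integral_const_mul, ← hcdef]
  simp only [integral_const, probReal_univ, smul_eq_mul, mul_one]
  rw [Real.sqrt_mul hs'.le, div_eq_mul_inv]
  have e : C * (√(s : ℝ) * √(δ : ℝ) * c + 1) * (√(s : ℝ))⁻¹ =
      C * (c * √(δ : ℝ) + (√(s : ℝ))⁻¹) := by field_simp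
  rw [e, mul_assoc C]
  have h1 : 0 ≤ √(δ : ℝ) := Real.sqrt_nonneg _
  have h2 : 0 ≤ (√(s : ℝ))⁻¹ := by positivity
  refine mul_le_mul_of_nonneg_left ?_ hC.le
  nlinarith [mul_nonneg hc h2]

/-- The central limit theorem in total variation for compound Poisson laws with absolutely
continuous jump law. -/
theorem tendsto_tvDist_compoundPoisson_gaussianReal (W : Measure ℝ) [IsProbabilityMeasure W]
    (hWac : W ≪ volume) (hW : MemLp id 2 W) {v : ℝ≥0} (hv : (v : ℝ) = ∫ x, x ^ 2 ∂W)
    (hv0 : v ≠ 0) :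
    Tendsto (fun s : ℝ≥0 => tvDist (compoundPoisson s W)
      (gaussianReal (s * ∫ x, x ∂W) (s * v))) atTop (𝓝 0) := by
  set m := ∫ x, x ∂W with hm
  obtain ⟨C, hC, hsm⟩ := exists_tvDist_compoundPoisson_gaussian_conv_le W hWac
  rw [ENNReal.tendsto_nhds_zero]
  intro ε hε
  -- Four errors occur: removing the noise costs terms in `√δ` and in `1 / √s`, the smoothed limit
  -- theorem one, and replacing the variance factor `δ + v` by `v` one. The parameter `δ` is fixed
  -- before `s` grows.
  have hε4 : 0 < ε / 4 := ENNReal.div_pos hε.ne' (by simp)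
  have hA : ∀ᶠ δ : ℝ≥0 in 𝓝[>] 0, ENNReal.ofReal (C * √(δ : ℝ)) ≤ ε / 4 := by
    have : Tendsto (fun δ : ℝ≥0 => ENNReal.ofReal (C * √(δ : ℝ))) (𝓝[>] 0) (𝓝 0) := by
      have hc : Continuous fun δ : ℝ≥0 => ENNReal.ofReal (C * √(δ : ℝ)) :=
        ENNReal.continuous_ofReal.comp (by fun_prop)
      have := hc.tendsto 0
      simp only [NNReal.coe_zero, Real.sqrt_zero, mul_zero, ENNReal.ofReal_zero] at this
      exact this.mono_left nhdsWithin_le_nhds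
    exact this.eventually_le_const hε4
  have hB : ∀ᶠ δ : ℝ≥0 in 𝓝[>] 0,
      tvDist (gaussianReal 0 v) (gaussianReal 0 (δ + v)) ≤ ε / 4 := by
    have hc : Tendsto (fun δ : ℝ≥0 => δ + v) (𝓝[>] 0) (𝓝 v) := by
      have : Continuous fun δ : ℝ≥0 => δ + v := by fun_prop
      simpa using (this.tendsto 0).mono_left nhdsWithin_le_nhds
    exact (tendsto_tvDist_gaussianReal_var hv0 hc 0).eventually_le_const hε4
  obtain ⟨δ, ⟨hδA, hδB⟩, hδ⟩ := ((hA.and hB).and self_mem_nhdsWithin).exists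
  have hδ0 : δ ≠ 0 := (show 0 < δ from hδ).ne'
  have hD := (tendsto_tvDist_gaussian_conv_compoundPoisson W hW hv hδ0).eventually_le_const hε4
  have hE : ∀ᶠ s : ℝ≥0 in atTop, ENNReal.ofReal (C * (√(s : ℝ))⁻¹) ≤ ε / 4 := by
    have : Tendsto (fun s : ℝ≥0 => ENNReal.ofReal (C * (√(s : ℝ))⁻¹)) atTop (𝓝 0) := by
      have h1 : Tendsto (fun s : ℝ≥0 => (√(s : ℝ))⁻¹) atTop (𝓝 0) :=
        tendsto_inv_atTop_zero.comp (Real.tendsto_sqrt_atTop.comp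
          (NNReal.tendsto_coe_atTop.2 tendsto_id))
      simpa using ENNReal.tendsto_ofReal (h1.const_mul C)
    exact this.eventually_le_const hε4
  filter_upwards [hD, hE, eventually_gt_atTop 0] with s h1 h2 hs
  have hs' : (0 : ℝ) < s := hs
  have h3 : tvDist (compoundPoisson s W) (gaussianReal 0 (s * δ) ∗ compoundPoisson s W) ≤
      ε / 4 + ε / 4 := by
    refine (hsm s δ hs).trans ?_
    rw [mul_add, ENNReal.ofReal_add (by positivity) (by positivity)]
    exact add_le_add hδA h2
  have h4 : tvDist (gaussianReal (s * m) (s * (δ + v))) (gaussianReal (s * m) (s * v)) ≤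
      ε / 4 := by
    rw [tvDist_comm]
    refine le_trans (le_of_eq ?_) hδB
    have hc : (√(s : ℝ))⁻¹ ≠ 0 := (inv_pos.2 (Real.sqrt_pos.2 hs')).ne'
    rw [← tvDist_map_affine (gaussianReal _ _) _ (-(s * m)) hc,
      gaussianReal_map_affine _ _ _ _ v, gaussianReal_map_affine _ _ _ _ (δ + v)]
    · simp
    · push_cast
      rw [inv_pow, Real.sq_sqrt hs'.le]; field_simp
    · push_cast
      rw [inv_pow, Real.sq_sqrt hs'.le]; field_simp
  rw [tvDist_comm] at h1
  calc _ ≤ tvDist (compoundPoisson s W) (gaussianReal 0 (s * δ) ∗ compoundPoisson s W) +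
        tvDist (gaussianReal 0 (s * δ) ∗ compoundPoisson s W) (gaussianReal (s * m) (s * v)) :=
        tvDist_triangle _ _ _
    _ ≤ _ + (_ + _) := by gcongr; exact tvDist_triangle _ (gaussianReal (s * m) (s * (δ + v))) _
    _ ≤ (ε / 4 + ε / 4) + (ε / 4 + ε / 4) := by gcongr
    _ = ε := by
      rw [← mul_two, ← mul_two, mul_assoc]
      rw [show (2 * 2 : ℝ≥0∞) = 4 by norm_num, ENNReal.div_mul_cancel (by simp) (by simp)]

/-! ### The master equation -/

/-- Enlarging the argument to `2 (s + 1)` absorbs the factor `n + 1 ≤ 2 ^ (n + 1)` lost in the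
shift. -/
lemma summable_pow_div_factorial_succ {a : ℕ → ℝ}
    (ha : ∀ s : ℝ, 0 ≤ s → Summable fun n : ℕ => s ^ n / n.factorial * |a n|) {s : ℝ}
    (hs : 0 ≤ s) : Summable fun n : ℕ => s ^ n / n.factorial * |a (n + 1)| := by
  have h := (ha (2 * (s + 1)) (by positivity)).comp_injective (add_left_injective 1)
  refine Summable.of_nonneg_of_le (fun n => by positivity) (fun n => ?_) h
  simp only [Function.comp_apply]
  refine mul_le_mul_of_nonneg_right ?_ (abs_nonneg _)
  rw [Nat.factorial_succ, div_le_div_iff₀ (by positivity) (by positivity)]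
  push_cast
  have h1 : ((n : ℝ) + 1) ≤ 2 ^ (n + 1) := by exact_mod_cast (Nat.lt_two_pow_self (n := n + 1)).le
  have h2 : s ^ n ≤ (s + 1) ^ (n + 1) :=
    (pow_le_pow_left₀ hs (by linarith) n).trans (pow_le_pow_right₀ (by linarith) (by omega))
  rw [mul_pow, ← mul_assoc]
  refine mul_le_mul_of_nonneg_right ?_ (by positivity)
  rw [mul_comm]
  exact mul_le_mul h1 h2 (by positivity) (by positivity)

lemma hasDerivAt_tsum_pow_div_factorial {a : ℕ → ℝ}
    (ha : ∀ s : ℝ, 0 ≤ s → Summable fun n : ℕ => s ^ n / n.factorial * |a n|) (s : ℝ) :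
    HasDerivAt (fun s : ℝ => ∑' n : ℕ, s ^ n / n.factorial * a n)
      (∑' n : ℕ, s ^ n / n.factorial * a (n + 1)) s := by
  have hR : (0 : ℝ) < |s| + 1 := by positivity
  have hfac : ∀ (n : ℕ) (y : ℝ), ((n + 1 : ℕ) : ℝ) * y ^ n / (n + 1).factorial * a (n + 1) =
      y ^ n / n.factorial * a (n + 1) := fun n y => by
    rw [Nat.factorial_succ]; push_cast; field_simp
  have hu : Summable fun n : ℕ => (n : ℝ) * (|s| + 1) ^ (n - 1) / n.factorial * |a n| := by
    rw [← summable_nat_add_iff 1]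
    refine (summable_pow_div_factorial_succ ha hR.le).congr fun n => ?_
    rw [Nat.factorial_succ, Nat.add_sub_cancel]; push_cast
    field_simp
  have h := hasDerivAt_tsum_of_isPreconnected (g := fun n y => y ^ n / n.factorial * a n)
    (g' := fun n y => (n : ℝ) * y ^ (n - 1) / n.factorial * a n) hu
    Metric.isOpen_ball (convex_ball (0 : ℝ) (|s| + 1)).isPreconnected
    (fun n y _ => ((hasDerivAt_pow n y).div_const _).mul_const _) (fun n y hy => ?_)
    (Metric.mem_ball_self hR) ?_ (y := s) (by simp)
  · refine h.congr_deriv ?_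
    have hsum : Summable fun n : ℕ => (n : ℝ) * s ^ (n - 1) / n.factorial * a n := by
      refine Summable.of_norm_bounded hu fun n => ?_
      rw [norm_mul, norm_div, norm_mul, norm_pow]
      simp only [Real.norm_eq_abs, Nat.abs_cast]
      gcongr
      linarith
    rw [hsum.tsum_eq_zero_add]
    simp only [Nat.cast_zero, zero_mul, zero_div, zero_add, Nat.add_sub_cancel, hfac]
  · rw [norm_mul, norm_div, norm_mul, norm_pow]
    simp only [Real.norm_eq_abs, Nat.abs_cast]
    have : |y| ≤ |s| + 1 := by simpa using (Metric.mem_ball.1 hy).le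
    gcongr
  · exact summable_of_ne_finset_zero (s := {0}) fun n hn => by
      simp [zero_pow (Finset.notMem_singleton.1 hn)]

/-- The abstract form of the master equation, used with coefficients `W^{*n}(B)` and with the
densities of `W^{*n}` at a point. -/
lemma hasDerivAt_exp_neg_mul_tsum {a : ℕ → ℝ}
    (ha : ∀ s : ℝ, 0 ≤ s → Summable fun n : ℕ => s ^ n / n.factorial * |a n|) (ν t : ℝ) :
    HasDerivAt (fun t : ℝ => Real.exp (-(ν * t)) * ∑' n : ℕ, (ν * t) ^ n / n.factorial * a n)
      (ν * (Real.exp (-(ν * t)) * ∑' n : ℕ, (ν * t) ^ n / n.factorial * a (n + 1)) -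
        ν * (Real.exp (-(ν * t)) * ∑' n : ℕ, (ν * t) ^ n / n.factorial * a n)) t := by
  have hl : HasDerivAt (fun t : ℝ => ν * t) ν t := by simpa using (hasDerivAt_id t).const_mul ν
  have h1 := (hasDerivAt_tsum_pow_div_factorial ha (ν * t)).comp t hl
  have h2 := hl.fun_neg.exp
  refine (h2.mul h1).congr_deriv ?_
  simp only [Function.comp_apply]
  ring

lemma conv_poissonMix (W : Measure ℝ) (s : ℝ≥0) (κ : ℕ → Measure ℝ)
    [∀ n, IsProbabilityMeasure (κ n)] :
    W ∗ poissonMix s κ = poissonMix s fun n => W ∗ κ n := by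
  ext B hB
  rw [conv_apply' _ _ hB, poissonMix_apply _ _ hB]
  simp_rw [map_add_poissonMix, fun x : ℝ => poissonMix_apply s (fun n => (κ n).map (x + ·)) hB]
  rw [lintegral_tsum fun n => ((measurable_map_add_apply (κ n) hB).const_mul _).aemeasurable]
  refine tsum_congr fun n => ?_
  rw [lintegral_const_mul _ (measurable_map_add_apply (κ n) hB), conv_apply' _ _ hB]

/-- The law on `(0, ∞)` with density `w`. -/
def jumpLaw (w : ℝ → ℝ≥0) : Measure ℝ :=
  (volume.restrict (Ioi 0)).withDensity fun r => (w r : ℝ≥0∞)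

lemma isProbabilityMeasure_jumpLaw {w : ℝ → ℝ≥0} (hw1 : ∫⁻ r in Ioi (0 : ℝ), w r = 1) :
    IsProbabilityMeasure (jumpLaw w) :=
  ⟨by rw [jumpLaw, withDensity_apply _ MeasurableSet.univ, Measure.restrict_univ, hw1]⟩

lemma jumpLaw_absolutelyContinuous (w : ℝ → ℝ≥0) : jumpLaw w ≪ volume :=
  (withDensity_absolutelyContinuous _ _).trans Measure.restrict_le_self.absolutelyContinuous

lemma integral_jumpLaw {w : ℝ → ℝ≥0} (hw : Measurable w) (g : ℝ → ℝ) :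
    ∫ r, g r ∂(jumpLaw w) = ∫ r in Ioi (0 : ℝ), w r * g r := by
  rw [jumpLaw, integral_withDensity_eq_integral_smul hw]
  rfl

lemma measurableSet_add_mem {B : Set ℝ} (hB : MeasurableSet B) (r : ℝ) :
    MeasurableSet {κ : ℝ | κ + r ∈ B} :=
  (measurable_add_const r) hB

lemma map_add_real_eq (p : Measure ℝ) {B : Set ℝ} (hB : MeasurableSet B) (r : ℝ) :
    (p.map (r + ·)).real B = p.real {κ | κ + r ∈ B} := by
  rw [map_measureReal_apply (measurable_const_add r) hB]
  congr 1
  ext κ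
  rw [mem_preimage, add_comm]
  rfl

/-- Since `w` has total mass one, the gain term is a convolution and the loss term a multiple of
`p`. -/
lemma integral_masterEquation {w : ℝ → ℝ≥0} (hw : Measurable w)
    (hw1 : ∫⁻ r in Ioi (0 : ℝ), w r = 1) (ν : ℝ) (p : Measure ℝ) [IsFiniteMeasure p] {B : Set ℝ}
    (hB : MeasurableSet B) :
    ∫ r in Ioi (0 : ℝ), ν * w r * (p.real {κ | κ + r ∈ B} - p.real B) =
      ν * (jumpLaw w ∗ p).real B - ν * p.real B := by
  have := isProbabilityMeasure_jumpLaw hw1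
  have h1 : ∀ r, ν * w r * (p.real {κ | κ + r ∈ B} - p.real B) =
      ν * (w r * ((p.map (r + ·)).real B - p.real B)) := fun r => by
    rw [map_add_real_eq p hB, mul_assoc]
  simp_rw [h1]
  rw [integral_const_mul, ← integral_jumpLaw hw fun r => (p.map (r + ·)).real B - p.real B,
    integral_sub (integrable_map_add_real _ p hB) (integrable_const _), ← conv_real _ _ hB]
  simp [mul_sub]

lemma compoundPoisson_real_eq {ν t : ℝ} (hν : 0 ≤ ν) (ht : 0 ≤ t) (κ : ℕ → Measure ℝ)
    [∀ n, IsProbabilityMeasure (κ n)] {B : Set ℝ} (hB : MeasurableSet B) :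
    (poissonMix (ν * t).toNNReal κ).real B =
      Real.exp (-(ν * t)) * ∑' n : ℕ, (ν * t) ^ n / n.factorial * (κ n).real B := by
  rw [← (hasSum_poissonMix_real _ κ hB).tsum_eq, Real.coe_toNNReal _ (mul_nonneg hν ht),
    ← tsum_mul_left]
  refine tsum_congr fun n => ?_
  ring

lemma summable_pow_div_factorial_measureReal (κ : ℕ → Measure ℝ)
    [∀ n, IsProbabilityMeasure (κ n)] (B : Set ℝ) (s : ℝ) (hs : 0 ≤ s) :
    Summable fun n : ℕ => s ^ n / n.factorial * |(κ n).real B| := by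
  refine Summable.of_nonneg_of_le (fun n => by positivity) (fun n => ?_)
    (Real.summable_pow_div_factorial s)
  refine mul_le_of_le_one_right (by positivity) ?_
  rw [abs_of_nonneg measureReal_nonneg]
  exact measureReal_le_one

/-- Compound Poisson laws solve the master equation. -/
theorem masterEquation_compoundPoisson {w : ℝ → ℝ≥0} (hw : Measurable w)
    (hw1 : ∫⁻ r in Ioi (0 : ℝ), w r = 1) {ν : ℝ} (hν : 0 ≤ ν) :
    MasterEquation ν w fun t => compoundPoisson (ν * t).toNNReal (jumpLaw w) := by
  intro B hB t ht
  have := isProbabilityMeasure_jumpLaw hw1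
  rw [integral_masterEquation hw hw1 ν _ hB]
  have hd := hasDerivAt_exp_neg_mul_tsum
    (summable_pow_div_factorial_measureReal (convPow (jumpLaw w)) B) ν t
  -- Convolution with the jump law raises every convolution power by one, matching the index shift
  -- in the derivative.
  have hc : (jumpLaw w ∗ compoundPoisson (ν * t).toNNReal (jumpLaw w)).real B =
      Real.exp (-(ν * t)) * ∑' n : ℕ, (ν * t) ^ n / n.factorial *
        (convPow (jumpLaw w) (n + 1)).real B := by
    rw [compoundPoisson, conv_poissonMix, compoundPoisson_real_eq hν ht _ hB]
    rfl
  have hc0 : (compoundPoisson (ν * t).toNNReal (jumpLaw w)).real B = _ :=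
    compoundPoisson_real_eq hν ht (convPow (jumpLaw w)) hB
  rw [hc, hc0]
  refine hd.hasDerivWithinAt.congr (fun s hs => ?_) ?_
  · exact compoundPoisson_real_eq hν hs (convPow (jumpLaw w)) hB
  · exact hc0

/-- The whole line is invariant under shifts, so the right-hand side vanishes and mass is conserved.
This makes the masses of merely finite solutions uniformly bounded. -/
lemma MasterEquation.measureReal_univ {w : ℝ → ℝ≥0} {ν : ℝ} {p : ℝ → Measure ℝ}
    (h : MasterEquation ν w p) {t : ℝ} (ht : 0 ≤ t) : (p t).real univ = (p 0).real univ := by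
  have hd : ∀ s, 0 ≤ s → HasDerivWithinAt (fun s => (p s).real univ) 0 (Ici 0) s := fun s hs => by
    simpa using h univ MeasurableSet.univ s hs
  refine constant_of_has_deriv_right_zero (a := 0) (b := t) (f := fun s => (p s).real univ)
    (fun s hs => (hd s hs.1).continuousWithinAt.mono Icc_subset_Ici_self)
    (fun s hs => (hd s hs.1).mono (Ici_subset_Ici.2 hs.1)) t ⟨ht, le_rfl⟩

/-- Solutions of the master equation are determined by their initial value. -/
theorem MasterEquation.unique {w : ℝ → ℝ≥0} (hw : Measurable w)
    (hw1 : ∫⁻ r in Ioi (0 : ℝ), w r = 1) {ν : ℝ} (hν : 0 ≤ ν) {p q : ℝ → Measure ℝ}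
    (hpf : ∀ t, 0 ≤ t → IsFiniteMeasure (p t)) (hqf : ∀ t, 0 ≤ t → IsFiniteMeasure (q t))
    (hp0 : p 0 = Measure.dirac 0) (hq0 : q 0 = Measure.dirac 0)
    (hp : MasterEquation ν w p) (hq : MasterEquation ν w q) {t : ℝ} (ht : 0 ≤ t) :
    p t = q t := by
  have hW := isProbabilityMeasure_jumpLaw hw1
  have hmass : ∀ {p : ℝ → Measure ℝ}, (∀ t, 0 ≤ t → IsFiniteMeasure (p t)) →
      p 0 = Measure.dirac 0 → MasterEquation ν w p → ∀ t, 0 ≤ t → ∀ B, (p t).real B ≤ 1 :=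
    fun {p} hpf h0 h t ht B => by
      have := hpf t ht
      refine (measureReal_mono (subset_univ B)).trans ?_
      rw [h.measureReal_univ ht, h0]
      simp
  -- Picard iteration: gain and loss each contribute `ν`, and every integration in time improves the
  -- bound by a factor `2νt / (n + 1)`. The bound must be uniform in `B`, as the gain term involves
  -- all shifts of `B`.
  have hbound : ∀ n : ℕ, ∀ B, MeasurableSet B → ∀ t, 0 ≤ t →
      ‖(p t).real B - (q t).real B‖ ≤ (2 * ν * t) ^ n / n.factorial := by
    intro n
    induction n with
    | zero =>
      intro B hB t ht
      have h1 := hmass hpf hp0 hp t ht B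
      have h2 := hmass hqf hq0 hq t ht B
      have h3 : 0 ≤ (p t).real B := measureReal_nonneg
      have h4 : 0 ≤ (q t).real B := measureReal_nonneg
      simp only [pow_zero, Nat.factorial_zero, Nat.cast_one, div_one]
      rw [Real.norm_eq_abs, abs_le]
      constructor <;> linarith
    | succ n ih =>
      intro B hB t ht
      have hd : ∀ s, 0 ≤ s → HasDerivWithinAt (fun s => (p s).real B - (q s).real B)
          (ν * ((jumpLaw w ∗ p s).real B - (jumpLaw w ∗ q s).real B) -
            ν * ((p s).real B - (q s).real B)) (Ici 0) s := fun s hs => by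
        have := hpf s hs
        have := hqf s hs
        refine ((hp B hB s hs).sub (hq B hB s hs)).congr_deriv ?_
        rw [integral_masterEquation hw hw1 ν _ hB, integral_masterEquation hw hw1 ν _ hB]
        ring
      refine image_norm_le_of_norm_deriv_right_le_deriv_boundary (a := 0) (b := t)
        (f := fun s => (p s).real B - (q s).real B)
        (B := fun s => (2 * ν * s) ^ (n + 1) / (n + 1).factorial)
        (B' := fun s => 2 * ν * ((2 * ν * s) ^ n / n.factorial))
        (fun s hs => (hd s hs.1).continuousWithinAt.mono Icc_subset_Ici_self)
        (fun s hs => (hd s hs.1).mono (Ici_subset_Ici.2 hs.1)) (by simp [hp0, hq0])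
        (fun s => ?_) (fun s hs => ?_) ⟨ht, le_rfl⟩
      · have hl : HasDerivAt (fun s : ℝ => 2 * ν * s) (2 * ν) s := by
          simpa using (hasDerivAt_id s).const_mul (2 * ν)
        refine ((hl.pow (n + 1)).div_const ((n + 1).factorial : ℝ)).congr_deriv ?_
        rw [Nat.factorial_succ, Nat.add_sub_cancel]
        push_cast
        field_simp
      · have := hpf s hs.1
        have := hqf s hs.1
        set c := (2 * ν * s) ^ n / n.factorial
        have h1 : ‖(jumpLaw w ∗ p s).real B - (jumpLaw w ∗ q s).real B‖ ≤ c := by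
          rw [conv_real _ _ hB, conv_real _ _ hB, ← integral_sub
            (integrable_map_add_real _ _ hB) (integrable_map_add_real _ _ hB)]
          have := norm_integral_le_of_norm_le_const (μ := jumpLaw w) (C := c)
            (f := fun r => ((p s).map (r + ·)).real B - ((q s).map (r + ·)).real B)
            (.of_forall fun r => by
              rw [map_add_real_eq _ hB, map_add_real_eq _ hB]
              exact ih _ (measurableSet_add_mem hB r) s hs.1)
          simpa using this
        have h2 := ih B hB s hs.1
        calc _ ≤ ‖ν * ((jumpLaw w ∗ p s).real B - (jumpLaw w ∗ q s).real B)‖ +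
              ‖ν * ((p s).real B - (q s).real B)‖ := norm_sub_le _ _
          _ ≤ ν * c + ν * c := by
            rw [norm_mul, norm_mul, Real.norm_of_nonneg hν]
            gcongr
          _ = 2 * ν * c := by ring
  have := hpf t ht
  have := hqf t ht
  ext B hB
  have h0 : ‖(p t).real B - (q t).real B‖ ≤ 0 :=
    ge_of_tendsto' (FloorSemiring.tendsto_pow_div_factorial_atTop (2 * ν * t))
      fun n => hbound n B hB t ht
  have h1 : (p t).real B = (q t).real B := sub_eq_zero.1 (norm_le_zero_iff.1 h0)
  exact (measureReal_eq_measureReal_iff).1 h1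

/-! ### Densities of the convolution powers and of the compound Poisson law -/

/-- `jumpDensity w n` is the density of the convolution power of order `n + 1`. -/
def jumpDensity (w : ℝ → ℝ≥0) : ℕ → ℝ → ℝ≥0∞
  | 0 => (Ioi 0).indicator fun r => (w r : ℝ≥0∞)
  | n + 1 => fun κ => ∫⁻ r, (Ioi (0 : ℝ)).indicator (fun r => (w r : ℝ≥0∞)) r *
      jumpDensity w n (κ - r)

section JumpDensity

variable {w : ℝ → ℝ≥0}

lemma measurable_jumpDensity (hw : Measurable w) (n : ℕ) : Measurable (jumpDensity w n) := by
  have h0 : Measurable ((Ioi (0 : ℝ)).indicator fun r => (w r : ℝ≥0∞)) :=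
    (by fun_prop : Measurable fun r => (w r : ℝ≥0∞)).indicator measurableSet_Ioi
  induction n with
  | zero => exact h0
  | succ n ih =>
    exact Measurable.lintegral_prod_right (f := fun κ r =>
      (Ioi (0 : ℝ)).indicator (fun r => (w r : ℝ≥0∞)) r * jumpDensity w n (κ - r)) (by fun_prop)

lemma jumpDensity_of_nonpos (n : ℕ) {κ : ℝ} (hκ : κ ≤ 0) : jumpDensity w n κ = 0 := by
  induction n generalizing κ with
  | zero => simp [jumpDensity, hκ]
  | succ n ih =>
    rw [jumpDensity]
    refine (lintegral_congr fun r => ?_).trans lintegral_zero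
    rcases le_or_gt r 0 with hr | hr
    · simp [hr]
    · rw [ih (by linarith), mul_zero]

lemma jumpLaw_eq_withDensity (w : ℝ → ℝ≥0) :
    jumpLaw w = volume.withDensity (jumpDensity w 0) := by
  rw [jumpLaw, jumpDensity, withDensity_indicator measurableSet_Ioi]

lemma convPow_jumpLaw_succ (hw : Measurable w) (hw1 : ∫⁻ r in Ioi (0 : ℝ), w r = 1) (n : ℕ) :
    convPow (jumpLaw w) (n + 1) = volume.withDensity (jumpDensity w n) := by
  have := isProbabilityMeasure_jumpLaw hw1
  induction n with
  | zero =>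
    rw [convPow, convPow, Measure.conv_dirac_zero, jumpLaw_eq_withDensity]
  | succ n ih =>
    rw [convPow, ih, Measure.conv_comm, withDensity_conv (measurable_jumpDensity hw n)]
    congr 1
    ext κ
    have hm := measurable_jumpDensity hw n
    rw [jumpLaw_eq_withDensity, lintegral_withDensity_eq_lintegral_mul _
      (measurable_jumpDensity hw 0) (by fun_prop)]
    rfl

lemma lintegral_jumpDensity (hw : Measurable w) (hw1 : ∫⁻ r in Ioi (0 : ℝ), w r = 1) (n : ℕ) :
    ∫⁻ κ, jumpDensity w n κ = 1 := by
  have := isProbabilityMeasure_jumpLaw hw1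
  rw [← setLIntegral_univ, ← withDensity_apply _ MeasurableSet.univ,
    ← convPow_jumpLaw_succ hw hw1, measure_univ]

/-- Finiteness at `κ` of all the exponential series of the densities. -/
def DensityFinite (w : ℝ → ℝ≥0) (κ : ℝ) : Prop :=
  ∀ T : ℕ, ∑' n : ℕ, ENNReal.ofReal ((T : ℝ) ^ (n + 1) / (n + 1).factorial) *
    jumpDensity w n κ < ⊤

/-- Each density integrates to one, so each series integrates to part of an exponential series.
Integer `T` suffices by monotonicity, which leaves one null set for all times. -/
lemma ae_densityFinite (hw : Measurable w) (hw1 : ∫⁻ r in Ioi (0 : ℝ), w r = 1) :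
    ∀ᵐ κ, DensityFinite w κ := by
  unfold DensityFinite
  rw [ae_all_iff]
  intro T
  have hm : ∀ n, Measurable (jumpDensity w n) := measurable_jumpDensity hw
  refine ae_lt_top (by fun_prop) ?_
  rw [lintegral_tsum fun n => by fun_prop]
  have hint : ∀ n : ℕ, ∫⁻ κ, ENNReal.ofReal ((T : ℝ) ^ (n + 1) / (n + 1).factorial) *
      jumpDensity w n κ = ENNReal.ofReal ((T : ℝ) ^ (n + 1) / (n + 1).factorial) := fun n => by
    rw [lintegral_const_mul _ (hm n), lintegral_jumpDensity hw hw1, mul_one]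
  simp_rw [hint]
  rw [← ENNReal.ofReal_tsum_of_nonneg (fun n => by positivity)]
  · exact ENNReal.ofReal_ne_top
  · exact (summable_nat_add_iff 1).2 (Real.summable_pow_div_factorial (T : ℝ))

/-- Density next to the atom at `0` of the compound Poisson law, with values in `[0, ∞]`. -/
def poissonDensity (ν : ℝ) (w : ℝ → ℝ≥0) (κ t : ℝ) : ℝ≥0∞ :=
  ∑' n : ℕ, ENNReal.ofReal (Real.exp (-(ν * t)) * (ν * t) ^ (n + 1) / (n + 1).factorial) *
    jumpDensity w n κ

lemma measurable_poissonDensity (hw : Measurable w) (ν : ℝ) :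
    Measurable (Function.uncurry (poissonDensity ν w)) := by
  have hm : ∀ n, Measurable (jumpDensity w n) := measurable_jumpDensity hw
  unfold poissonDensity Function.uncurry
  fun_prop

lemma measurable_poissonDensity_sub (hw : Measurable w) (ν κ t : ℝ) :
    Measurable fun r => poissonDensity ν w (κ - r) t := by
  have hm : ∀ n, Measurable (jumpDensity w n) := measurable_jumpDensity hw
  unfold poissonDensity
  fun_prop

lemma compoundPoisson_eq_add_withDensity (hw : Measurable w)
    (hw1 : ∫⁻ r in Ioi (0 : ℝ), w r = 1) {ν t : ℝ} (hν : 0 ≤ ν) (ht : 0 ≤ t) :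
    compoundPoisson (ν * t).toNNReal (jumpLaw w) =
      ENNReal.ofReal (Real.exp (-(ν * t))) • Measure.dirac 0 +
        volume.withDensity fun κ => poissonDensity ν w κ t := by
  have hm : ∀ n, Measurable (jumpDensity w n) := measurable_jumpDensity hw
  have hνt := mul_nonneg hν ht
  ext B hB
  rw [compoundPoisson, poissonMix_apply _ _ hB, tsum_eq_zero_add' ENNReal.summable]
  simp only [poissonMeasure_singleton, Real.coe_toNNReal _ hνt, Measure.add_apply,
    Measure.smul_apply, smul_eq_mul]
  congr 1
  · simp [convPow]
  · rw [withDensity_apply _ hB]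
    unfold poissonDensity
    rw [lintegral_tsum fun n => by fun_prop]
    refine tsum_congr fun n => ?_
    rw [lintegral_const_mul _ (hm n), convPow_jumpLaw_succ hw hw1, withDensity_apply _ hB]

/-- Coefficients of the series of the density at `κ`. -/
def densityCoeff (w : ℝ → ℝ≥0) (κ : ℝ) : ℕ → ℝ
  | 0 => 0
  | n + 1 => (jumpDensity w n κ).toReal

lemma densityCoeff_nonneg (w : ℝ → ℝ≥0) (κ : ℝ) (n : ℕ) : 0 ≤ densityCoeff w κ n := by
  cases n with
  | zero => exact le_rfl
  | succ n => exact ENNReal.toReal_nonneg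

lemma DensityFinite.jumpDensity_ne_top {κ : ℝ} (h : DensityFinite w κ) (n : ℕ) :
    jumpDensity w n κ ≠ ⊤ := by
  intro htop
  have h1 := ENNReal.ne_top_of_tsum_ne_top (h 1).ne n
  rw [htop] at h1
  refine h1 (ENNReal.mul_top ?_)
  rw [Ne, ENNReal.ofReal_eq_zero, not_le]
  positivity

lemma DensityFinite.summable {κ : ℝ} (h : DensityFinite w κ) (s : ℝ) (hs : 0 ≤ s) :
    Summable fun n : ℕ => s ^ n / n.factorial * |densityCoeff w κ n| := by
  obtain ⟨T, hT⟩ := exists_nat_ge s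
  rw [← summable_nat_add_iff 1]
  have h1 := ENNReal.summable_toReal (h T).ne
  refine Summable.of_nonneg_of_le (fun n => by positivity) (fun n => ?_) h1
  rw [ENNReal.toReal_mul, ENNReal.toReal_ofReal (by positivity),
    abs_of_nonneg (densityCoeff_nonneg _ _ _)]
  refine mul_le_mul_of_nonneg_right ?_ ENNReal.toReal_nonneg
  gcongr

lemma DensityFinite.poissonDensity_eq {κ : ℝ} (h : DensityFinite w κ) {ν t : ℝ} (hν : 0 ≤ ν)
    (ht : 0 ≤ t) :
    poissonDensity ν w κ t = ENNReal.ofReal (Real.exp (-(ν * t)) *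
      ∑' n : ℕ, (ν * t) ^ n / n.factorial * densityCoeff w κ n) := by
  have hνt := mul_nonneg hν ht
  have hs := h.summable _ hνt
  simp only [abs_of_nonneg (densityCoeff_nonneg _ _ _)] at hs
  have e : Real.exp (-(ν * t)) * ∑' n : ℕ, (ν * t) ^ n / n.factorial * densityCoeff w κ n =
      ∑' n : ℕ, Real.exp (-(ν * t)) * ((ν * t) ^ (n + 1) / (n + 1).factorial *
        densityCoeff w κ (n + 1)) := by
    rw [hs.tsum_eq_zero_add, tsum_mul_left]
    simp [densityCoeff]
  rw [e, poissonDensity, ENNReal.ofReal_tsum_of_nonneg]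
  · refine tsum_congr fun n => ?_
    rw [← mul_assoc, ENNReal.ofReal_mul (by positivity), densityCoeff,
      ENNReal.ofReal_toReal (h.jumpDensity_ne_top n), mul_div_assoc]
  · exact fun n => mul_nonneg (Real.exp_pos _).le
      (mul_nonneg (by positivity) (densityCoeff_nonneg _ _ _))
  · exact ((summable_nat_add_iff 1).2 hs).mul_left _

lemma poissonDensity_of_nonpos (ν : ℝ) {κ : ℝ} (hκ : κ ≤ 0) (t : ℝ) :
    poissonDensity ν w κ t = 0 := by
  simp [poissonDensity, jumpDensity_of_nonpos _ hκ]

lemma lintegral_mul_poissonDensity (hw : Measurable w) (ν : ℝ) (κ t : ℝ) :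
    ∫⁻ r, (Ioi (0 : ℝ)).indicator (fun r => (w r : ℝ≥0∞)) r * poissonDensity ν w (κ - r) t =
      ∑' n : ℕ, ENNReal.ofReal (Real.exp (-(ν * t)) * (ν * t) ^ (n + 1) / (n + 1).factorial) *
        jumpDensity w (n + 1) κ := by
  have hm : ∀ n, Measurable (jumpDensity w n) := measurable_jumpDensity hw
  have h0 : Measurable ((Ioi (0 : ℝ)).indicator fun r => (w r : ℝ≥0∞)) := hm 0
  unfold poissonDensity
  simp_rw [← ENNReal.tsum_mul_left]
  rw [lintegral_tsum fun n => by fun_prop]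
  refine tsum_congr fun n => ?_
  simp_rw [mul_left_comm _ (ENNReal.ofReal _)]
  rw [lintegral_const_mul _ (by fun_prop)]
  rfl

/-- The density part lacks the atom, whose convolution with the jump law is `w` with mass `e^{-νt}`;
the first term of the shifted series is therefore subtracted. -/
lemma DensityFinite.lintegral_mul_poissonDensity_eq (hw : Measurable w) {κ : ℝ} (hκ : 0 < κ)
    (h : DensityFinite w κ) {ν t : ℝ} (hν : 0 ≤ ν) (ht : 0 ≤ t) :
    ∫⁻ r, (Ioi (0 : ℝ)).indicator (fun r => (w r : ℝ≥0∞)) r * poissonDensity ν w (κ - r) t =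
      ENNReal.ofReal (Real.exp (-(ν * t)) *
        (∑' n : ℕ, (ν * t) ^ n / n.factorial * densityCoeff w κ (n + 1)) -
          w κ * Real.exp (-(ν * t))) := by
  have hνt := mul_nonneg hν ht
  have hs := summable_pow_div_factorial_succ h.summable hνt
  simp only [abs_of_nonneg (densityCoeff_nonneg _ _ _)] at hs
  have h1 : densityCoeff w κ 1 = w κ := by simp [densityCoeff, jumpDensity, hκ]
  have e : Real.exp (-(ν * t)) *
        (∑' n : ℕ, (ν * t) ^ n / n.factorial * densityCoeff w κ (n + 1)) -
          w κ * Real.exp (-(ν * t)) =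
      ∑' n : ℕ, Real.exp (-(ν * t)) * ((ν * t) ^ (n + 1) / (n + 1).factorial *
        densityCoeff w κ (n + 2)) := by
    rw [hs.tsum_eq_zero_add, tsum_mul_left]
    simp only [pow_zero, Nat.factorial_zero, Nat.cast_one, div_one, one_mul, zero_add, h1]
    ring
  rw [lintegral_mul_poissonDensity hw, e, ENNReal.ofReal_tsum_of_nonneg]
  · refine tsum_congr fun n => ?_
    rw [← mul_assoc, ENNReal.ofReal_mul (by positivity), densityCoeff,
      ENNReal.ofReal_toReal (h.jumpDensity_ne_top (n + 1)), mul_div_assoc]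
  · exact fun n => mul_nonneg (Real.exp_pos _).le
      (mul_nonneg (by positivity) (densityCoeff_nonneg _ _ _))
  · exact ((summable_nat_add_iff 1).2 hs).mul_left _

/-- Jump densities vanish off `(0, ∞)`, which confines `r` to `(0, κ]` up to a null set, and `κ - r`
is a point of finiteness for almost every `r`, so that `toReal` loses nothing. -/
lemma lintegral_Ioc_mul_toReal (hw : Measurable w) (hw1 : ∫⁻ r in Ioi (0 : ℝ), w r = 1)
    {ν t : ℝ} (hν : 0 ≤ ν) (ht : 0 ≤ t) (κ : ℝ) :
    ∫⁻ r in Ioc 0 κ, ENNReal.ofReal (w r * (poissonDensity ν w (κ - r) t).toReal) =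
      ∫⁻ r, (Ioi (0 : ℝ)).indicator (fun r => (w r : ℝ≥0∞)) r *
        poissonDensity ν w (κ - r) t := by
  rw [← lintegral_indicator measurableSet_Ioc]
  have hae : ∀ᵐ r : ℝ, DensityFinite w (κ - r) :=
    (Measure.measurePreserving_sub_left volume κ).quasiMeasurePreserving.ae (ae_densityFinite hw hw1)
  refine lintegral_congr_ae ?_
  filter_upwards [hae] with r hr
  rcases le_or_gt r 0 with h0 | h0
  · simp [not_lt.2 h0]
  rcases le_or_gt r κ with h1 | h1
  · have hfin : poissonDensity ν w (κ - r) t ≠ ⊤ := by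
      rw [hr.poissonDensity_eq hν ht]; exact ENNReal.ofReal_ne_top
    rw [indicator_of_mem (show r ∈ Ioc 0 κ from ⟨h0, h1⟩), indicator_of_mem (show r ∈ Ioi 0 from h0),
      ENNReal.ofReal_mul NNReal.zero_le_coe, ENNReal.ofReal_toReal hfin, ENNReal.ofReal_coe_nnreal]
  · rw [indicator_of_notMem (fun h : r ∈ Ioc 0 κ => absurd h.2 (not_le.2 h1)),
      poissonDensity_of_nonpos ν (by linarith) t, mul_zero]

lemma DensityFinite.hasDerivWithinAt (hw : Measurable w) (hw1 : ∫⁻ r in Ioi (0 : ℝ), w r = 1)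
    {κ : ℝ} (hκ : DensityFinite w κ) (hκ0' : 0 < κ) {ν t : ℝ} (hν : 0 ≤ ν) (ht : 0 ≤ t) :
    IntervalIntegrable (fun r => (w r : ℝ) * (poissonDensity ν w (κ - r) t).toReal) volume 0 κ ∧
      HasDerivWithinAt (fun s => (poissonDensity ν w κ s).toReal)
        (ν * ((∫ r in (0 : ℝ)..κ, w r * (poissonDensity ν w (κ - r) t).toReal) +
          w κ * Real.exp (-(ν * t))) - ν * (poissonDensity ν w κ t).toReal) (Ici 0) t := by
  have hνt := mul_nonneg hν ht
  have hval : ∀ s, 0 ≤ s → (poissonDensity ν w κ s).toReal = Real.exp (-(ν * s)) *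
      ∑' n : ℕ, (ν * s) ^ n / n.factorial * densityCoeff w κ n := fun s hs => by
    rw [hκ.poissonDensity_eq hν hs, ENNReal.toReal_ofReal]
    have := mul_nonneg hν hs
    exact mul_nonneg (Real.exp_pos _).le (tsum_nonneg fun n =>
      mul_nonneg (by positivity) (densityCoeff_nonneg _ _ _))
  have hL := (lintegral_Ioc_mul_toReal hw hw1 hν ht κ).trans
    (hκ.lintegral_mul_poissonDensity_eq hw hκ0' hν ht)
  have hm1 : Measurable fun r => (w r : ℝ) * (poissonDensity ν w (κ - r) t).toReal := by
    have := measurable_poissonDensity_sub hw ν κ t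
    fun_prop
  have hnn : 0 ≤ᵐ[volume.restrict (Ioc 0 κ)]
      fun r => (w r : ℝ) * (poissonDensity ν w (κ - r) t).toReal :=
    .of_forall fun r => mul_nonneg NNReal.zero_le_coe ENNReal.toReal_nonneg
  have hint : IntegrableOn (fun r => (w r : ℝ) * (poissonDensity ν w (κ - r) t).toReal)
      (Ioc 0 κ) := by
    refine ⟨hm1.aestronglyMeasurable, ?_⟩
    rw [hasFiniteIntegral_iff_ofReal hnn, hL]
    exact ENNReal.ofReal_lt_top
  refine ⟨(intervalIntegrable_iff_integrableOn_Ioc_of_le hκ0'.le).2 hint, ?_⟩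
  have hI : ∫ r in (0 : ℝ)..κ, (w r : ℝ) * (poissonDensity ν w (κ - r) t).toReal =
      Real.exp (-(ν * t)) *
        (∑' n : ℕ, (ν * t) ^ n / n.factorial * densityCoeff w κ (n + 1)) -
          w κ * Real.exp (-(ν * t)) := by
    rw [intervalIntegral.integral_of_le hκ0'.le, integral_eq_lintegral_of_nonneg_ae
      hnn hm1.aestronglyMeasurable, hL, ENNReal.toReal_ofReal]
    have hs := summable_pow_div_factorial_succ hκ.summable hνt
    simp only [abs_of_nonneg (densityCoeff_nonneg _ _ _)] at hs
    have h1 : densityCoeff w κ 1 = w κ := by simp [densityCoeff, jumpDensity, hκ0']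
    rw [hs.tsum_eq_zero_add]
    simp only [pow_zero, Nat.factorial_zero, Nat.cast_one, div_one, one_mul, zero_add, h1]
    have : 0 ≤ Real.exp (-(ν * t)) * ∑' n : ℕ, (ν * t) ^ (n + 1) / (n + 1).factorial *
        densityCoeff w κ (n + 1 + 1) :=
      mul_nonneg (Real.exp_pos _).le (tsum_nonneg fun n =>
        mul_nonneg (by positivity) (densityCoeff_nonneg _ _ _))
    linarith
  -- The contribution of the atom completes the integral to the full shifted series.
  rw [hI, sub_add_cancel, hval t ht]
  exact (hasDerivAt_exp_neg_mul_tsum hκ.summable ν t).hasDerivWithinAt.congr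
    (fun s hs => hval s hs) (hval t ht)

/-- The density of the compound Poisson law next to its atom solves the master equation
pointwise. -/
theorem exists_density_compoundPoisson (hw : Measurable w)
    (hw1 : ∫⁻ r in Ioi (0 : ℝ), w r = 1) {ν : ℝ} (hν : 0 ≤ ν) :
    ∃ q : ℝ → ℝ → ℝ, Measurable (Function.uncurry q) ∧ (∀ κ t, 0 ≤ q κ t) ∧
      (∀ t, 0 ≤ t → compoundPoisson (ν * t).toNNReal (jumpLaw w) =
        ENNReal.ofReal (Real.exp (-(ν * t))) • Measure.dirac 0 +
          (volume.restrict (Ioi 0)).withDensity (fun κ => ENNReal.ofReal (q κ t))) ∧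
      ∀ᵐ κ ∂(volume.restrict (Ioi (0 : ℝ))), ∀ t, 0 ≤ t →
        IntervalIntegrable (fun r => w r * q (κ - r) t) volume 0 κ ∧
        HasDerivWithinAt (fun s => q κ s)
          (ν * ((∫ r in (0 : ℝ)..κ, w r * q (κ - r) t) + w κ * Real.exp (-(ν * t))) -
            ν * q κ t) (Ici 0) t := by
  have hmeas := measurable_poissonDensity hw ν
  -- For `t ≥ 0` infinite values, which `toReal` sends to `0`, occur only for `κ` in a fixed null
  -- set.
  refine ⟨fun κ t => (poissonDensity ν w κ t).toReal, hmeas.ennreal_toReal,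
    fun κ t => ENNReal.toReal_nonneg, fun t ht => ?_, ?_⟩
  · rw [compoundPoisson_eq_add_withDensity hw hw1 hν ht]
    congr 1
    rw [← withDensity_indicator measurableSet_Ioi]
    refine withDensity_congr_ae ?_
    filter_upwards [ae_densityFinite hw hw1] with κ hκ
    rcases le_or_gt κ 0 with h0 | h0
    · rw [poissonDensity_of_nonpos ν h0, indicator_of_notMem (by simpa using h0)]
    · rw [indicator_of_mem (show κ ∈ Ioi 0 from h0), ENNReal.ofReal_toReal]
      rw [hκ.poissonDensity_eq hν ht]; exact ENNReal.ofReal_ne_top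
  · filter_upwards [ae_restrict_mem measurableSet_Ioi, ae_restrict_of_ae (ae_densityFinite hw hw1)]
      with κ hκ0 hκ t ht
    exact hκ.hasDerivWithinAt hw hw1 hκ0 hν ht

end JumpDensity

/-! ### Truncated normal laws -/

lemma tendsto_erf_atTop : Tendsto erf atTop (𝓝 1) := by
  have hi : IntegrableOn (fun s : ℝ => Real.exp (-s ^ 2)) (Ioi 0) := by
    simpa using (integrable_exp_neg_mul_sq one_pos).integrableOn (s := Ioi (0 : ℝ))
  have h1 := intervalIntegral_tendsto_integral_Ioi 0 hi tendsto_id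
  have h2 : ∫ s in Ioi (0 : ℝ), Real.exp (-s ^ 2) = √Real.pi / 2 := by
    simpa using integral_gaussian_Ioi 1
  rw [h2] at h1
  have h3 := h1.const_mul (2 / √Real.pi)
  have hpi : √Real.pi ≠ 0 := (Real.sqrt_pos.2 Real.pi_pos).ne'
  have h4 : 2 / √Real.pi * (√Real.pi / 2) = 1 := by field_simp
  rw [h4] at h3
  exact h3

lemma tendsto_mul_div_sqrt_atTop {a b : ℝ} (ha : 0 < a) (hb : 0 < b) :
    Tendsto (fun t : ℝ => a * t / √(b * t)) atTop atTop := by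
  have h1 : Tendsto (fun t : ℝ => a / √b * √t) atTop atTop :=
    Real.tendsto_sqrt_atTop.const_mul_atTop (by positivity)
  refine h1.congr' ?_
  filter_upwards [eventually_gt_atTop 0] with t ht
  rw [Real.sqrt_mul hb.le]
  have hb' : 0 < √b := Real.sqrt_pos.2 hb
  have ht' : 0 < √t := Real.sqrt_pos.2 ht
  field_simp
  rw [Real.sq_sqrt ht.le]

lemma tendsto_truncFactor {a b : ℝ} (ha : 0 < a) (hb : 0 < b) :
    Tendsto (fun t : ℝ => truncFactor (a * t) (b * t)) atTop (𝓝 1) := by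
  have h1 : Tendsto (fun t : ℝ => erf (a * t / √(2 * (b * t)))) atTop (𝓝 1) := by
    refine tendsto_erf_atTop.comp ?_
    simpa only [mul_assoc] using tendsto_mul_div_sqrt_atTop ha (by positivity : 0 < 2 * b)
  have h2 : Tendsto (fun t : ℝ => 2 / (1 + erf (a * t / √(2 * (b * t))))) atTop
      (𝓝 (2 / (1 + 1))) := tendsto_const_nhds.div (h1.const_add 1) (by norm_num)
  have h3 : (2 / (1 + 1) : ℝ) = 1 := by norm_num
  rw [h3] at h2
  exact h2

/-- After standardisation this is the normal distribution function at `-a t / √(b t)`, which tends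
to `-∞`. -/
lemma tendsto_gaussianReal_Iic_zero {a b : ℝ} (ha : 0 < a) (hb : 0 < b) :
    Tendsto (fun t : ℝ => (gaussianReal (a * t) (b * t).toNNReal).real (Iic 0)) atTop (𝓝 0) := by
  have h1 := (tendsto_cdf_atBot (gaussianReal 0 1)).comp
    (tendsto_neg_atTop_atBot.comp (tendsto_mul_div_sqrt_atTop ha hb))
  refine h1.congr' ?_
  filter_upwards [eventually_gt_atTop 0] with t ht
  have hbt : 0 < b * t := by positivity
  have hs : 0 < √(b * t) := Real.sqrt_pos.2 hbt
  have hg : gaussianReal (a * t) (b * t).toNNReal =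
      (gaussianReal 0 1).map fun x => √(b * t) * (a * t / √(b * t) + x) := by
    rw [gaussianReal_map_affine 0 _ _ 1 (b * t).toNNReal]
    · congr 1
      field_simp
      ring
    · rw [Real.coe_toNNReal _ hbt.le, Real.sq_sqrt hbt.le]; simp
  rw [hg, map_measureReal_apply (by fun_prop) measurableSet_Iic]
  simp only [Function.comp_apply, cdf_eq_real]
  congr 1
  ext x
  rw [mem_preimage, mem_Iic, mem_Iic]
  constructor
  · intro h
    exact mul_nonpos_of_nonneg_of_nonpos hs.le (by linarith)
  · intro h
    by_contra hc
    have := mul_pos hs (by linarith : 0 < a * t / √(b * t) + x)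
    linarith

lemma truncNormal_real {m v : ℝ} (hv : 0 < v) (hf : 0 ≤ truncFactor m v) {B : Set ℝ}
    (hB : MeasurableSet B) :
    (truncNormal m v).real B =
      truncFactor m v * (gaussianReal m v.toNNReal).real (B ∩ Ici 0) := by
  have hv' : v.toNNReal ≠ 0 := by simpa using hv
  rw [measureReal_def, truncNormal, withDensity_apply _ hB, Measure.restrict_restrict hB,
    measureReal_def, gaussianReal_apply _ hv']
  simp_rw [fun κ : ℝ => ENNReal.ofReal_mul (q := 1 / √(2 * Real.pi * v) *
    Real.exp (-(κ - m) ^ 2 / (2 * v))) hf]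
  rw [lintegral_const_mul _ (by fun_prop), ENNReal.toReal_mul, ENNReal.toReal_ofReal hf]
  congr 2
  refine lintegral_congr fun κ => ?_
  rw [gaussianPDF, gaussianPDFReal, Real.coe_toNNReal _ hv.le, one_div]

/-- The two laws differ by the mass cut off and by the prefactor. That the prefactor normalises
exactly plays no role; it only has to be near one. -/
lemma tvDist_gaussianReal_truncNormal_le {m v : ℝ} (hv : 0 < v) (hf : 0 ≤ truncFactor m v) :
    tvDist (gaussianReal m v.toNNReal) (truncNormal m v) ≤
      ENNReal.ofReal ((gaussianReal m v.toNNReal).real (Iic 0) + |truncFactor m v - 1|) := by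
  refine tvDist_le fun B hB => ENNReal.ofReal_le_ofReal ?_
  rw [truncNormal_real hv hf hB]
  set γ := gaussianReal m v.toNNReal
  have h1 : γ.real B = γ.real (B ∩ Ici 0) + γ.real (B \ Ici 0) :=
    (measureReal_inter_add_sdiff measurableSet_Ici).symm
  have h2 : γ.real (B \ Ici 0) ≤ γ.real (Iic 0) :=
    measureReal_mono fun x hx => mem_Iic.2 (le_of_not_ge fun h => hx.2 (mem_Ici.2 h))
  have h3 : γ.real (B ∩ Ici 0) ≤ 1 := measureReal_le_one
  have h4 : 0 ≤ γ.real (B ∩ Ici 0) := measureReal_nonneg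
  have h5 : 0 ≤ γ.real (B \ Ici 0) := measureReal_nonneg
  have h6 : γ.real B - truncFactor m v * γ.real (B ∩ Ici 0) =
      γ.real (B \ Ici 0) - (truncFactor m v - 1) * γ.real (B ∩ Ici 0) := by rw [h1]; ring
  rw [h6]
  refine (abs_sub _ _).trans ?_
  rw [abs_of_nonneg h5, abs_mul, abs_of_nonneg h4]
  exact add_le_add h2 (mul_le_of_le_one_right (abs_nonneg _) h3)

lemma tendsto_tvDist_gaussianReal_truncNormal {a b : ℝ} (ha : 0 < a) (hb : 0 < b) :
    Tendsto (fun t : ℝ => tvDist (gaussianReal (a * t) (b * t).toNNReal)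
      (truncNormal (a * t) (b * t))) atTop (𝓝 0) := by
  have hf := tendsto_truncFactor ha hb
  have h1 : Tendsto (fun t : ℝ => ENNReal.ofReal
      ((gaussianReal (a * t) (b * t).toNNReal).real (Iic 0) +
        |truncFactor (a * t) (b * t) - 1|)) atTop (𝓝 0) := by
    have := (tendsto_gaussianReal_Iic_zero ha hb).add (hf.sub_const 1).abs
    simpa using ENNReal.tendsto_ofReal this
  refine tendsto_of_tendsto_of_tendsto_of_le_of_le' tendsto_const_nhds h1
    (.of_forall fun _ => zero_le) ?_
  filter_upwards [eventually_gt_atTop 0, hf.eventually_const_le (zero_lt_one)] with t ht hft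
  exact tvDist_gaussianReal_truncNormal_le (by positivity) hft

/-! ### Mixtures of narrow normal laws -/

lemma tvDist_le_add_univ (μ ν : Measure ℝ) [IsFiniteMeasure μ] [IsFiniteMeasure ν] :
    tvDist μ ν ≤ μ univ + ν univ := by
  refine tvDist_le fun B _ => ?_
  rw [← ofReal_measureReal (μ := μ), ← ofReal_measureReal (μ := ν),
    ← ENNReal.ofReal_add measureReal_nonneg measureReal_nonneg]
  refine ENNReal.ofReal_le_ofReal ((abs_sub _ _).trans ?_)
  rw [abs_of_nonneg measureReal_nonneg, abs_of_nonneg measureReal_nonneg]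
  exact add_le_add (measureReal_mono (subset_univ _)) (measureReal_mono (subset_univ _))

lemma tvDist_le_sum {ι : Type*} (s : Finset ι) {μ ν : Measure ℝ} {κ η : ι → Measure ℝ}
    (hμ : ∀ B, MeasurableSet B → μ.real B = ∑ i ∈ s, (κ i).real B)
    (hν : ∀ B, MeasurableSet B → ν.real B = ∑ i ∈ s, (η i).real B) :
    tvDist μ ν ≤ ∑ i ∈ s, tvDist (κ i) (η i) := by
  refine tvDist_le fun B hB => ?_
  rw [hμ B hB, hν B hB, ← Finset.sum_sub_distrib]
  refine (ENNReal.ofReal_le_ofReal (Finset.abs_sum_le_sum_abs _ _)).trans ?_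
  rw [ENNReal.ofReal_sum_of_nonneg fun i _ => abs_nonneg _]
  exact Finset.sum_le_sum fun i _ => ofReal_abs_sub_le_tvDist _ _ hB

/-- An absolutely continuous measure is asymptotically unchanged by Gaussian noise of smaller
order than the scale of the measure. -/
lemma tendsto_tvDist_map_mul_conv_gaussian {ν : Measure ℝ} [IsFiniteMeasure ν] (hν : ν ≪ volume)
    (c : ℝ≥0) :
    Tendsto (fun t : ℝ => tvDist (ν.map (t * ·))
      (gaussianReal 0 (t.toNNReal * c) ∗ ν.map (t * ·))) atTop (𝓝 0) := by
  -- Undoing the scaling by `t` turns noise `√t z` into a translation by `z / √t`, which is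
  -- asymptotically harmless.
  have hz : ∀ z : ℝ, Tendsto (fun t : ℝ => tvDist ν (ν.map ((√t)⁻¹ * z + ·))) atTop (𝓝 0) := by
    intro z
    refine (tendsto_tvDist_map_add hν).comp ?_
    simpa using (tendsto_inv_atTop_zero.comp Real.tendsto_sqrt_atTop).mul_const z
  have hfin : ∀ y : ℝ, IsFiniteMeasure (ν.map (y + ·)) := fun y => inferInstance
  have hlim := tendsto_lintegral_zero_of_le (m := gaussianReal 0 c) (l := atTop)
    (E := fun (t : ℝ) z => tvDist ν (ν.map ((√t)⁻¹ * z + ·))) (C := ν univ + ν univ)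
    (by finiteness) (fun t z => by
      refine (tvDist_le_add_univ _ _).trans ?_
      rw [Measure.map_apply (by fun_prop) MeasurableSet.univ, preimage_univ])
    (.of_forall hz)
  refine tendsto_of_tendsto_of_tendsto_of_le_of_le' tendsto_const_nhds hlim
    (.of_forall fun _ => zero_le) ?_
  filter_upwards [eventually_gt_atTop 0] with t ht
  have hg : gaussianReal 0 (t.toNNReal * c) = (gaussianReal 0 c).map fun x => √t * (0 + x) := by
    rw [gaussianReal_map_affine 0 0 _ c (t.toNNReal * c)]
    · simp
    · push_cast
      rw [Real.coe_toNNReal _ ht.le, Real.sq_sqrt ht.le]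
  have hst : 0 < √t := Real.sqrt_pos.2 ht
  refine (tvDist_conv_self_le _ _).trans ?_
  have hle : ∀ y, tvDist (ν.map (t * ·)) ((ν.map (t * ·)).map (y + ·)) ≤
      tvDist ν (ν.map (t⁻¹ * y + ·)) := fun y => by
    refine le_trans (le_of_eq ?_) (tvDist_map_le ν _ (measurable_const_mul t))
    congr 1
    rw [Measure.map_map (by fun_prop) (by fun_prop), Measure.map_map (by fun_prop) (by fun_prop)]
    congr 1
    ext x
    simp only [Function.comp_apply]
    field_simp
  refine (lintegral_mono hle).trans ?_
  -- The change of variables goes through an embedding because the integrand is not known to be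
  -- measurable.
  have hemb : MeasurableEmbedding fun x : ℝ => √t * (0 + x) := by
    simpa using (Homeomorph.mulLeft₀ (√t) hst.ne').measurableEmbedding
  rw [hg, hemb.lintegral_map]
  refine le_of_eq (lintegral_congr fun z => ?_)
  have : t⁻¹ * (√t * (0 + z)) = (√t)⁻¹ * z := by
    rw [zero_add, ← mul_assoc]
    congr 1
    field_simp
    rw [Real.sq_sqrt ht.le]
  rw [this]

section Mixture

variable {X : Type*} [MeasurableSpace X] {μ : Measure X}

lemma bind_real {f : X → Measure ℝ} (hf : Measurable f) [∀ x, IsProbabilityMeasure (f x)]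
    {B : Set ℝ} (hB : MeasurableSet B) : (μ.bind f).real B = ∫ x, (f x).real B ∂μ := by
  rw [measureReal_def, Measure.bind_apply hB hf.aemeasurable]
  symm
  exact integral_toReal ((Measure.measurable_coe hB).comp hf).aemeasurable
    (.of_forall fun x => measure_lt_top _ _)

lemma measure_eq_sum_restrict_preimage {β : Type*} (u : SimpleFunc X β) {A : Set X}
    (hA : MeasurableSet A) : μ A = ∑ c ∈ u.range, μ.restrict (u ⁻¹' {c}) A := by
  have h := measure_biUnion_finset (μ := μ) (s := u.range) (f := fun c => A ∩ u ⁻¹' {c})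
    (fun c _ d _ hcd => by
      rw [Function.onFun, Set.disjoint_left]
      rintro x ⟨_, h1⟩ ⟨_, h2⟩
      exact hcd (h1.symm.trans h2))
    (fun c _ => hA.inter (u.measurableSet_preimage _))
  have hU : ⋃ c ∈ u.range, A ∩ u ⁻¹' {c} = A := by
    ext x
    simp
  rw [hU] at h
  rw [h]
  exact Finset.sum_congr rfl fun c _ => (Measure.restrict_apply hA).symm

variable [IsFiniteMeasure μ]

lemma integrable_measureReal {f : X → Measure ℝ} (hf : Measurable f)
    [∀ x, IsProbabilityMeasure (f x)] {B : Set ℝ} (hB : MeasurableSet B) :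
    Integrable (fun x => (f x).real B) μ :=
  Integrable.of_bound (C := 1) ((Measure.measurable_coe hB).comp hf).ennreal_toReal.aestronglyMeasurable
    (.of_forall fun x => by
      rw [Real.norm_of_nonneg measureReal_nonneg]; exact measureReal_le_one)

lemma tvDist_bind_le {f g : X → Measure ℝ} (hf : Measurable f) (hg : Measurable g)
    [∀ x, IsProbabilityMeasure (f x)] [∀ x, IsProbabilityMeasure (g x)] :
    tvDist (μ.bind f) (μ.bind g) ≤ ∫⁻ x, tvDist (f x) (g x) ∂μ :=
  tvDist_le_lintegral (fun _ hB => integrable_measureReal hf hB)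
    (fun _ hB => integrable_measureReal hg hB) (fun _ hB => bind_real hf hB)
    (fun _ hB => bind_real hg hB)

lemma measurable_gaussianReal_comp {m : X → ℝ} {v : X → ℝ≥0} (hm : Measurable m)
    (hv : Measurable v) : Measurable fun x => gaussianReal (m x) (v x) :=
  measurable_gaussianReal.comp (hm.prodMk hv)

/-- On a level set of `u` the variance is constant, so the mixture is a convolution with one fixed
Gaussian. -/
lemma restrict_bind_gaussian_apply {G : X → ℝ} (hG : Measurable G) (u : SimpleFunc X ℝ≥0)
    (t : ℝ) (c : ℝ≥0) {B : Set ℝ} (hB : MeasurableSet B) :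
    ∫⁻ x, gaussianReal (t * G x) (t.toNNReal * u x) B ∂(μ.restrict (u ⁻¹' {c})) =
      (gaussianReal 0 (t.toNNReal * c) ∗
        ((μ.restrict (u ⁻¹' {c})).map G).map (t * ·)) B := by
  have hm : Measurable fun a : ℝ =>
      ((gaussianReal 0 (t.toNNReal * c)).map fun x => t * a + x) B :=
    (measurable_map_add_apply _ hB).comp (measurable_const_mul t)
  rw [Measure.conv_comm, conv_apply' _ _ hB,
    lintegral_map (measurable_map_add_apply _ hB) (by fun_prop), lintegral_map hm hG]
  refine setLIntegral_congr_fun (u.measurableSet_preimage _) fun x hx => ?_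
  have hx' : u x = c := hx
  rw [gaussianReal_map_const_add, zero_add, hx']

lemma tendsto_tvDist_bind_gaussian_simpleFunc {G : X → ℝ} (hG : Measurable G)
    (hac : μ.map G ≪ volume) (u : SimpleFunc X ℝ≥0) :
    Tendsto (fun t : ℝ => tvDist (μ.map fun x => t * G x)
      (μ.bind fun x => gaussianReal (t * G x) (t.toNNReal * u x))) atTop (𝓝 0) := by
  have hc : ∀ c : ℝ≥0, (μ.restrict (u ⁻¹' {c})).map G ≪ volume := fun c =>
    (Measure.map_mono Measure.restrict_le_self hG).absolutelyContinuous.trans hac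
  have hsum : Tendsto (fun t : ℝ => ∑ c ∈ u.range,
      tvDist (((μ.restrict (u ⁻¹' {c})).map G).map (t * ·))
        (gaussianReal 0 (t.toNNReal * c) ∗ ((μ.restrict (u ⁻¹' {c})).map G).map (t * ·)))
      atTop (𝓝 0) := by
    have := tendsto_finsetSum u.range fun c _ => tendsto_tvDist_map_mul_conv_gaussian (hc c) c
    simpa using this
  refine tendsto_of_tendsto_of_tendsto_of_le_of_le tendsto_const_nhds hsum (fun _ => zero_le)
    (fun t => tvDist_le_sum _ (fun B hB => ?_) (fun B hB => ?_))
  · have hm : Measurable fun x => t * G x := by fun_prop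
    rw [map_measureReal_apply hm hB, measureReal_def, measure_eq_sum_restrict_preimage u (hm hB),
      ENNReal.toReal_sum fun c _ => by finiteness]
    refine Finset.sum_congr rfl fun c _ => ?_
    rw [Measure.map_map (by fun_prop) hG, map_measureReal_apply (by fun_prop) hB]
    rfl
  · have hm : Measurable fun x => gaussianReal (t * G x) (t.toNNReal * u x) :=
      measurable_gaussianReal_comp (by fun_prop) (u.measurable.const_mul _)
    have hμ : μ = ∑ c ∈ u.range, μ.restrict (u ⁻¹' {c}) := by
      ext A hA
      rw [measure_eq_sum_restrict_preimage u hA, Measure.finsetSum_apply]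
    rw [measureReal_def, Measure.bind_apply hB hm.aemeasurable]
    conv_lhs => rw [hμ]
    rw [lintegral_finsetSum_measure]
    simp_rw [restrict_bind_gaussian_apply hG u t _ hB]
    rw [ENNReal.toReal_sum fun c _ => by finiteness]
    rfl

/-- Mixtures of laws that are asymptotically normal with mean `t * G x` and variance of order `t`
are asymptotically equal to the law of `t * G`, if the latter is absolutely continuous. -/
theorem tendsto_tvDist_bind_map {κ : ℝ → X → Measure ℝ} (hκ : ∀ t, Measurable (κ t))
    [∀ t x, IsProbabilityMeasure (κ t x)] {G : X → ℝ} (hG : Measurable G) {v : X → ℝ≥0}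
    (hv : Measurable v) (hac : μ.map G ≪ volume) (hv0 : ∀ᵐ x ∂μ, v x ≠ 0)
    (hlim : ∀ᵐ x ∂μ, Tendsto (fun t : ℝ => tvDist (κ t x)
      (gaussianReal (t * G x) (t.toNNReal * v x))) atTop (𝓝 0)) :
    Tendsto (fun t : ℝ => tvDist (μ.bind (κ t)) (μ.map fun x => t * G x)) atTop (𝓝 0) := by
  rw [ENNReal.tendsto_nhds_zero]
  intro ε hε
  have hε3 : 0 < ε / 3 := ENNReal.div_pos hε.ne' (by simp)
  -- Mean and variance both depend on `x`, so the mixture is not a convolution. Approximating the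
  -- variance by simple functions reduces it to finitely many convolutions.
  let u : ℕ → SimpleFunc X ℝ≥0 := hv.stronglyMeasurable.approx
  have hu : ∀ x, Tendsto (fun n => u n x) atTop (𝓝 (v x)) := hv.stronglyMeasurable.tendsto_approx
  have hA := tendsto_lintegral_zero_of_le (m := μ) ENNReal.one_ne_top
    (fun (t : ℝ) x => tvDist_le_one (κ t x) (gaussianReal (t * G x) (t.toNNReal * v x))) hlim
  have hB := tendsto_lintegral_zero_of_le (m := μ) (l := atTop) ENNReal.one_ne_top
    (fun (n : ℕ) x => tvDist_le_one (gaussianReal 0 (v x)) (gaussianReal 0 (u n x)))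
    (hv0.mono fun x hx => tendsto_tvDist_gaussianReal_var hx (hu x) 0)
  obtain ⟨n, hn⟩ := (hB.eventually_le_const hε3).exists
  have hC := (tendsto_tvDist_bind_gaussian_simpleFunc hG hac (u n)).eventually_le_const hε3
  filter_upwards [hA.eventually_le_const hε3, hC, eventually_gt_atTop 0] with t h1 h3 ht
  have hm1 : Measurable fun x => gaussianReal (t * G x) (t.toNNReal * v x) :=
    measurable_gaussianReal_comp (by fun_prop) (hv.const_mul _)
  have hm2 : Measurable fun x => gaussianReal (t * G x) (t.toNNReal * u n x) :=
    measurable_gaussianReal_comp (by fun_prop) ((u n).measurable.const_mul _)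
  have hscale : ∀ (x : X) (c : ℝ≥0), gaussianReal (t * G x) (t.toNNReal * c) =
      (gaussianReal 0 c).map fun y => √t * (√t * G x + y) := fun x c => by
    rw [gaussianReal_map_affine 0 _ _ c (t.toNNReal * c)]
    · congr 1
      rw [zero_add, ← mul_assoc, Real.mul_self_sqrt ht.le]
    · push_cast
      rw [Real.coe_toNNReal _ ht.le, Real.sq_sqrt ht.le]
  -- By affine scaling, the error from replacing `v` by `u n` is bounded by one at unit scale,
  -- independent of `t`; hence `n` can be chosen before `t`.
  have h2 : tvDist (μ.bind fun x => gaussianReal (t * G x) (t.toNNReal * v x))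
      (μ.bind fun x => gaussianReal (t * G x) (t.toNNReal * u n x)) ≤ ε / 3 := by
    refine (tvDist_bind_le hm1 hm2).trans (le_trans (lintegral_mono fun x => ?_) hn)
    simp only [hscale]
    exact tvDist_map_le _ _ (by fun_prop)
  rw [tvDist_comm] at h3
  calc _ ≤ _ + _ := tvDist_triangle _ (μ.bind fun x => gaussianReal (t * G x) (t.toNNReal * v x)) _
    _ ≤ _ + (_ + _) := by
      gcongr
      exact tvDist_triangle _ (μ.bind fun x => gaussianReal (t * G x) (t.toNNReal * u n x)) _
    _ ≤ ε / 3 + (ε / 3 + ε / 3) := by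
      gcongr
      exact (tvDist_bind_le (hκ t) hm1).trans h1
    _ = ε := by rw [← add_assoc, ENNReal.add_thirds]

end Mixture

/-! ### The area formula on the line -/

/-- A function on `ℝ` with nonvanishing derivative on `s` is injective on countably many
measurable pieces of `s`. -/
lemma exists_partition_injOn {s : Set ℝ} {g g' : ℝ → ℝ}
    (hg : ∀ x ∈ s, HasDerivWithinAt g (g' x) s x) (hg' : ∀ x ∈ s, g' x ≠ 0) :
    ∃ t : ℕ → Set ℝ, Pairwise (Function.onFun Disjoint t) ∧ (∀ n, MeasurableSet (t n)) ∧
      (s ⊆ ⋃ n, t n) ∧ ∀ n, InjOn g (s ∩ t n) := by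
  classical
  -- Approximation by a linear map with error at most half its slope forces injectivity. The value
  -- `1` at slope zero only keeps `r` nonzero.
  let r : (ℝ →L[ℝ] ℝ) → ℝ≥0 := fun A => if A 1 = 0 then 1 else ‖A 1‖₊ / 2
  have hr : ∀ A, r A ≠ 0 := fun A => by
    by_cases h : A 1 = 0 <;> simp [r, h]
  obtain ⟨t, A, hdisj, hmeas, hsub, happ, hA⟩ :=
    exists_partition_approximatesLinearOn_of_hasFDerivWithinAt g s
      (fun x => ContinuousLinearMap.toSpanSingleton ℝ (g' x))
      (fun x hx => (hg x hx).hasFDerivWithinAt) r hr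
  refine ⟨t, hdisj, hmeas, hsub, fun n x hx y hy hxy => ?_⟩
  obtain ⟨z, hz, hAz⟩ := hA ⟨x, hx.1⟩ n
  have hne : A n 1 ≠ 0 := by
    rw [hAz]
    simpa using hg' z hz
  have h := happ n x hx y hy
  have hlin : A n (x - y) = (x - y) * A n 1 := by
    conv_lhs => rw [← mul_one (x - y), ← smul_eq_mul, map_smul, smul_eq_mul]
  rw [hxy, sub_self, zero_sub, norm_neg, hlin, norm_mul] at h
  simp only [r, if_neg hne, NNReal.coe_div, coe_nnnorm, NNReal.coe_ofNat] at h
  have h1 : 0 < ‖A n 1‖ := norm_pos_iff.mpr hne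
  have h2 : ‖x - y‖ = 0 := by
    nlinarith [norm_nonneg (x - y)]
  exact sub_eq_zero.mp (norm_eq_zero.mp h2)

/-- The sum over the fiber of an injective function, as a function on the target. -/
lemma tsum_fiber_of_injOn {S : Set ℝ} {g : ℝ → ℝ} (hinj : InjOn g S) (h : ℝ → ℝ≥0∞) (κ : ℝ) :
    ∑' x : {x // x ∈ S ∧ g x = κ}, h x =
      Function.extend (fun x : S => g x) (fun x : S => h x) 0 κ := by
  have hi : Function.Injective fun x : S => g x := fun x y hxy =>
    Subtype.ext (hinj x.2 y.2 hxy)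
  by_cases hκ : ∃ x : S, g x = κ
  · obtain ⟨x, rfl⟩ := hκ
    rw [hi.extend_apply (fun x : S => h x) 0 x,
      tsum_eq_single (⟨x, x.2, rfl⟩ : {y // y ∈ S ∧ g y = g x})]
    rintro ⟨y, hy, hyx⟩ hne
    exact absurd (Subtype.ext (hinj hy x.2 hyx)) hne
  · rw [Function.extend_apply' _ _ _ hκ]
    have : IsEmpty {x // x ∈ S ∧ g x = κ} := ⟨fun x => hκ ⟨⟨x, x.2.1⟩, x.2.2⟩⟩
    simp

/-- An injective measurable map on a Borel set is a measurable embedding, so functions on the set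
can be transported measurably to its image. -/
lemma measurable_extend_injOn {S : Set ℝ} (hS : MeasurableSet S) {g : ℝ → ℝ}
    (hg : Measurable fun x : S => g x) (hinj : InjOn g S) {h : ℝ → ℝ≥0∞}
    (hh : Measurable fun x : S => h x) :
    Measurable (Function.extend (fun x : S => g x) (fun x : S => h x) 0) := by
  have := hS.standardBorel
  have he : MeasurableEmbedding (fun x : S => g x) :=
    Measurable.measurableEmbedding hg fun x y hxy => Subtype.ext (hinj x.2 y.2 hxy)
  exact he.measurable_extend hh measurable_zero

lemma measurableSet_inter_preimage {S B : Set ℝ} (hS : MeasurableSet S) {g : ℝ → ℝ}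
    (hg : Measurable fun x : S => g x) (hB : MeasurableSet B) : MeasurableSet (S ∩ g ⁻¹' B) := by
  have := hS.subtype_image (hg hB)
  convert this using 1
  ext x
  simp [and_comm]

/-- On an injective piece, change of variables produces the Jacobian `|g'|`, which the weight
cancels. -/
lemma lintegral_extend_injOn {S B : Set ℝ} (hS : MeasurableSet S) (hB : MeasurableSet B)
    {g g' : ℝ → ℝ} (hgm : Measurable fun x : S => g x)
    (hg : ∀ x ∈ S, HasDerivWithinAt g (g' x) S x) (hg' : ∀ x ∈ S, g' x ≠ 0)
    (hinj : InjOn g S) (f : ℝ → ℝ≥0∞) :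
    ∫⁻ κ in B, Function.extend (fun x : S => g x)
      (fun x : S => ENNReal.ofReal |g' x|⁻¹ * f x) 0 κ = ∫⁻ x in S ∩ g ⁻¹' B, f x := by
  set F := Function.extend (fun x : S => g x) (fun x : S => ENNReal.ofReal |g' x|⁻¹ * f x) 0
  have hi : Function.Injective fun x : S => g x := fun x y hxy =>
    Subtype.ext (hinj x.2 y.2 hxy)
  have hSB : MeasurableSet (S ∩ g ⁻¹' B) := measurableSet_inter_preimage hS hgm hB
  have hgc : ContinuousOn g S := fun x hx => (hg x hx).continuousWithinAt
  have himg : MeasurableSet (g '' (S ∩ g ⁻¹' B)) :=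
    hSB.image_of_continuousOn_injOn (hgc.mono inter_subset_left) (hinj.mono inter_subset_left)
  have hsupp : ∫⁻ κ in B, F κ = ∫⁻ κ in g '' (S ∩ g ⁻¹' B), F κ := by
    rw [← lintegral_indicator hB, ← lintegral_indicator himg]
    congr 1
    ext κ
    by_cases hκ : ∃ x : S, g x = κ
    · obtain ⟨x, rfl⟩ := hκ
      by_cases hx : g x ∈ B
      · rw [indicator_of_mem hx, indicator_of_mem]
        exact ⟨x, ⟨x.2, hx⟩, rfl⟩
      · rw [indicator_of_notMem hx, indicator_of_notMem]
        rintro ⟨y, hy, hyx⟩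
        exact hx (hyx ▸ hy.2)
    · have : F κ = 0 := Function.extend_apply' _ _ _ hκ
      simp [indicator, this]
  rw [hsupp, lintegral_image_eq_lintegral_abs_deriv_mul hSB
    (fun x hx => (hg x hx.1).mono inter_subset_left) (hinj.mono inter_subset_left)]
  refine setLIntegral_congr_fun hSB fun x hx => ?_
  have hF : F (g x) = ENNReal.ofReal |g' x|⁻¹ * f x :=
    hi.extend_apply (fun x : S => ENNReal.ofReal |g' x|⁻¹ * f x) 0 ⟨x, hx.1⟩
  have hpos : 0 < |g' x| := abs_pos.mpr (hg' x hx.1)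
  rw [hF, ← mul_assoc, ← ENNReal.ofReal_mul hpos.le, mul_inv_cancel₀ hpos.ne',
    ENNReal.ofReal_one, one_mul]

lemma tsum_fiber_eq_tsum_partition {s : Set ℝ} {t : ℕ → Set ℝ} {g : ℝ → ℝ}
    (hdisj : Pairwise (Function.onFun Disjoint t)) (hsub : s ⊆ ⋃ n, t n) (h : ℝ → ℝ≥0∞) (κ : ℝ) :
    ∑' x : {x // x ∈ s ∧ g x = κ}, h x =
      ∑' n, ∑' x : {x // x ∈ s ∩ t n ∧ g x = κ}, h x := by
  have hU : {x | x ∈ s ∧ g x = κ} = ⋃ n, {x | x ∈ s ∩ t n ∧ g x = κ} := by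
    ext x
    constructor
    · rintro ⟨hx, hxκ⟩
      obtain ⟨n, hn⟩ := mem_iUnion.mp (hsub hx)
      exact mem_iUnion.mpr ⟨n, ⟨hx, hn⟩, hxκ⟩
    · intro hx
      obtain ⟨n, hn⟩ := mem_iUnion.mp hx
      exact ⟨hn.1.1, hn.2⟩
  have hd : Pairwise (Function.onFun Disjoint fun n => {x | x ∈ s ∩ t n ∧ g x = κ}) := by
    intro i j hij
    refine (hdisj hij).mono ?_ ?_
    · exact fun x hx => hx.1.2
    · exact fun x hx => hx.1.2
  have := ENNReal.tsum_biUnion (f := h) (hd.set_pairwise univ)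
  rw [← hU] at this
  exact this

/-- The area formula on the line, for functions with nonvanishing derivative. -/
theorem lintegral_tsum_fiber {s B : Set ℝ} (hs : MeasurableSet s) (hB : MeasurableSet B)
    {g g' : ℝ → ℝ} (hg : ∀ x ∈ s, HasDerivWithinAt g (g' x) s x)
    (hg' : ∀ x ∈ s, g' x ≠ 0) (hg'm : ContinuousOn g' s) {f : ℝ → ℝ≥0∞} (hf : Measurable f) :
    ∫⁻ κ in B, ∑' x : {x // x ∈ s ∧ g x = κ}, ENNReal.ofReal |g' x|⁻¹ * f x =
      ∫⁻ x in s ∩ g ⁻¹' B, f x := by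
  obtain ⟨t, hdisj, hmeas, hsub, hinj⟩ := exists_partition_injOn hg hg'
  have hgc : ContinuousOn g s := fun x hx => (hg x hx).continuousWithinAt
  have hm : ∀ n, MeasurableSet (s ∩ t n) := fun n => hs.inter (hmeas n)
  have hgm : ∀ n, Measurable fun x : (s ∩ t n : Set ℝ) => g x := fun n =>
    (continuousOn_iff_continuous_domRestrict.mp (hgc.mono inter_subset_left)).measurable
  have hwm : ∀ n, Measurable fun x : (s ∩ t n : Set ℝ) =>
      ENNReal.ofReal |g' x|⁻¹ * f x := by
    intro n
    have h1 : Measurable fun x : (s ∩ t n : Set ℝ) => g' x :=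
      (continuousOn_iff_continuous_domRestrict.mp (hg'm.mono inter_subset_left)).measurable
    have h2 : Measurable fun x : (s ∩ t n : Set ℝ) => f x := hf.comp measurable_subtype_coe
    exact (ENNReal.measurable_ofReal.comp (h1.abs.inv)).mul h2
  have hsum : ∀ κ, ∑' x : {x // x ∈ s ∧ g x = κ}, ENNReal.ofReal |g' x|⁻¹ * f x =
      ∑' n, Function.extend (fun x : (s ∩ t n : Set ℝ) => g x)
        (fun x : (s ∩ t n : Set ℝ) => ENNReal.ofReal |g' x|⁻¹ * f x) 0 κ := fun κ => by
    rw [tsum_fiber_eq_tsum_partition hdisj hsub fun x => ENNReal.ofReal |g' x|⁻¹ * f x]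
    exact tsum_congr fun n => tsum_fiber_of_injOn (hinj n)
      (fun x => ENNReal.ofReal |g' x|⁻¹ * f x) κ
  have hU : s ∩ g ⁻¹' B = ⋃ n, s ∩ t n ∩ g ⁻¹' B := by
    rw [← iUnion_inter, ← inter_iUnion, inter_eq_left.mpr hsub]
  have hmB : ∀ n, MeasurableSet (s ∩ t n ∩ g ⁻¹' B) := fun n =>
    measurableSet_inter_preimage (hm n) (hgm n) hB
  simp_rw [hsum]
  rw [lintegral_tsum fun n => (measurable_extend_injOn (h := fun x => ENNReal.ofReal |g' x|⁻¹ * f x)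
      (hm n) (hgm n) (hinj n) (hwm n)).aemeasurable,
    hU, lintegral_iUnion hmB fun i j hij => (hdisj hij).mono
      (fun x hx => hx.1.2) (fun x hx => hx.1.2)]
  exact tsum_congr fun n => lintegral_extend_injOn (hm n) hB (hgm n)
    (fun x hx => (hg x hx.1).mono inter_subset_left) (fun x hx => hg' x hx.1) (hinj n) f

/-! ### Rates, moments and the law of the mean growth -/

namespace Model

variable (M : Model)

instance isProbabilityMeasure_μx : IsProbabilityMeasure M.μx :=
  ⟨by rw [μx, withDensity_apply _ .univ, Measure.restrict_univ]; exact M.lintegral_ρ⟩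

lemma ae_mem_Ωx : ∀ᵐ x ∂M.μx, x ∈ M.Ωx :=
  (withDensity_absolutelyContinuous _ _).ae_le (ae_restrict_mem M.measurableSet_Ωx)

lemma measurable_K_right (x : ℝ) : Measurable (M.K x) :=
  M.measurable_K.comp measurable_prodMk_left

lemma measurable_weightPDF_right (x : ℝ) : Measurable (M.weightPDF x) :=
  M.measurable_weightPDF.comp measurable_prodMk_left

lemma arrivalIntensity_univ (x : ℝ) :
    M.arrivalIntensity x univ = ∫⁻ y in M.Ωy, (M.K x y : ℝ≥0∞) * M.φ y := by
  rw [arrivalIntensity, withDensity_apply _ .univ, Measure.restrict_univ, μy,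
    lintegral_withDensity_eq_lintegral_mul _ M.measurable_φ.coe_nnreal_ennreal
      (M.measurable_K_right x).coe_nnreal_ennreal]
  exact lintegral_congr fun y => mul_comm (M.φ y : ℝ≥0∞) _

lemma isFiniteMeasure_arrivalIntensity {x : ℝ} (hx : x ∈ M.Ωx) :
    IsFiniteMeasure (M.arrivalIntensity x) :=
  ⟨by rw [arrivalIntensity_univ]; exact M.lintegral_K_lt_top x hx⟩

lemma rate_nonneg (x : ℝ) : 0 ≤ M.rate x := measureReal_nonneg

lemma rate_eq (x : ℝ) : M.rate x = ∫ y in M.Ωy, (M.K x y : ℝ) * M.φ y := by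
  rw [rate, measureReal_def, arrivalIntensity_univ, integral_eq_lintegral_of_nonneg_ae]
  · congr 1
    refine lintegral_congr fun y => ?_
    rw [← NNReal.coe_mul, ENNReal.ofReal_coe_nnreal, ENNReal.coe_mul]
  · exact .of_forall fun y => by positivity
  · exact ((M.measurable_K_right x).coe_nnreal_real.mul
      M.measurable_φ.coe_nnreal_real).aestronglyMeasurable

lemma measurable_rate : Measurable M.rate := by
  have h : M.rate = fun x => (∫⁻ y in M.Ωy, (M.K x y : ℝ≥0∞) * M.φ y).toReal := by
    ext x
    rw [rate, measureReal_def, arrivalIntensity_univ]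
  rw [h]
  refine Measurable.ennreal_toReal (Measurable.lintegral_prod_right'
    (f := fun p : ℝ × ℝ => (M.K p.1 p.2 : ℝ≥0∞) * M.φ p.2) ?_)
  exact M.measurable_K.coe_nnreal_ennreal.mul
    (M.measurable_φ.comp measurable_snd).coe_nnreal_ennreal

lemma measurable_weightMoment (n : ℕ) : Measurable (M.weightMoment n) := by
  refine StronglyMeasurable.measurable (StronglyMeasurable.integral_prod_right'
    (f := fun p : ℝ × ℝ => p.2 ^ n * (M.weightPDF p.1 p.2 : ℝ)) ?_)
  exact ((measurable_snd.pow_const n).mul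
    M.measurable_weightPDF.coe_nnreal_real).stronglyMeasurable

lemma isProbabilityMeasure_weightLaw {x : ℝ} (hx : x ∈ M.Ωx) :
    IsProbabilityMeasure (M.weightLaw x) :=
  isProbabilityMeasure_jumpLaw (M.lintegral_weightPDF x hx)

lemma weightMoment_eq_integral (n : ℕ) (x : ℝ) :
    M.weightMoment n x = ∫ r, r ^ n ∂M.weightLaw x := by
  refine Eq.trans ?_ (integral_jumpLaw (M.measurable_weightPDF_right x) fun r => r ^ n).symm
  exact integral_congr_ae (.of_forall fun r => mul_comm _ _)

lemma integrable_sq_weightLaw {x : ℝ} (h2 : M.FiniteSecondMoment x) :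
    Integrable (fun r : ℝ => r ^ 2) (M.weightLaw x) := by
  rw [weightLaw, integrable_withDensity_iff_integrable_smul (M.measurable_weightPDF_right x)]
  refine h2.congr (.of_forall fun r => ?_)
  simp [NNReal.smul_def, mul_comm]

lemma memLp_weightLaw {x : ℝ} (h2 : M.FiniteSecondMoment x) : MemLp id 2 (M.weightLaw x) :=
  (memLp_two_iff_integrable_sq aestronglyMeasurable_id).mpr (M.integrable_sq_weightLaw h2)

lemma weightMoment_pos {x : ℝ} (hx : x ∈ M.Ωx) {n : ℕ}
    (hn : Integrable (fun r : ℝ => r ^ n) (M.weightLaw x)) : 0 < M.weightMoment n x := by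
  have := M.isProbabilityMeasure_weightLaw hx
  have hpos : ∀ᵐ r ∂M.weightLaw x, 0 < r :=
    (withDensity_absolutelyContinuous _ _).ae_le (ae_restrict_mem measurableSet_Ioi)
  rw [weightMoment_eq_integral, integral_pos_iff_support_of_nonneg_ae
    (hpos.mono fun r hr => (pow_pos hr n).le) hn]
  have h : (Function.support fun r : ℝ => r ^ n) =ᵐ[M.weightLaw x] univ :=
    eventuallyEq_univ.mpr (hpos.mono fun r hr => (pow_pos hr n).ne')
  rw [measure_congr h, measure_univ]
  exact one_pos

lemma weightMoment_one_pos {x : ℝ} (hx : x ∈ M.Ωx) (h2 : M.FiniteSecondMoment x) :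
    0 < M.weightMoment 1 x := by
  have := M.isProbabilityMeasure_weightLaw hx
  refine M.weightMoment_pos hx ?_
  simp only [pow_one]
  exact (M.memLp_weightLaw h2).integrable one_le_two

lemma weightMoment_two_pos {x : ℝ} (hx : x ∈ M.Ωx) (h2 : M.FiniteSecondMoment x) :
    0 < M.weightMoment 2 x :=
  M.weightMoment_pos hx (M.integrable_sq_weightLaw h2)

lemma lintegral_μx {f : ℝ → ℝ≥0∞} (hf : Measurable f) :
    ∫⁻ x, f x ∂M.μx = ∫⁻ x in M.Ωx, f x * M.ρ x := by
  rw [μx, lintegral_withDensity_eq_lintegral_mul _ M.measurable_ρ.coe_nnreal_ennreal hf]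
  exact lintegral_congr fun x => mul_comm (M.ρ x : ℝ≥0∞) _

/-- The sum over the zeros of `z` is the density of the law of `t ν_x ⟨r⟩_x`. -/
theorem withDensity_rootSum {t : ℝ} (hU : UniqueDiffOn ℝ M.Ωx)
    (hz : ∀ κ : ℝ, ContDiffOn ℝ 1 (M.z κ t) M.Ωx ∧
      ∀ x ∈ M.Ωx, derivWithin (M.z κ t) M.Ωx x ≠ 0) :
    volume.withDensity (fun κ => M.rootSum κ t) =
      M.μx.map fun x => t * (M.rate x * M.weightMoment 1 x) := by
  -- Since `z = κ - g`, its zeros form the fiber of `g` over `κ`, and `|z'| = |g'|` does not depend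
  -- on `κ`.
  set g : ℝ → ℝ := fun x => t * (M.rate x * M.weightMoment 1 x) with hg_def
  have hgm : Measurable g := (M.measurable_rate.mul (M.measurable_weightMoment 1)).const_mul t
  have hzg : ∀ κ, M.z κ t = fun x => κ - g x := fun κ => by
    ext x
    simp only [z, hg_def]
    ring
  have hgz : g = fun x => -M.z 0 t x := by
    ext x
    simp [hzg]
  have hgd : ContDiffOn ℝ 1 g M.Ωx := by
    rw [hgz]
    exact (hz 0).1.neg
  have hder : ∀ κ, ∀ x ∈ M.Ωx,
      derivWithin (M.z κ t) M.Ωx x = -derivWithin g M.Ωx x := fun κ x hx => by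
    rw [hzg]
    exact derivWithin_const_sub _
  have hgw : ∀ x ∈ M.Ωx, HasDerivWithinAt g (derivWithin g M.Ωx x) M.Ωx x := fun x hx =>
    (hgd.differentiableOn one_ne_zero x hx).hasDerivWithinAt
  have hg0 : ∀ x ∈ M.Ωx, derivWithin g M.Ωx x ≠ 0 := fun x hx h => by
    apply (hz 0).2 x hx
    rw [hder 0 x hx, h, neg_zero]
  have hroot : ∀ κ, M.rootSum κ t = ∑' x : {x // x ∈ M.Ωx ∧ g x = κ},
      ENNReal.ofReal |derivWithin g M.Ωx x|⁻¹ * (M.ρ x : ℝ≥0∞) := fun κ => by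
    have he : ∀ x, x ∈ M.Ωx ∧ M.z κ t x = 0 ↔ x ∈ M.Ωx ∧ g x = κ := fun x => by
      rw [hzg, sub_eq_zero, eq_comm (a := κ)]
    rw [← (Equiv.subtypeEquivRight he).tsum_eq]
    refine tsum_congr fun x => ?_
    rw [hder κ _ x.2.1, abs_neg, ENNReal.ofReal_mul (by positivity), ENNReal.ofReal_coe_nnreal]
    rfl
  ext B hB
  rw [withDensity_apply _ hB]
  simp_rw [hroot]
  rw [lintegral_tsum_fiber M.measurableSet_Ωx hB hgw hg0
    (hgd.continuousOn_derivWithin hU le_rfl) M.measurable_ρ.coe_nnreal_ennreal,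
    Measure.map_apply hgm hB, μx, withDensity_apply _ (hgm hB),
    Measure.restrict_restrict (hgm hB), inter_comm]

end Model

/-! ### Visit distributions of the network -/

namespace Network

variable {M : Model} {Ω : Type*} [MeasurableSpace Ω] {P : Measure Ω} (N : Network M P)

lemma isProbabilityMeasure_condVisit (x t : ℝ) : IsProbabilityMeasure (N.condVisit x t) := by
  have := N.isMarkov
  exact Measure.isProbabilityMeasure_map (measurable_strength t).aemeasurable

lemma measurable_condVisit (t : ℝ) : Measurable fun x => N.condVisit x t :=
  (Measure.measurable_map _ (measurable_strength t)).comp N.classLaw.measurable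

lemma condVisit_eq_compoundPoisson {x t : ℝ} (hx : x ∈ M.Ωx) (ht : 0 ≤ t) :
    N.condVisit x t = compoundPoisson (M.rate x * t).toNNReal (M.weightLaw x) := by
  have := N.isMarkov
  have := M.isFiniteMeasure_arrivalIntensity hx
  have := M.isProbabilityMeasure_weightLaw hx
  exact map_strength_eq_compoundPoisson (N.arrivals x hx) (N.weights x hx) ht

lemma masterEquation_condVisit {x : ℝ} (hx : x ∈ M.Ωx) :
    MasterEquation (M.rate x) (M.weightPDF x) (N.condVisit x) := by
  have h := masterEquation_compoundPoisson (M.measurable_weightPDF_right x)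
    (M.lintegral_weightPDF x hx) (M.rate_nonneg x)
  intro B hB t ht
  have hB' := h B hB t ht
  simp only [N.condVisit_eq_compoundPoisson hx ht]
  exact hB'.congr (fun s hs => by rw [N.condVisit_eq_compoundPoisson hx hs]; rfl)
    (by rw [N.condVisit_eq_compoundPoisson hx ht]; rfl)

lemma condVisit_zero {x : ℝ} (hx : x ∈ M.Ωx) : N.condVisit x 0 = Measure.dirac 0 := by
  have := M.isProbabilityMeasure_weightLaw hx
  rw [N.condVisit_eq_compoundPoisson hx le_rfl, mul_zero, Real.toNNReal_zero]
  refine Measure.ext_of_charFun ?_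
  ext ξ
  simp [charFun_compoundPoisson, charFun_dirac]

/-- The conditional visit distribution is asymptotically normal. -/
theorem tendsto_tvDist_condVisit_gaussianReal {x : ℝ} (hx : x ∈ M.Ωx) (hν : 0 < M.rate x)
    (h2 : M.FiniteSecondMoment x) :
    Tendsto (fun t : ℝ => tvDist (N.condVisit x t)
      (gaussianReal (t * (M.rate x * M.weightMoment 1 x))
        (t.toNNReal * (M.rate x * M.weightMoment 2 x).toNNReal))) atTop (𝓝 0) := by
  have := M.isProbabilityMeasure_weightLaw hx
  have hm2 := M.weightMoment_two_pos hx h2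
  have hclt := tendsto_tvDist_compoundPoisson_gaussianReal (M.weightLaw x)
    (jumpLaw_absolutelyContinuous _) (M.memLp_weightLaw h2) (v := (M.weightMoment 2 x).toNNReal)
    (by rw [Real.coe_toNNReal _ hm2.le, M.weightMoment_eq_integral])
    (by simpa using hm2)
  have hs : Tendsto (fun t : ℝ => (M.rate x * t).toNNReal) atTop atTop :=
    tendsto_real_toNNReal_atTop.comp (tendsto_id.const_mul_atTop hν)
  refine (hclt.comp hs).congr' ?_
  filter_upwards [eventually_ge_atTop 0] with t ht
  have hmean : ∫ r, r ∂M.weightLaw x = M.weightMoment 1 x := by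
    simp [M.weightMoment_eq_integral]
  rw [Function.comp_apply, N.condVisit_eq_compoundPoisson hx ht, hmean,
    Real.coe_toNNReal _ (by positivity), Real.toNNReal_mul hν.le, Real.toNNReal_mul hν.le]
  congr 2 <;> ring

/-- The averaged empirical measure sees only the law of a single location, which is common to all of
them and disintegrates over the attractiveness. -/
lemma visitDistribution_eq_bind {n : ℕ} (hn : 0 < n) (t : ℝ) :
    N.visitDistribution n t = M.μx.bind fun x => N.condVisit x t := by
  have := N.isMarkov
  have h : ∀ i, P.map (fun ω => strength t (N.trips i ω)) = M.μx.bind fun x => N.condVisit x t := by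
    intro i
    ext B hB
    have hs := measurable_strength t
    have hs2 : Measurable fun p : ℝ × TripRecord => strength t p.2 := hs.comp measurable_snd
    have hpair : Measurable fun ω => (N.X i ω, N.trips i ω) :=
      (N.measurable_X i).prodMk (N.measurable_trips i)
    have hmap : P.map (fun ω => strength t (N.trips i ω)) =
        (P.map fun ω => (N.X i ω, N.trips i ω)).map fun p => strength t p.2 :=
      (Measure.map_map hs2 hpair).symm
    rw [hmap, N.law, Measure.map_apply hs2 hB,
      Measure.compProd_apply (hs2 hB),
      Measure.bind_apply hB (N.measurable_condVisit t).aemeasurable]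
    refine lintegral_congr fun x => ?_
    rw [condVisit, Measure.map_apply hs hB]
    rfl
  rw [visitDistribution, Finset.sum_congr rfl fun i _ => h i, Finset.sum_const,
    Finset.card_range, ← Nat.cast_smul_eq_nsmul ℝ≥0∞, smul_smul,
    ENNReal.inv_mul_cancel (by simpa using hn.ne') (ENNReal.natCast_ne_top n), one_smul]

theorem visitDistribution_apply {n : ℕ} (hn : 0 < n) (t : ℝ) {B : Set ℝ} (hB : MeasurableSet B) :
    N.visitDistribution n t B = ∫⁻ x in M.Ωx, N.condVisit x t B * M.ρ x := by
  rw [N.visitDistribution_eq_bind hn, Measure.bind_apply hB (N.measurable_condVisit t).aemeasurable]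
  exact M.lintegral_μx ((Measure.measurable_coe hB).comp (N.measurable_condVisit t))

theorem asympEqTV_condVisit_truncNormal {x : ℝ} (hx : x ∈ M.Ωx) (hν : 0 < M.rate x)
    (h2 : M.FiniteSecondMoment x) :
    AsympEqTV (N.condVisit x) fun t => truncNormal
      (M.rate x * M.weightMoment 1 x * t) (M.rate x * M.weightMoment 2 x * t) := by
  have ha := mul_pos hν (M.weightMoment_one_pos hx h2)
  have hb := mul_pos hν (M.weightMoment_two_pos hx h2)
  rw [asympEqTV_iff]
  have h1 := N.tendsto_tvDist_condVisit_gaussianReal hx hν h2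
  have h3 := h1.add (tendsto_tvDist_gaussianReal_truncNormal ha hb)
  rw [add_zero] at h3
  refine tendsto_of_tendsto_of_tendsto_of_le_of_le tendsto_const_nhds h3 (fun _ => zero_le)
    fun t => ?_
  dsimp only
  rw [mul_comm t, mul_comm t.toNNReal, ← Real.toNNReal_mul hb.le]
  exact tvDist_triangle _ _ _

theorem asympEqTV_visitDistribution (hU : UniqueDiffOn ℝ M.Ωx)
    (h2 : ∀ x ∈ M.Ωx, M.FiniteSecondMoment x)
    (hz : ∀ κ t : ℝ, 0 < t → ContDiffOn ℝ 1 (M.z κ t) M.Ωx ∧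
      ∀ x ∈ M.Ωx, derivWithin (M.z κ t) M.Ωx x ≠ 0) {n : ℕ} (hn : 0 < n) :
    AsympEqTV (N.visitDistribution n) fun t => volume.withDensity fun κ => M.rootSum κ t := by
  have hG : Measurable fun x => M.rate x * M.weightMoment 1 x :=
    M.measurable_rate.mul (M.measurable_weightMoment 1)
  -- At `t = 1` the sum over zeros is a density of the law of `ν_x ⟨r⟩_x`.
  have hac : M.μx.map (fun x => M.rate x * M.weightMoment 1 x) ≪ volume := by
    have h := M.withDensity_rootSum hU fun κ => hz κ 1 one_pos
    simp only [one_mul] at h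
    rw [← h]
    exact withDensity_absolutelyContinuous _ _
  -- An absolutely continuous law has no atom at `0`, so almost every rate is positive, as the
  -- normal approximation requires.
  have hν : ∀ᵐ x ∂M.μx, 0 < M.rate x := by
    have h0 := hac (measure_singleton (0 : ℝ))
    rw [Measure.map_apply hG (measurableSet_singleton 0)] at h0
    have h1 : ∀ᵐ x ∂M.μx, ¬ M.rate x * M.weightMoment 1 x = 0 := measure_eq_zero_iff_ae_notMem.mp h0
    filter_upwards [h1] with x hx
    exact (M.rate_nonneg x).lt_of_ne fun h => hx (by rw [← h, zero_mul])
  have := N.isProbabilityMeasure_condVisit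
  have h := tendsto_tvDist_bind_map (μ := M.μx) (κ := fun t x => N.condVisit x t)
    N.measurable_condVisit hG (v := fun x => (M.rate x * M.weightMoment 2 x).toNNReal)
    (M.measurable_rate.mul (M.measurable_weightMoment 2)).real_toNNReal hac
    (by
      filter_upwards [M.ae_mem_Ωx, hν] with x hx hxν
      exact (Real.toNNReal_pos.mpr (mul_pos hxν (M.weightMoment_two_pos hx (h2 x hx)))).ne')
    (by
      filter_upwards [M.ae_mem_Ωx, hν] with x hx hxν
      exact N.tendsto_tvDist_condVisit_gaussianReal hx hxν (h2 x hx))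
  rw [asympEqTV_iff]
  refine h.congr' ?_
  filter_upwards [eventually_gt_atTop 0] with t ht
  rw [N.visitDistribution_eq_bind hn, M.withDensity_rootSum hU fun κ => hz κ t ht]

end Network

end TripMobility

end

/-! ### The proposition -/

theorem proposition1 (M : TripMobility.Model) {Ω : Type*} [MeasurableSpace Ω]
    (P : Measure Ω) [IsProbabilityMeasure P] (N : TripMobility.Network M P) :
    -- the attraction rate, and its meaning as a transition rate of the number of visits
    (∀ x ∈ M.Ωx, M.rate x = ∫ y in M.Ωy, (M.K x y : ℝ) * M.φ y ∧
      ∀ (k : ℕ) (t : ℝ), 0 ≤ t → Tendsto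
        (fun h : ℝ => (N.classLaw x).real
          {τ | TripMobility.visits t τ = k ∧ TripMobility.visits (t + h) τ = k + 1} / h)
        (𝓝[>] 0)
        (𝓝 (M.rate x * (N.classLaw x).real {τ | TripMobility.visits t τ = k}))) ∧
    -- the master equation with initial condition, which determines the visit distribution
    (∀ x ∈ M.Ωx,
      (∀ t : ℝ, IsProbabilityMeasure (N.condVisit x t)) ∧
      N.condVisit x 0 = Measure.dirac 0 ∧
      TripMobility.MasterEquation (M.rate x) (M.weightPDF x) (N.condVisit x) ∧
      (∀ p : ℝ → Measure ℝ, (∀ t, 0 ≤ t → IsFiniteMeasure (p t)) → p 0 = Measure.dirac 0 →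
        TripMobility.MasterEquation (M.rate x) (M.weightPDF x) p →
        ∀ t, 0 ≤ t → p t = N.condVisit x t)) ∧
    -- the master equation pointwise, for the density next to the atom at `0`
    (∀ x ∈ M.Ωx, ∃ q : ℝ → ℝ → ℝ, Measurable (Function.uncurry q) ∧ (∀ κ t, 0 ≤ q κ t) ∧
      (∀ t, 0 ≤ t → N.condVisit x t =
        ENNReal.ofReal (Real.exp (-(M.rate x * t))) • Measure.dirac 0 +
          (volume.restrict (Ioi 0)).withDensity (fun κ => ENNReal.ofReal (q κ t))) ∧
      ∀ᵐ κ ∂(volume.restrict (Ioi (0 : ℝ))), ∀ t, 0 ≤ t →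
        IntervalIntegrable (fun r => M.weightPDF x r * q (κ - r) t) volume 0 κ ∧
        HasDerivWithinAt (fun s => q κ s)
          (M.rate x * ((∫ r in (0 : ℝ)..κ, M.weightPDF x r * q (κ - r) t) +
            M.weightPDF x κ * Real.exp (-(M.rate x * t))) - M.rate x * q κ t) (Ici 0) t) ∧
    -- the conditional visit distribution is asymptotically a truncated normal law
    (∀ x ∈ M.Ωx, 0 < M.rate x → M.FiniteSecondMoment x →
      TripMobility.AsympEqTV (N.condVisit x)
        (fun t => TripMobility.truncNormal
          (M.rate x * M.weightMoment 1 x * t) (M.rate x * M.weightMoment 2 x * t)) ∧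
      Tendsto (fun t => TripMobility.truncFactor
          (M.rate x * M.weightMoment 1 x * t) (M.rate x * M.weightMoment 2 x * t))
        atTop (𝓝 1)) ∧
    -- the overall visit distribution is a mixture
    (∀ n : ℕ, 0 < n → ∀ t : ℝ, 0 ≤ t → ∀ B : Set ℝ, MeasurableSet B →
      N.visitDistribution n t B = ∫⁻ x in M.Ωx, N.condVisit x t B * M.ρ x) ∧
    -- its asymptotic form
    (UniqueDiffOn ℝ M.Ωx → (∀ x ∈ M.Ωx, M.FiniteSecondMoment x) →
      (∀ κ t : ℝ, 0 < t → ContDiffOn ℝ 1 (M.z κ t) M.Ωx ∧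
        ∀ x ∈ M.Ωx, derivWithin (M.z κ t) M.Ωx x ≠ 0) →
      ∀ n : ℕ, 0 < n → TripMobility.AsympEqTV (N.visitDistribution n)
        (fun t => volume.withDensity (fun κ => M.rootSum κ t))) := by
  refine ⟨fun x hx => ⟨M.rate_eq x, fun k t ht => ?_⟩, fun x hx =>
    ⟨N.isProbabilityMeasure_condVisit x, N.condVisit_zero hx, N.masterEquation_condVisit hx,
      fun p hp hp0 hpM t ht => ?_⟩, fun x hx => ?_, fun x hx hν h2 =>
    ⟨N.asympEqTV_condVisit_truncNormal hx hν h2, TripMobility.tendsto_truncFactor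
      (mul_pos hν (M.weightMoment_one_pos hx h2)) (mul_pos hν (M.weightMoment_two_pos hx h2))⟩,
    fun n hn t _ B hB => N.visitDistribution_apply hn t hB,
    fun hU h2 hz n hn => N.asympEqTV_visitDistribution hU h2 hz hn⟩
  · have := N.isMarkov
    have := M.isFiniteMeasure_arrivalIntensity hx
    exact (N.arrivals x hx).tendsto_visits_jump ht k
  · have := N.isProbabilityMeasure_condVisit x
    exact TripMobility.MasterEquation.unique (M.measurable_weightPDF_right x)
      (M.lintegral_weightPDF x hx) (M.rate_nonneg x) hp (fun t _ => inferInstance) hp0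
      (N.condVisit_zero hx) hpM (N.masterEquation_condVisit hx) ht
  · obtain ⟨q, hqm, hq0, hq, hqd⟩ := TripMobility.exists_density_compoundPoisson
      (M.measurable_weightPDF_right x) (M.lintegral_weightPDF x hx) (M.rate_nonneg x)
    exact ⟨q, hqm, hq0, fun t ht =>
      (N.condVisit_eq_compoundPoisson hx ht).trans (hq t ht), hqd⟩
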